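/- Let $d\ge 2$, let $\Omega\subset\mathbb R^d$ be a lattice with fundamental domain $F$ of volume $1$, let $\Gamma=\{\gamma\in\mathbb R^d:(\gamma,\omega)\in2\pi\mathbb Z\ \forall\omega\in\Omega\}$ be its dual lattice, and let $q\in W_2^s(F)$, $s\ge 6(3^d(d+1)^2)+d$, be a real $\Omega$-periodic potential with Fourier coefficients $q_\gamma=\int_F q(x)e^{-i(\gamma,x)}dx$ and $q_0=0$; here $q\in W_2^s(F)$ means $q\in L^2(F)$ and $\sum_{\gamma\in\Gamma}|q_\gamma|^2(1+|\gamma|^{2s})<\infty$. A maximal element of a lattice is a nonzero element of the lattice that has minimal norm among the nonzero lattice elements on the line through it and $0$. Let $\delta$ be a maximal element of $\Gamma$ and suppose that the directional potential $q^\delta(x)=Q((\delta,x))$, $Q(\zeta)=\sum_{n\in\mathbb Z}q_{n\delta}e^{in\zeta}$, has the form $$q^\delta(x)=q_\delta e^{i(\delta,x)}+q_{-\delta}e^{-i(\delta,x)} .$$ Let $v\in(0,\tfrac12)\cup(\tfrac12,1)$, and let $\mu_n(v)$, $n\in\mathbb Z$, be the eigenvalues, numbered in the same order as the numbers $|n+v|$,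 and $\varphi_{n,v}$ corresponding eigenfunctions, normalized by $\int_F|\varphi_{n,v}((\delta,x))|^2dx=1$, of the problem $$-|\delta|^2y''(\zeta)+Q(\zeta)y(\zeta)=\mu y(\zeta),\qquad y(\zeta+2\pi)=e^{2\pi iv}y(\zeta).$$ Then, uniformly in $\zeta=(\delta,x)\in\mathbb R$, as $|n|\to\infty$, $$|\varphi_{n,v}(\zeta)|^2=A_0+\frac{A_1}{n}+\frac{A_2}{n^2}+\frac{A_3}{n^3}+\frac{A_4}{n^4}+O\Big(\frac1{|n|^5}\Big),$$ where $A_0=1$, $A_1=0$, and $$A_2=\frac{q^\delta}{2|\delta|^2}+a_1|q_\delta|^2,\qquad A_3=a_2q^\delta+a_3|q_\delta|^2,\qquad A_4=a_4q^\delta+a_5\big(q_\delta^2e^{2i(\delta,x)}+q_{-\delta}^2e^{-2i(\delta,x)}\big)+a_6,$$ with $$a_1=a_3=a_6=0,\qquad a_2=-\frac{v}{|\delta|^2},\qquad a_4=\frac{12v^2+1}{8|\delta|^2},\qquad a_5=\frac{3}{8|\delta|^4}.$$ Consequently, let $\Gamma_\delta$ be the dual lattice, in the hyperplane $\{x:(x,\delta)=0\}$,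 of $\Omega_\delta=\{h\in\Omega:(h,\delta)=0\}$, let $b$ be any maximal element of $\Gamma_\delta$, let $S(\delta,b)$ be the set of elements of $\Gamma$ in the plane spanned by $\delta$ and $b$, and put $$q_{\delta,b}(x)=\sum_{\gamma\in S(\delta,b)\setminus\delta\mathbb R}\frac{\gamma}{(b,\gamma)}q_\gamma e^{i(\gamma,x)},\quad J(\delta,b,n,v)=\int_F|q_{\delta,b}(x)\varphi_{n,v}((\delta,x))|^2dx,\quad J_k=\int_F|q_{\delta,b}(x)|^2A_k((\delta,x))\,dx .$$ The series for $q_{\delta,b}(x)$ converges absolutely for every $x$; the numbers $J_0,\dots,J_4$ are determined successively by the quantities $J(\delta,b,n,v)$ through $$J_k=\lim_{|n|\to\infty}n^k\Big(J(\delta,b,n,v)-\sum_{i<k}\frac{J_i}{n^i}\Big),\qquad 0\le k\le4,$$ and the invariant $\int_F|q_{\delta,b}|^2(q_\delta^2e^{2i(\delta,x)}+q_{-\delta}^2e^{-2i(\delta,x)})dx$ is obtained from them by $$\int_F|q_{\delta,b}(x)|^2\big(q_\delta^2e^{2i(\delta,x)}+q_{-\delta}^2e^{-2i(\delta,x)}\big)dx=\frac{8|\delta|^4}{3}\Big(J_4-\frac{12v^2+1}{4}J_2\Big).$$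 -/

import Mathlib

open MeasureTheory

noncomputable section

namespace PeriodicSchrodinger

/-- The lattice `Ω` in `ℝ^d` generated by a basis `B`. -/
def lattice {d : ℕ} (B : Module.Basis (Fin d) ℝ (EuclideanSpace ℝ (Fin d))) :
    Set (EuclideanSpace ℝ (Fin d)) :=
  (Submodule.span ℤ (Set.range B) : Submodule ℤ (EuclideanSpace ℝ (Fin d)))

/-- The fundamental domain `F` of `Ω`: the half-open parallelepiped spanned by the basis. -/
def cell {d : ℕ} (B : Module.Basis (Fin d) ℝ (EuclideanSpace ℝ (Fin d))) :
    Set (EuclideanSpace ℝ (Fin d)) :=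
  ZSpan.fundamentalDomain B

/-- The dual lattice `Γ = {γ : (γ, ω) ∈ 2πℤ for all ω ∈ Ω}`. -/
def dualLattice {d : ℕ} (B : Module.Basis (Fin d) ℝ (EuclideanSpace ℝ (Fin d))) :
    Set (EuclideanSpace ℝ (Fin d)) :=
  {γ | ∀ ω ∈ lattice B, ∃ k : ℤ, inner ℝ γ ω = 2 * Real.pi * k}

/-- `Γ_δ`: the dual, inside the hyperplane `H_δ = {x : (x, δ) = 0}`, of the lattice
`Ω_δ = {h ∈ Ω : (h, δ) = 0}`. -/
def dualLatticePerp {d : ℕ} (B : Module.Basis (Fin d) ℝ (EuclideanSpace ℝ (Fin d)))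
    (δ : EuclideanSpace ℝ (Fin d)) : Set (EuclideanSpace ℝ (Fin d)) :=
  {β | inner ℝ β δ = 0 ∧
    ∀ h ∈ lattice B, inner ℝ h δ = 0 → ∃ k : ℤ, inner ℝ β h = 2 * Real.pi * k}

/-- `δ` is a maximal element of `L`: a nonzero element of `L` which has minimal norm among
the nonzero elements of `L` on the line `ℝδ`. -/
def IsMaximalElement {d : ℕ} (L : Set (EuclideanSpace ℝ (Fin d)))
    (δ : EuclideanSpace ℝ (Fin d)) : Prop :=
  δ ∈ L ∧ δ ≠ 0 ∧ ∀ γ ∈ L, γ ≠ 0 → (∃ c : ℝ, γ = c • δ) → ‖δ‖ ≤ ‖γ‖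

/-- The Fourier coefficient `q_γ = ∫_F q(x) e^{-i(γ,x)} dx` (for a cell of volume one). -/
def fourierCoeff {d : ℕ} (B : Module.Basis (Fin d) ℝ (EuclideanSpace ℝ (Fin d)))
    (q : EuclideanSpace ℝ (Fin d) → ℝ) (γ : EuclideanSpace ℝ (Fin d)) : ℂ :=
  ∫ x in cell B, (q x : ℂ) * Complex.exp (-(Complex.I * ((inner ℝ γ x : ℝ) : ℂ)))

/-- `q` is a real `Ω`-periodic potential in `W_2^s(F)`:
`q ∈ L²(F)` and `∑_{γ ∈ Γ} |q_γ|² (1 + |γ|^{2s}) < ∞`. -/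
def IsPeriodicSobolev {d : ℕ} (B : Module.Basis (Fin d) ℝ (EuclideanSpace ℝ (Fin d)))
    (s : ℝ) (q : EuclideanSpace ℝ (Fin d) → ℝ) : Prop :=
  (∀ ω ∈ lattice B, ∀ x, q (x + ω) = q x) ∧
  MemLp q 2 (volume.restrict (cell B)) ∧
  Summable (fun γ : dualLattice B =>
    ‖fourierCoeff B q γ‖ ^ 2 * (1 + ‖(γ : EuclideanSpace ℝ (Fin d))‖ ^ (2 * s)))

/-- `Q(ζ) = ∑_{n ∈ ℤ} q_{nδ} e^{inζ}`; the directional potential is `q^δ(x) = Q((δ,x))`. -/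
def directionalProfile {d : ℕ} (B : Module.Basis (Fin d) ℝ (EuclideanSpace ℝ (Fin d)))
    (q : EuclideanSpace ℝ (Fin d) → ℝ) (δ : EuclideanSpace ℝ (Fin d)) (ζ : ℝ) : ℂ :=
  ∑' n : ℤ, fourierCoeff B q ((n : ℝ) • δ) * Complex.exp (Complex.I * n * ζ)

/-- The directional potential `q^δ`. -/
def directionalPotential {d : ℕ} (B : Module.Basis (Fin d) ℝ (EuclideanSpace ℝ (Fin d)))
    (q : EuclideanSpace ℝ (Fin d) → ℝ) (δ x : EuclideanSpace ℝ (Fin d)) : ℂ :=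
  directionalProfile B q δ (inner ℝ δ x)

/-- `S(δ,b) \ δℝ`: the elements of `Γ` in the plane through `0`, `δ`, `b` that are not on the
line `ℝδ`. -/
def planeIndices {d : ℕ} (B : Module.Basis (Fin d) ℝ (EuclideanSpace ℝ (Fin d)))
    (δ b : EuclideanSpace ℝ (Fin d)) : Set (EuclideanSpace ℝ (Fin d)) :=
  {γ | γ ∈ dualLattice B ∧ γ ∈ Submodule.span ℝ {δ, b} ∧ γ ∉ Submodule.span ℝ {δ}}

/-- The summand `(γ / (b,γ)) q_γ e^{i(γ,x)}` of `q_{δ,b}(x)`, a vector of `ℂ^d`. -/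
def planeTerm {d : ℕ} (B : Module.Basis (Fin d) ℝ (EuclideanSpace ℝ (Fin d)))
    (q : EuclideanSpace ℝ (Fin d) → ℝ) (b x γ : EuclideanSpace ℝ (Fin d)) :
    EuclideanSpace ℂ (Fin d) :=
  (fourierCoeff B q γ * Complex.exp (Complex.I * ((inner ℝ γ x : ℝ) : ℂ)) /
      ((inner ℝ b γ : ℝ) : ℂ)) •
    (WithLp.toLp 2 (fun i => ((γ i : ℝ) : ℂ)) : EuclideanSpace ℂ (Fin d))

/-- `q_{δ,b}(x) = ∑_{γ ∈ S(δ,b) \ δℝ} (γ / (b,γ)) q_γ e^{i(γ,x)}`. -/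
def planePotential {d : ℕ} (B : Module.Basis (Fin d) ℝ (EuclideanSpace ℝ (Fin d)))
    (q : EuclideanSpace ℝ (Fin d) → ℝ) (δ b x : EuclideanSpace ℝ (Fin d)) :
    EuclideanSpace ℂ (Fin d) :=
  ∑' γ : planeIndices B δ b, planeTerm B q b x γ

/-- `y` is a (possibly zero) solution of `-D y'' + Q y = lam y`,
`y(ζ + 2π) = e^{2πiv} y(ζ)`. -/
def SolvesFloquet (D : ℝ) (Q : ℝ → ℂ) (v lam : ℝ) (y : ℝ → ℂ) : Prop :=
  ContDiff ℝ 2 y ∧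
  (∀ ζ, -(D : ℂ) * deriv (deriv y) ζ + Q ζ * y ζ = (lam : ℂ) * y ζ) ∧
  (∀ ζ, y (ζ + 2 * Real.pi) = Complex.exp (Complex.I * (2 * Real.pi * v)) * y ζ)

/-- `μ n` (`n ∈ ℤ`) are all the eigenvalues of the boundary value problem `T_v(Q)`, numbered
in the same order as the eigenvalues `(n + v)² D` of the unperturbed problem `T_v(0)`, and
`φ n` are corresponding normalized eigenfunctions (mean of `|φ n|²` over a period equal to
one, which is `∫_F |φ_n((δ,x))|² dx = 1` for a cell `F` of volume one). -/
structure IsEigenSystem (D : ℝ) (Q : ℝ → ℂ) (v : ℝ) (μ : ℤ → ℝ) (φ : ℤ → ℝ → ℂ) : Prop where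
  solves : ∀ n, SolvesFloquet D Q v (μ n) (φ n)
  normalized : ∀ n, (2 * Real.pi)⁻¹ * ∫ ζ in (0 : ℝ)..(2 * Real.pi), ‖φ n ζ‖ ^ 2 = 1
  complete : ∀ (lam : ℝ) (y : ℝ → ℂ), SolvesFloquet D Q v lam y → y ≠ 0 → ∃ n, μ n = lam
  ordered : ∀ m n : ℤ, |(m : ℝ) + v| < |(n : ℝ) + v| → μ m < μ n

/-- `J(δ,b,n,v) = ∫_F |q_{δ,b}(x) φ_{n,v}((δ,x))|² dx`, with `f = φ_{n,v}`. -/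
def invariantJ {d : ℕ} (B : Module.Basis (Fin d) ℝ (EuclideanSpace ℝ (Fin d)))
    (q : EuclideanSpace ℝ (Fin d) → ℝ) (δ b : EuclideanSpace ℝ (Fin d)) (f : ℝ → ℂ) : ℝ :=
  ∫ x in cell B, ‖f (inner ℝ δ x) • planePotential B q δ b x‖ ^ 2

/-- `∫_F |q_{δ,b}(x)|² A((δ,x)) dx`. With `A = A_k` this is `J_k(δ,b)`. -/
def weightedIntegral {d : ℕ} (B : Module.Basis (Fin d) ℝ (EuclideanSpace ℝ (Fin d)))
    (q : EuclideanSpace ℝ (Fin d) → ℝ) (δ b : EuclideanSpace ℝ (Fin d)) (A : ℝ → ℂ) : ℂ :=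
  ∫ x in cell B, ((‖planePotential B q δ b x‖ ^ 2 : ℝ) : ℂ) * A (inner ℝ δ x)

end PeriodicSchrodinger

end

/-!
Write `D = |δ|²`. By the hypothesis on the directional potential, the one-dimensional operator is
`-D y'' + Q y` with `Q(ζ) = q e^{iζ} + conj q e^{-iζ}` (`cosPotential`, where `q = q_δ`), because
`q_{-δ}` is the conjugate of `q_δ` for a real potential.

*The density.* If `y'' = p y` with real `p`, then `w = |y|²` satisfies `w''' = 4 p w' + 2 p' w`. For
`p = (Q - μ)/D` and `L = μ/D` this is a three-term recursion for the Fourier coefficients of `w`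
(`SolvesFloquet.normSq_coeff_recursion`),
`k (4L - k²) w_k = (2/D) ((2k - 1) q w_{k-1} + (2k + 1) conj q w_{k+1})`.
The normalization of `φ n` says `w_0 = 1`. For `μ = μ_n` the divisors `4L - k²` are at least of
order `n` for every `k`, because `2v` is not an integer, and of order `n²` for `|k| ≤ 4`. Hence the
recursion contracts, and `w_1 = 2q / (D(4L - 1))`, `w_2 = 6q² / (D²(4L - 1)(4L - 4))`, with all the
other modes of positive frequency negligible, up to `O(n⁻⁵)` (`coeff_asymptotics`). Replacing `q` by
`conj q` gives the negative frequencies. No asymptotics of the eigenfunctions themselves are needed.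

*The eigenvalues.* It remains to expand `L = μ_n/D` to the accuracy `(n+v)² + O(1/n)`. The numbering
of the `μ_n` is only given through the order of `|n + v|`, so it has to be tied to the unperturbed
eigenvalues `D(n+v)²`. The upper bound `μ_n ≤ D(n+v)² + 2|q|` comes from the min-max principle for
truncated Hermitian matrices (`card_le_card_eigenvalues`), the limits of whose eigenvectors are
eigenfunctions of the full problem, with distinct eigenvalues since these are simple
(`exists_eigenvalues_le`). The lower bound comes from a combination of the eigenfunctions up to `n`
with no Fourier coefficients below `n` (`IsEigenSystem.unperturbed_le_add`). Once
`μ_n = D(n+v)² + O(1)`, the recursion for the coefficients of `φ n` improves the error to `O(1/n)`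
(`IsEigenSystem.exists_abs_sub_le_div`), and the expansion of the density follows
(`IsEigenSystem.exists_density_expansion`).

*The invariant.* In the plane of `δ` and `b`, off the line `ℝδ`, maximality of `b` gives
`|(b, γ)| ≥ |b|²` (`sq_norm_le_abs_inner`). As `∑ |γ| |q_γ|` converges for a Sobolev potential, the
series for `q_{δ,b}` converges absolutely and uniformly, to a bounded continuous function. So the
uniform expansion of the density may be integrated against `|q_{δ,b}|²`, which yields the limits
(`tendsto_coeff_of_expansion`), and a linear combination of `J_4` and `J_2` removes the first
harmonic from `A_4` (`weightedIntegral_secondHarmonic`).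
-/

namespace PeriodicSchrodinger

open ComplexConjugate

/-! ### Fourier coefficients at real frequencies -/

/-- The Fourier coefficient `(2π)⁻¹ ∫₀^{2π} f(ζ) e^{-iκζ} dζ` at a real frequency `κ`. For a
`2π`-periodic `f` the frequencies of interest are the integers, for a function with Floquet
multiplier `e^{2πiv}` they are the numbers `m + v`. -/
noncomputable def freqCoeff (κ : ℝ) (f : ℝ → ℂ) : ℂ :=
  ((2 * Real.pi)⁻¹ : ℝ) * ∫ ζ in (0 : ℝ)..(2 * Real.pi), f ζ * Complex.exp (-(Complex.I * κ * ζ))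

lemma continuous_expNeg (κ : ℝ) : Continuous fun ζ : ℝ => Complex.exp (-(Complex.I * κ * ζ)) := by
  fun_prop

lemma norm_expI (x : ℝ) : ‖Complex.exp (Complex.I * x)‖ = 1 := by
  rw [mul_comm]; exact Complex.norm_exp_ofReal_mul_I x

lemma hasDerivAt_expI (c : ℂ) (ζ : ℝ) :
    HasDerivAt (fun ζ : ℝ => Complex.exp (c * ζ)) (c * Complex.exp (c * ζ)) ζ := by
  have h : HasDerivAt (fun z : ℂ => Complex.exp (c * z)) (c * Complex.exp (c * ζ)) ζ := by
    have := ((hasDerivAt_id (ζ : ℂ)).const_mul c).cexp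
    simpa [mul_comm] using this
  exact h.comp_ofReal

lemma freqCoeff_add {f g : ℝ → ℂ} (hf : Continuous f) (hg : Continuous g) (κ : ℝ) :
    freqCoeff κ (fun ζ => f ζ + g ζ) = freqCoeff κ f + freqCoeff κ g := by
  unfold freqCoeff
  rw [← mul_add, ← intervalIntegral.integral_add]
  · simp only [add_mul]
  · exact (hf.mul (continuous_expNeg κ)).intervalIntegrable _ _
  · exact (hg.mul (continuous_expNeg κ)).intervalIntegrable _ _

lemma freqCoeff_const_mul (a : ℂ) (f : ℝ → ℂ) (κ : ℝ) :
    freqCoeff κ (fun ζ => a * f ζ) = a * freqCoeff κ f := by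
  unfold freqCoeff
  simp only [mul_assoc]
  rw [intervalIntegral.integral_const_mul]
  ring

lemma freqCoeff_finset_sum {ι : Type*} (s : Finset ι) (a : ι → ℂ) {f : ι → ℝ → ℂ}
    (hf : ∀ i ∈ s, Continuous (f i)) (κ : ℝ) :
    freqCoeff κ (fun ζ => ∑ i ∈ s, a i * f i ζ) = ∑ i ∈ s, a i * freqCoeff κ (f i) := by
  simp only [← freqCoeff_const_mul]
  unfold freqCoeff
  rw [← Finset.mul_sum, ← intervalIntegral.integral_finsetSum]
  · simp only [Finset.sum_mul]
  · intro i hi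
    exact ((continuous_const.mul (hf i hi)).mul (continuous_expNeg κ)).intervalIntegrable _ _

lemma freqCoeff_exp_mul (f : ℝ → ℂ) (κ τ : ℝ) :
    freqCoeff κ (fun ζ => Complex.exp (Complex.I * τ * ζ) * f ζ) = freqCoeff (κ - τ) f := by
  unfold freqCoeff
  congr 2
  ext ζ
  beta_reduce
  rw [mul_comm (Complex.exp _) (f ζ), mul_assoc, ← Complex.exp_add]
  push_cast
  ring_nf

/-- Integration by parts: the boundary terms cancel as soon as `f(ζ) e^{-iκζ}` takes the same value
at both ends of the period. -/
lemma freqCoeff_deriv {f f' : ℝ → ℂ} (hf : ∀ ζ, HasDerivAt f (f' ζ) ζ) (hf' : Continuous f')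
    {κ : ℝ} (hper : f (2 * Real.pi) * Complex.exp (-(Complex.I * κ * (2 * Real.pi))) = f 0) :
    freqCoeff κ f' = Complex.I * κ * freqCoeff κ f := by
  have hfc : Continuous f := continuous_iff_continuousAt.2 fun ζ => (hf ζ).continuousAt
  have hd : ∀ ζ ∈ Set.uIcc (0 : ℝ) (2 * Real.pi),
      HasDerivAt (fun ζ : ℝ => f ζ * Complex.exp (-(Complex.I * κ * ζ)))
      (f' ζ * Complex.exp (-(Complex.I * κ * ζ)) -
        Complex.I * κ * (f ζ * Complex.exp (-(Complex.I * κ * ζ)))) ζ := by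
    intro ζ _
    have h2 := hasDerivAt_expI (-(Complex.I * κ)) ζ
    simp only [neg_mul] at h2
    convert! (hf ζ).mul h2 using 1
    ring
  have hi1 : IntervalIntegrable (fun ζ : ℝ => f' ζ * Complex.exp (-(Complex.I * κ * ζ))) volume
    0 (2 * Real.pi) := (hf'.mul (continuous_expNeg κ)).intervalIntegrable _ _
  have hi2 : IntervalIntegrable (fun ζ : ℝ => Complex.I * κ *
    (f ζ * Complex.exp (-(Complex.I * κ * ζ)))) volume 0 (2 * Real.pi) :=
    (continuous_const.mul (hfc.mul (continuous_expNeg κ))).intervalIntegrable _ _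
  have h := intervalIntegral.integral_eq_sub_of_hasDerivAt hd (hi1.sub hi2)
  rw [intervalIntegral.integral_sub hi1 hi2, intervalIntegral.integral_const_mul] at h
  push_cast at h
  rw [hper] at h
  simp only [mul_zero, neg_zero, Complex.exp_zero, mul_one, sub_self] at h
  unfold freqCoeff
  rw [sub_eq_zero.1 h]
  ring

lemma freqCoeff_intCast (f : ℝ → ℂ) (m : ℤ) :
    freqCoeff m f = fourierCoeffOn Real.two_pi_pos f m := by
  rw [fourierCoeffOn_eq_integral]
  unfold freqCoeff
  simp only [sub_zero, one_div, fourier_coe_apply, smul_eq_mul, Complex.real_smul]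
  congr 2
  ext ζ
  rw [mul_comm]
  congr 2
  have : (Real.pi : ℂ) ≠ 0 := by exact_mod_cast Real.pi_ne_zero
  push_cast
  field_simp

/-- Parseval's identity along the shifted frequencies `m + v`. -/
lemma hasSum_sq_freqCoeff {f : ℝ → ℂ} (hf : Continuous f) (v : ℝ) :
    HasSum (fun m : ℤ => ‖freqCoeff (m + v) f‖ ^ 2)
      ((2 * Real.pi)⁻¹ * ∫ ζ in (0 : ℝ)..(2 * Real.pi), ‖f ζ‖ ^ 2) := by
  have hg : Continuous fun ζ : ℝ => Complex.exp (Complex.I * (-v : ℝ) * ζ) * f ζ := by fun_prop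
  have hm : MemLp (fun ζ : ℝ => Complex.exp (Complex.I * (-v : ℝ) * ζ) * f ζ) 2
      (volume.restrict (Set.Ioc 0 (2 * Real.pi))) := by
    rw [memLp_two_iff_integrable_sq_norm hg.aestronglyMeasurable]
    exact ((hg.norm.pow 2).integrableOn_Icc).mono_set Set.Ioc_subset_Icc_self
  have h := hasSum_sq_fourierCoeffOn Real.two_pi_pos hm
  simp only [← freqCoeff_intCast, freqCoeff_exp_mul, sub_neg_eq_add, sub_zero, smul_eq_mul,
    norm_mul] at h
  convert h using 5 with ζ
  rw [mul_assoc, ← Complex.ofReal_mul, norm_expI, one_mul]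

lemma freqCoeff_norm_le {f : ℝ → ℂ} {M : ℝ} (hM : ∀ ζ ∈ Set.Icc 0 (2 * Real.pi), ‖f ζ‖ ≤ M)
    (κ : ℝ) :
    ‖freqCoeff κ f‖ ≤ M := by
  unfold freqCoeff
  have h := intervalIntegral.norm_integral_le_of_norm_le_const (a := 0) (b := 2 * Real.pi) (C := M)
    (f := fun ζ => f ζ * Complex.exp (-(Complex.I * κ * ζ))) (fun ζ hζ => by
      have : -(Complex.I * κ * ζ) = Complex.I * ((-(κ * ζ) : ℝ) : ℂ) := by push_cast; ring
      rw [norm_mul, this, norm_expI, mul_one]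
      rw [Set.uIoc_of_le Real.two_pi_pos.le] at hζ
      exact hM ζ (Set.Ioc_subset_Icc_self hζ))
  rw [norm_mul, Complex.norm_real, Real.norm_of_nonneg (by positivity)]
  calc (2 * Real.pi)⁻¹ * _ ≤ (2 * Real.pi)⁻¹ * (M * |2 * Real.pi - 0|) := by gcongr
    _ = M := by rw [sub_zero, abs_of_pos Real.two_pi_pos]; field_simp

lemma hasSum_freqCoeff {f : ℝ → ℂ} (hf : Continuous f) (hper : f.Periodic (2 * Real.pi))
    (hs : Summable fun m : ℤ => freqCoeff m f) (ζ : ℝ) :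
    HasSum (fun m : ℤ => freqCoeff m f * Complex.exp (Complex.I * (m * ζ))) (f ζ) := by
  have : Fact (0 < 2 * Real.pi) := ⟨Real.two_pi_pos⟩
  let F : C(AddCircle (2 * Real.pi), ℂ) := ⟨hper.lift, by
    apply continuous_coinduced_dom.2
    exact hf⟩
  have hF : ∀ x : ℝ, F (x : AddCircle (2 * Real.pi)) = f x := fun x => hper.lift_coe x
  have hc : ∀ m : ℤ, _root_.fourierCoeff F m = freqCoeff m f := by
    intro m
    rw [freqCoeff_intCast, fourierCoeffOn_eq_integral, fourierCoeff_eq_intervalIntegral _ _ 0]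
    simp only [sub_zero, zero_add, hF, fourier_coe_apply]
  have h := has_pointwise_sum_fourier_series_of_summable (f := F) (by
    convert hs using 1; ext m; exact hc m) (ζ : AddCircle (2 * Real.pi))
  simp only [hc, hF, fourier_coe_apply, smul_eq_mul] at h
  convert h using 4 with m
  have : (Real.pi : ℂ) ≠ 0 := by exact_mod_cast Real.pi_ne_zero
  push_cast
  field_simp

/-! ### Solutions of the Floquet problem -/

/-- The real trigonometric polynomial `q e^{iζ} + conj q e^{-iζ}` of degree one. -/
noncomputable def cosPotential (q : ℂ) (ζ : ℝ) : ℂ :=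
  q * Complex.exp (Complex.I * ζ) + conj q * Complex.exp (-(Complex.I * ζ))

lemma conj_expI (ζ : ℝ) :
    conj (Complex.exp (Complex.I * ζ)) = Complex.exp (-(Complex.I * ζ)) := by
  rw [← Complex.exp_conj]; simp

lemma conj_cosPotential (q : ℂ) (ζ : ℝ) : conj (cosPotential q ζ) = cosPotential q ζ := by
  have h := conj_expI ζ
  have h' : conj (Complex.exp (-(Complex.I * ζ))) = Complex.exp (Complex.I * ζ) := by
    rw [← h, Complex.conj_conj]
  simp only [cosPotential, map_add, map_mul, h, h', Complex.conj_conj]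
  ring

lemma norm_cosPotential_le (q : ℂ) (ζ : ℝ) : ‖cosPotential q ζ‖ ≤ 2 * ‖q‖ := by
  unfold cosPotential
  refine (norm_add_le _ _).trans ?_
  have : -(Complex.I * ζ) = Complex.I * ((-ζ : ℝ) : ℂ) := by push_cast; ring
  rw [norm_mul, norm_mul, this, norm_expI, norm_expI, RCLike.norm_conj]
  linarith

lemma continuous_cosPotential (q : ℂ) : Continuous (cosPotential q) := by
  unfold cosPotential; fun_prop

lemma hasDerivAt_cosPotential (q : ℂ) (ζ : ℝ) :
    HasDerivAt (cosPotential q) (Complex.I * (q * Complex.exp (Complex.I * ζ)) -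
      Complex.I * (conj q * Complex.exp (-(Complex.I * ζ)))) ζ := by
  have h1 := (hasDerivAt_expI Complex.I ζ).const_mul q
  have h2 := (hasDerivAt_expI (-Complex.I) ζ).const_mul (conj q)
  simp only [neg_mul] at h2
  convert! h1.add h2 using 1
  ring

lemma exp_two_pi_int (k : ℤ) :
    Complex.exp (-(Complex.I * (k : ℝ) * (2 * Real.pi))) = 1 := by
  rw [Complex.exp_eq_one_iff]
  exact ⟨-k, by push_cast; ring⟩

lemma freqCoeff_cosPotential_mul (q : ℂ) {f : ℝ → ℂ} (hf : Continuous f) (κ : ℝ) :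
    freqCoeff κ (fun ζ => cosPotential q ζ * f ζ) =
      q * freqCoeff (κ - 1) f + conj q * freqCoeff (κ + 1) f := by
  have h1 := freqCoeff_exp_mul f κ 1
  have h2 := freqCoeff_exp_mul f κ (-1)
  have e1 : freqCoeff κ (fun ζ => cosPotential q ζ * f ζ) =
      freqCoeff κ (fun ζ => q * (Complex.exp (Complex.I * (1 : ℝ) * ζ) * f ζ) +
        conj q * (Complex.exp (Complex.I * (-1 : ℝ) * ζ) * f ζ)) := by
    congr 1
    ext ζ
    have e : Complex.I * ((-1 : ℝ) : ℂ) * ζ = -(Complex.I * ζ) := by push_cast; ring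
    rw [e]
    simp only [cosPotential, Complex.ofReal_one, mul_one]
    ring
  rw [e1, freqCoeff_add (by fun_prop) (by fun_prop), freqCoeff_const_mul, freqCoeff_const_mul,
    h1, h2, sub_neg_eq_add]

namespace SolvesFloquet

variable {D v lam lam' : ℝ} {Q : ℝ → ℂ} {q : ℂ} {y z : ℝ → ℂ}

lemma hasDerivAt (h : SolvesFloquet D Q v lam y) (ζ : ℝ) : HasDerivAt y (deriv y ζ) ζ :=
  (h.1.differentiable (by norm_num) ζ).hasDerivAt

lemma contDiff_deriv (h : SolvesFloquet D Q v lam y) : ContDiff ℝ 1 (deriv y) :=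
  (contDiff_succ_iff_deriv (n := 1)).1 (by simpa [one_add_one_eq_two] using h.1) |>.2.2

lemma hasDerivAt_deriv (h : SolvesFloquet D Q v lam y) (ζ : ℝ) :
    HasDerivAt (deriv y) (deriv (deriv y) ζ) ζ :=
  (h.contDiff_deriv.differentiable (by norm_num) ζ).hasDerivAt

lemma continuous (h : SolvesFloquet D Q v lam y) : Continuous y := h.1.continuous

lemma continuous_deriv (h : SolvesFloquet D Q v lam y) : Continuous (deriv y) :=
  h.contDiff_deriv.continuous

lemma deriv_add_period (h : SolvesFloquet D Q v lam y) (ζ : ℝ) :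
    deriv y (ζ + 2 * Real.pi) = Complex.exp (Complex.I * (2 * Real.pi * v)) * deriv y ζ := by
  have h1 : (fun ζ => y (ζ + 2 * Real.pi)) =
      fun ζ => Complex.exp (Complex.I * (2 * Real.pi * v)) * y ζ := funext h.2.2
  have h2 := ((h.hasDerivAt (ζ + 2 * Real.pi)).comp_add_const ζ (2 * Real.pi))
  rw [h1] at h2
  exact h2.unique ((h.hasDerivAt ζ).const_mul _)

/-- The equation solved for the second derivative. -/
lemma deriv_deriv (hD : D ≠ 0) (h : SolvesFloquet D Q v lam y) (ζ : ℝ) :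
    deriv (deriv y) ζ = (Q ζ - lam) / D * y ζ := by
  have h1 := h.2.1 ζ
  have hD' : (D : ℂ) ≠ 0 := by exact_mod_cast hD
  field_simp
  linear_combination -h1

lemma norm_multiplier : ‖Complex.exp (Complex.I * (2 * Real.pi * v))‖ = 1 := by
  have := norm_expI (2 * Real.pi * v)
  push_cast at this
  exact this

lemma multiplier_mul_conj : Complex.exp (Complex.I * (2 * Real.pi * v)) *
    conj (Complex.exp (Complex.I * (2 * Real.pi * v))) = 1 := by
  rw [Complex.mul_conj, Complex.normSq_eq_norm_sq, norm_multiplier]; simp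

/-- In the basis `e^{i(m+v)ζ}` the equation becomes a three-term recursion. -/
lemma coeff_recursion (hD : D ≠ 0) (h : SolvesFloquet D (cosPotential q) v lam y) (m : ℤ) :
    ((D * (m + v) ^ 2 - lam : ℝ) : ℂ) * freqCoeff (m + v) y =
      -(q * freqCoeff (m - 1 + v) y + conj q * freqCoeff (m + 1 + v) y) := by
  have hexp : Complex.exp (Complex.I * (2 * Real.pi * v)) *
      Complex.exp (-(Complex.I * ((m + v : ℝ) : ℂ) * (2 * Real.pi))) = 1 := by
    rw [← Complex.exp_add, Complex.exp_eq_one_iff]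
    exact ⟨-m, by push_cast; ring⟩
  have p0 := h.2.2 0
  have p1 := h.deriv_add_period 0
  rw [zero_add] at p0 p1
  have h1 := freqCoeff_deriv (κ := m + v) h.hasDerivAt h.continuous_deriv (by
    rw [p0]; linear_combination y 0 * hexp)
  have hc2 : Continuous (deriv (deriv y)) := by
    have : deriv (deriv y) = fun ζ => (cosPotential q ζ - lam) / D * y ζ :=
      funext (h.deriv_deriv hD)
    rw [this]
    have := continuous_cosPotential q
    have := h.continuous
    fun_prop
  have h2 := freqCoeff_deriv (κ := m + v) h.hasDerivAt_deriv hc2 (by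
    rw [p1]; linear_combination deriv y 0 * hexp)
  have h3 : freqCoeff (m + v) (deriv (deriv y)) =
      (1 / D) * freqCoeff (m + v) (fun ζ => cosPotential q ζ * y ζ) +
        (-lam / D) * freqCoeff (m + v) y := by
    rw [← freqCoeff_const_mul, ← freqCoeff_const_mul, ← freqCoeff_add]
    · congr 1
      ext ζ
      rw [h.deriv_deriv hD]
      ring
    · exact continuous_const.mul ((continuous_cosPotential q).mul h.continuous)
    · exact continuous_const.mul h.continuous
  rw [h2, h1, freqCoeff_cosPotential_mul q h.continuous] at h3
  have hD' : (D : ℂ) ≠ 0 := by exact_mod_cast hD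
  have e1 : (m + v - 1 : ℝ) = m - 1 + v := by ring
  have e2 : (m + v + 1 : ℝ) = m + 1 + v := by ring
  rw [e1, e2] at h3
  field_simp at h3
  push_cast at h3 ⊢
  linear_combination (-1 : ℂ) * h3 + (D : ℂ) * (m + v) ^ 2 * freqCoeff (m + v) y *
    Complex.I_sq

/-- Eigenfunctions of different eigenvalues are orthogonal: the difference of the eigenvalues times
the inner product is the increment over a period of the Wronskian of `y` and `conj z`. -/
lemma integral_mul_conj_eq_zero (hD : D ≠ 0) (hy : SolvesFloquet D (cosPotential q) v lam y)
    (hz : SolvesFloquet D (cosPotential q) v lam' z) (hne : lam ≠ lam') :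
    ∫ ζ in (0 : ℝ)..(2 * Real.pi), y ζ * conj (z ζ) = 0 := by
  have hD' : (D : ℂ) ≠ 0 := by exact_mod_cast hD
  have hd : ∀ ζ ∈ Set.uIcc (0 : ℝ) (2 * Real.pi),
      HasDerivAt (fun ζ => deriv y ζ * conj (z ζ) - y ζ * conj (deriv z ζ))
        ((((lam' : ℂ) - lam) / D) * (y ζ * conj (z ζ))) ζ := by
    intro ζ _
    have hz1 := (hz.hasDerivAt ζ).star
    have hz2 := (hz.hasDerivAt_deriv ζ).star
    convert! ((hy.hasDerivAt_deriv ζ).mul hz1).sub ((hy.hasDerivAt ζ).mul hz2) using 1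
    have e : star (deriv (deriv z) ζ) = (cosPotential q ζ - lam') / D * conj (z ζ) := by
      rw [hz.deriv_deriv hD]
      simp [conj_cosPotential]
    rw [e, hy.deriv_deriv hD]
    simp only [RCLike.star_def]
    ring
  have hc := hy.continuous
  have hcz := hz.continuous
  have h := intervalIntegral.integral_eq_sub_of_hasDerivAt hd
    (Continuous.intervalIntegrable (by
      have : Continuous fun ζ => conj (z ζ) := Complex.continuous_conj.comp hcz
      fun_prop) _ _)
  rw [intervalIntegral.integral_const_mul] at h
  have p0 := hy.2.2 0
  have p1 := hy.deriv_add_period 0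
  have r0 := hz.2.2 0
  have r1 := hz.deriv_add_period 0
  rw [zero_add] at p0 p1 r0 r1
  rw [p0, p1, r0, r1, map_mul, map_mul] at h
  have hne' : ((lam' : ℂ) - lam) / D ≠ 0 := by
    apply div_ne_zero _ hD'
    rw [sub_ne_zero]
    exact_mod_cast hne.symm
  have h0 : ((lam' : ℂ) - lam) / D * ∫ ζ in (0 : ℝ)..(2 * Real.pi), y ζ * conj (z ζ) = 0 := by
    rw [h]
    linear_combination (deriv y 0 * conj (z 0) - y 0 * conj (deriv z 0)) *
      multiplier_mul_conj (v := v)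
  exact (mul_eq_zero.1 h0).resolve_left hne'

/-- A solution with vanishing initial data is zero. -/
lemma eq_zero_of_initial (hD : D ≠ 0) (h : SolvesFloquet D (cosPotential q) v lam y) {ζ₀ : ℝ}
    (h0 : y ζ₀ = 0) (h1 : deriv y ζ₀ = 0) : y = 0 := by
  set K : ℝ := max 1 ((2 * ‖q‖ + |lam|) / |D|) with hK
  have hK0 : 0 ≤ K := le_max_of_le_left zero_le_one
  obtain ⟨K', hK'⟩ : ∃ K' : NNReal, (K' : ℝ) = K := ⟨K.toNNReal, Real.coe_toNNReal _ hK0⟩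
  have hp : ∀ t : ℝ, ‖(cosPotential q t - lam) / (D : ℂ)‖ ≤ K := by
    intro t
    rw [norm_div, Complex.norm_real, Real.norm_eq_abs]
    refine le_max_of_le_right ?_
    gcongr
    refine (norm_sub_le _ _).trans ?_
    rw [Complex.norm_real, Real.norm_eq_abs]
    gcongr
    exact norm_cosPotential_le q t
  let F : ℝ → ℂ × ℂ → ℂ × ℂ := fun t x => (x.2, (cosPotential q t - lam) / D * x.1)
  have hF : ∀ t, LipschitzOnWith K' (F t) Set.univ := by
    intro t
    rw [lipschitzOnWith_univ]
    refine LipschitzWith.of_dist_le_mul fun x x' => ?_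
    simp only [F, Prod.dist_eq, hK']
    refine max_le ?_ ?_
    · calc dist x.2 x'.2 ≤ 1 * max (dist x.1 x'.1) (dist x.2 x'.2) := by
            rw [one_mul]; exact le_max_right _ _
        _ ≤ _ := by gcongr; exact le_max_left _ _
    · rw [dist_eq_norm, ← mul_sub, norm_mul]
      calc _ ≤ K * ‖x.1 - x'.1‖ := by gcongr; exact hp t
        _ ≤ _ := by gcongr; rw [← dist_eq_norm]; exact le_max_left _ _
  have hu := ODE_solution_unique_univ (v := F) (s := fun _ => Set.univ) (K := K')
    (f := fun t => (y t, deriv y t)) (g := fun _ => (0, 0)) (t₀ := ζ₀) hF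
    (fun t => ⟨by
      have := (h.hasDerivAt t).prodMk (h.hasDerivAt_deriv t)
      rw [h.deriv_deriv hD] at this
      exact this, trivial⟩)
    (fun t => ⟨by
      have := hasDerivAt_const t ((0, 0) : ℂ × ℂ)
      simp only [F, mul_zero]
      exact this, trivial⟩)
    (by simp [h0, h1])
  funext t
  exact congrArg Prod.fst (congrFun hu t)

lemma sub_const_mul (hy : SolvesFloquet D Q v lam y) (hz : SolvesFloquet D Q v lam z) (a : ℂ) :
    SolvesFloquet D Q v lam (fun ζ => z ζ - a * y ζ) := by
  have hd : deriv (fun ζ => z ζ - a * y ζ) = fun ζ => deriv z ζ - a * deriv y ζ := by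
    funext ζ
    exact ((hz.hasDerivAt ζ).sub ((hy.hasDerivAt ζ).const_mul a)).deriv
  have hdd : deriv (fun ζ => deriv z ζ - a * deriv y ζ) =
      fun ζ => deriv (deriv z) ζ - a * deriv (deriv y) ζ := by
    funext ζ
    exact ((hz.hasDerivAt_deriv ζ).sub ((hy.hasDerivAt_deriv ζ).const_mul a)).deriv
  refine ⟨hz.1.sub (contDiff_const.mul hy.1), fun ζ => ?_, fun ζ => ?_⟩
  · rw [hd, hdd]
    linear_combination hz.2.1 ζ - a * hy.2.1 ζ
  · beta_reduce
    rw [hz.2.2, hy.2.2]; ring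

/-- Eigenvalues are simple when the Floquet multiplier is not `±1`: the Wronskian of two
eigenfunctions is constant and is multiplied by the square of the multiplier over a period. -/
lemma exists_eq_const_mul (hD : D ≠ 0) (hv : v ∈ Set.Ioo (0 : ℝ) (1 / 2) ∪ Set.Ioo (1 / 2 : ℝ) 1)
    (hy : SolvesFloquet D (cosPotential q) v lam y)
    (hz : SolvesFloquet D (cosPotential q) v lam z) (hne : y ≠ 0) :
    ∃ a : ℂ, ∀ ζ, z ζ = a * y ζ := by
  obtain ⟨ζ₀, h0⟩ := Function.ne_iff.1 hne
  rw [Pi.zero_apply] at h0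
  set a := z ζ₀ / y ζ₀ with ha
  have hu := hy.sub_const_mul hz a
  set u := fun ζ => z ζ - a * y ζ with hu_def
  have hu0 : u ζ₀ = 0 := by simp only [hu_def, ha]; field_simp; ring
  have hW : ∀ ζ, HasDerivAt (fun ζ => y ζ * deriv u ζ - deriv y ζ * u ζ) 0 ζ := by
    intro ζ
    convert! ((hy.hasDerivAt ζ).mul (hu.hasDerivAt_deriv ζ)).sub
      ((hy.hasDerivAt_deriv ζ).mul (hu.hasDerivAt ζ)) using 1
    rw [hu.deriv_deriv hD, hy.deriv_deriv hD]
    ring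
  have hconst := is_const_of_deriv_eq_zero (fun ζ => (hW ζ).differentiableAt)
    (fun ζ => (hW ζ).deriv) ζ₀ (ζ₀ + 2 * Real.pi)
  rw [hy.2.2, hu.2.2, hy.deriv_add_period, hu.deriv_add_period, hu0] at hconst
  set e := Complex.exp (Complex.I * (2 * Real.pi * v)) with he
  have he2 : e * e ≠ 1 := by
    rw [he, ← Complex.exp_add]
    intro h
    obtain ⟨k, hk⟩ := Complex.exp_eq_one_iff.1 h
    have hpi : (Real.pi : ℂ) ≠ 0 := by exact_mod_cast Real.pi_ne_zero
    have hk' : (2 * v : ℂ) = k := by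
      have : (2 * Real.pi * Complex.I) * (2 * v : ℂ) = (2 * Real.pi * Complex.I) * k := by
        linear_combination hk
      exact mul_left_cancel₀ (by simp [hpi]) this
    have hk'' : 2 * v = k := by exact_mod_cast hk'
    rcases hv with hv | hv
    · have h1 : (0 : ℝ) < k := by linarith [hv.1]
      have h2 : (k : ℝ) < 1 := by linarith [hv.2]
      have h1' : 0 < k := by exact_mod_cast h1
      have h2' : k < 1 := by exact_mod_cast h2
      omega
    · have h1 : (1 : ℝ) < k := by linarith [hv.1]
      have h2 : (k : ℝ) < 2 := by linarith [hv.2]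
      have h1' : 1 < k := by exact_mod_cast h1
      have h2' : k < 2 := by exact_mod_cast h2
      omega
  have h1 : (1 - e * e) * (y ζ₀ * deriv u ζ₀) = 0 := by linear_combination hconst
  have h2 : deriv u ζ₀ = 0 := by
    rcases mul_eq_zero.1 h1 with h | h
    · exact absurd (sub_eq_zero.1 h).symm he2
    · exact (mul_eq_zero.1 h).resolve_left h0
  refine ⟨a, fun ζ => ?_⟩
  have := congrFun (hu.eq_zero_of_initial hD hu0 h2) ζ
  simpa [hu_def, sub_eq_zero] using this

/-- The density `w = |y|²` of a solution satisfies `w''' = 4 p w' + 2 p' w`, where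
`y'' = p y`. In Fourier coefficients this is a three-term recursion, and since `w''` is continuous
the coefficients are summable. -/
lemma normSq_coeff_recursion (hD : D ≠ 0) (h : SolvesFloquet D (cosPotential q) v lam y) :
    (∀ k : ℤ, (k : ℂ) * (4 * (lam / D) - k ^ 2) * freqCoeff k (fun ζ => y ζ * conj (y ζ)) =
      2 / D * ((2 * k - 1) * q * freqCoeff (k - 1) (fun ζ => y ζ * conj (y ζ)) +
        (2 * k + 1) * conj q * freqCoeff (k + 1) (fun ζ => y ζ * conj (y ζ)))) ∧
    Summable fun k : ℤ => freqCoeff k (fun ζ => y ζ * conj (y ζ)) := by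
  have hD' : (D : ℂ) ≠ 0 := by exact_mod_cast hD
  set e := Complex.exp (Complex.I * (2 * Real.pi * v)) with he
  have hee : e * conj e = 1 := multiplier_mul_conj
  set w : ℝ → ℂ := fun ζ => y ζ * conj (y ζ) with hw
  set w1 : ℝ → ℂ := fun ζ => deriv y ζ * conj (y ζ) + y ζ * conj (deriv y ζ) with hw1
  set p : ℝ → ℂ := fun ζ => (cosPotential q ζ - lam) / D with hp
  set w2 : ℝ → ℂ := fun ζ => 2 * p ζ * w ζ + 2 * (deriv y ζ * conj (deriv y ζ)) with hw2
  set p' : ℝ → ℂ := fun ζ => (Complex.I * (q * Complex.exp (Complex.I * ζ)) -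
      Complex.I * (conj q * Complex.exp (-(Complex.I * ζ)))) / D with hp'
  set w3 : ℝ → ℂ := fun ζ => 4 * p ζ * w1 ζ + 2 * p' ζ * w ζ with hw3
  have hpc : ∀ ζ, conj (p ζ) = p ζ := by
    intro ζ
    simp only [hp, map_div₀, map_sub, conj_cosPotential, Complex.conj_ofReal]
  have hdp : ∀ ζ, HasDerivAt p (p' ζ) ζ := fun ζ =>
    ((hasDerivAt_cosPotential q ζ).sub_const (lam : ℂ)).div_const (D : ℂ)
  have hyy : ∀ ζ, deriv (deriv y) ζ = p ζ * y ζ := h.deriv_deriv hD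
  have hyc : ∀ ζ, HasDerivAt (fun ζ => conj (y ζ)) (conj (deriv y ζ)) ζ :=
    fun ζ => (h.hasDerivAt ζ).star
  have hyc' : ∀ ζ, HasDerivAt (fun ζ => conj (deriv y ζ)) (p ζ * conj (y ζ)) ζ := by
    intro ζ
    have := (h.hasDerivAt_deriv ζ).star
    rw [hyy, star_mul'] at this
    simp only [RCLike.star_def, hpc] at this
    exact this
  have hyy' : ∀ ζ, HasDerivAt (deriv y) (p ζ * y ζ) ζ := by
    intro ζ; rw [← hyy]; exact h.hasDerivAt_deriv ζ
  have d0 : ∀ ζ, HasDerivAt w (w1 ζ) ζ := fun ζ => (h.hasDerivAt ζ).mul (hyc ζ)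
  have d1 : ∀ ζ, HasDerivAt w1 (w2 ζ) ζ := by
    intro ζ
    convert! ((hyy' ζ).mul (hyc ζ)).add ((h.hasDerivAt ζ).mul (hyc' ζ)) using 1
    simp only [hw2, hw]
    ring
  have d2 : ∀ ζ, HasDerivAt w2 (w3 ζ) ζ := by
    intro ζ
    convert! (((hdp ζ).const_mul 2).mul (d0 ζ)).add (((hyy' ζ).mul (hyc' ζ)).const_mul 2) using 1
    simp only [hw3, hw1]
    ring
  have cw : Continuous w := continuous_iff_continuousAt.2 fun ζ => (d0 ζ).continuousAt
  have cw1 : Continuous w1 := continuous_iff_continuousAt.2 fun ζ => (d1 ζ).continuousAt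
  have cw2 : Continuous w2 := continuous_iff_continuousAt.2 fun ζ => (d2 ζ).continuousAt
  have cp : Continuous p := continuous_iff_continuousAt.2 fun ζ => (hdp ζ).continuousAt
  have cp' : Continuous p' := by fun_prop
  have cw3 : Continuous w3 := by fun_prop
  have p0 := h.2.2 0
  have p1 := h.deriv_add_period 0
  rw [zero_add, ← he] at p0 p1
  have pw : w (2 * Real.pi) = w 0 := by
    simp only [hw]
    rw [p0, map_mul]
    linear_combination y 0 * conj (y 0) * hee
  have pw1 : w1 (2 * Real.pi) = w1 0 := by
    simp only [hw1]
    rw [p0, p1, map_mul, map_mul]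
    linear_combination (deriv y 0 * conj (y 0) + y 0 * conj (deriv y 0)) * hee
  have pp : p (2 * Real.pi) = p 0 := by
    simp only [hp, cosPotential]
    have e1 : Complex.exp (Complex.I * (2 * Real.pi : ℝ)) = 1 := by
      rw [Complex.exp_eq_one_iff]; exact ⟨1, by push_cast; ring⟩
    have e2 : Complex.exp (-(Complex.I * (2 * Real.pi : ℝ))) = 1 := by
      rw [Complex.exp_neg, e1, inv_one]
    rw [e1, e2]
    simp
  have pw2 : w2 (2 * Real.pi) = w2 0 := by
    simp only [hw2]
    rw [pp, pw, p1, map_mul]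
    linear_combination 2 * (deriv y 0 * conj (deriv y 0)) * hee
  have f1 : ∀ k : ℤ, freqCoeff k w1 = Complex.I * k * freqCoeff k w := by
    intro k
    have := freqCoeff_deriv (κ := k) d0 cw1 (by rw [pw, exp_two_pi_int, mul_one])
    simpa using this
  have f2 : ∀ k : ℤ, freqCoeff k w2 = Complex.I * k * freqCoeff k w1 := by
    intro k
    have := freqCoeff_deriv (κ := k) d1 cw2 (by rw [pw1, exp_two_pi_int, mul_one])
    simpa using this
  have f3 : ∀ k : ℤ, freqCoeff k w3 = Complex.I * k * freqCoeff k w2 := by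
    intro k
    have := freqCoeff_deriv (κ := k) d2 cw3 (by rw [pw2, exp_two_pi_int, mul_one])
    simpa using this
  constructor
  · intro k
    have split : w3 = fun ζ => ((4 / D : ℂ) * (cosPotential q ζ * w1 ζ) +
        (-4 * lam / D : ℂ) * w1 ζ) + (2 * Complex.I / D : ℂ) *
          (cosPotential q ζ * w ζ) + (-4 * Complex.I / D * conj q : ℂ) *
          (Complex.exp (Complex.I * (-1 : ℝ) * ζ) * w ζ) := by
      funext ζ
      have e : Complex.I * ((-1 : ℝ) : ℂ) * ζ = -(Complex.I * ζ) := by push_cast; ring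
      simp only [hw3, hp, hp', e, cosPotential]
      ring
    have cq := continuous_cosPotential q
    have h3 := f3 k
    rw [f2, f1, split, freqCoeff_add (by fun_prop) (by fun_prop),
      freqCoeff_add (by fun_prop) (by fun_prop), freqCoeff_add (by fun_prop) (by fun_prop),
      freqCoeff_const_mul, freqCoeff_const_mul, freqCoeff_const_mul, freqCoeff_const_mul,
      freqCoeff_cosPotential_mul q cw1, freqCoeff_cosPotential_mul q cw,
      freqCoeff_exp_mul, f1] at h3
    have g1 := f1 (k - 1)
    have g2 := f1 (k + 1)
    push_cast at g1 g2
    rw [sub_neg_eq_add, g1, g2] at h3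
    have hI : Complex.I ≠ 0 := Complex.I_ne_zero
    apply mul_left_cancel₀ hI
    linear_combination -h3 - Complex.I * k ^ 3 * freqCoeff k w * Complex.I_sq
  · obtain ⟨M, hM⟩ := (isCompact_Icc (a := (0 : ℝ)) (b := 2 * Real.pi)).exists_bound_of_continuousOn
      cw2.continuousOn
    have hb : ∀ k : ℤ, ‖freqCoeff k w2‖ ≤ M := fun k =>
      freqCoeff_norm_le (fun ζ hζ => hM ζ hζ) k
    have hs : Summable fun k : ℤ => M * (1 / (k : ℝ) ^ 2) :=
      (Real.summable_one_div_int_pow.2 one_lt_two).mul_left M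
    refine Summable.of_norm_bounded_eventually hs ?_
    filter_upwards [(Set.finite_singleton (0 : ℤ)).compl_mem_cofinite] with k hk
    have hk0 : (k : ℝ) ≠ 0 := by exact_mod_cast hk
    have h2 := hb k
    rw [f2, f1, norm_mul, norm_mul, norm_mul, norm_mul, Complex.norm_I, Complex.norm_intCast] at h2
    have hk2 : 0 < (k : ℝ) ^ 2 := by positivity
    rw [mul_one_div, le_div_iff₀ hk2, ← sq_abs]
    linarith

end SolvesFloquet

/-! ### Solutions from rapidly decreasing coefficient sequences -/

/-- The function `∑ c_m e^{i(m+v)ζ}` with Floquet multiplier `e^{2πiv}`. -/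
noncomputable def floquetSeries (v : ℝ) (c : ℤ → ℂ) (ζ : ℝ) : ℂ :=
  ∑' m : ℤ, c m * Complex.exp (Complex.I * ((m + v : ℝ) : ℂ) * ζ)

section

variable {D v lam : ℝ} {q : ℂ} {c : ℤ → ℂ}

lemma norm_floquetTerm (v : ℝ) (c : ℤ → ℂ) (m : ℤ) (ζ : ℝ) :
    ‖c m * Complex.exp (Complex.I * ((m + v : ℝ) : ℂ) * ζ)‖ = ‖c m‖ := by
  rw [norm_mul, mul_assoc, ← Complex.ofReal_mul, norm_expI, mul_one]

lemma summable_floquetTerm (hc : Summable fun m => ‖c m‖) (ζ : ℝ) :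
    Summable fun m : ℤ => c m * Complex.exp (Complex.I * ((m + v : ℝ) : ℂ) * ζ) :=
  Summable.of_norm (by simpa only [norm_floquetTerm] using hc)

lemma continuous_floquetSeries (hc : Summable fun m => ‖c m‖) :
    Continuous (floquetSeries v c) :=
  continuous_tsum (fun m => by fun_prop) hc fun m ζ => (norm_floquetTerm v c m ζ).le

lemma hasDerivAt_floquetSeries (hc : Summable fun m => ‖c m‖)
    (hc' : Summable fun m : ℤ => ‖Complex.I * ((m + v : ℝ) : ℂ) * c m‖) (ζ : ℝ) :
    HasDerivAt (floquetSeries v c)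
      (floquetSeries v (fun m => Complex.I * ((m + v : ℝ) : ℂ) * c m) ζ) ζ := by
  refine hasDerivAt_tsum hc' (fun m ζ => ?_)
    (fun m ζ => (norm_floquetTerm v (fun m => Complex.I * ((m + v : ℝ) : ℂ) * c m) m ζ).le)
    (summable_floquetTerm hc 0) ζ
  convert! (hasDerivAt_expI (Complex.I * ((m + v : ℝ) : ℂ)) ζ).const_mul (c m) using 1
  ring

lemma floquetSeries_add_period (ζ : ℝ) : floquetSeries v c (ζ + 2 * Real.pi) =
    Complex.exp (Complex.I * (2 * Real.pi * v)) * floquetSeries v c ζ := by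
  unfold floquetSeries
  rw [← tsum_mul_left]
  congr 1
  ext m
  have h : Complex.exp (Complex.I * ((m + v : ℝ) : ℂ) * ((ζ + 2 * Real.pi : ℝ) : ℂ)) =
      Complex.exp (Complex.I * (2 * Real.pi * v)) *
        Complex.exp (Complex.I * ((m + v : ℝ) : ℂ) * ζ) := by
    rw [← Complex.exp_add, Complex.exp_eq_exp_iff_exists_int]
    exact ⟨m, by push_cast; ring⟩
  rw [h]; ring

lemma exp_mul_floquetSeries (ζ : ℝ) : Complex.exp (Complex.I * ζ) * floquetSeries v c ζ =
    floquetSeries v (fun m => c (m - 1)) ζ := by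
  unfold floquetSeries
  rw [← tsum_mul_left, ← (Equiv.subRight (1 : ℤ)).tsum_eq]
  congr 1
  ext m
  rw [mul_left_comm, ← Complex.exp_add]
  simp only [Equiv.subRight_apply]
  congr 2
  push_cast; ring

lemma expNeg_mul_floquetSeries (ζ : ℝ) : Complex.exp (-(Complex.I * ζ)) * floquetSeries v c ζ =
    floquetSeries v (fun m => c (m + 1)) ζ := by
  unfold floquetSeries
  rw [← tsum_mul_left, ← (Equiv.addRight (1 : ℤ)).tsum_eq]
  congr 1
  ext m
  rw [mul_left_comm, ← Complex.exp_add]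
  simp only [Equiv.coe_addRight]
  congr 2
  push_cast; ring

/-- A summable sequence is recovered as the coefficients of its series. -/
lemma freqCoeff_floquetSeries (hc : Summable fun m => ‖c m‖) (k : ℤ) :
    freqCoeff (k + v) (floquetSeries v c) = c k := by
  have hone : ∀ m : ℤ, freqCoeff (k + v)
      (fun ζ => Complex.exp (Complex.I * ((m + v : ℝ) : ℂ) * ζ)) = if m = k then 1 else 0 := by
    intro m
    have h1 := freqCoeff_exp_mul (fun _ => 1) (k + v) (m + v)
    simp only [mul_one] at h1
    rw [h1]
    have e : (k + v - (m + v) : ℝ) = ((k - m : ℤ) : ℝ) := by push_cast; ring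
    rw [e]
    split_ifs with hm
    · subst hm
      have : (Real.pi : ℂ) ≠ 0 := by exact_mod_cast Real.pi_ne_zero
      simp [freqCoeff]
      field_simp
    · have h2 := freqCoeff_deriv (f := fun _ => 1) (f' := fun _ => 0) (κ := (k - m : ℤ))
        (fun ζ => hasDerivAt_const ζ 1) continuous_const (by rw [exp_two_pi_int, mul_one])
      have h3 : freqCoeff (k - m : ℤ) (fun _ => 0) = 0 := by simp [freqCoeff]
      rw [h3] at h2
      have hne : Complex.I * (((k - m : ℤ) : ℝ) : ℂ) ≠ 0 := by
        refine mul_ne_zero Complex.I_ne_zero ?_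
        exact_mod_cast sub_ne_zero.2 (Ne.symm hm)
      exact (mul_eq_zero.1 h2.symm).resolve_left hne
  have hF : ∀ m : ℤ, Continuous fun ζ : ℝ =>
      c m * Complex.exp (Complex.I * ((m + v : ℝ) : ℂ) * ζ) *
        Complex.exp (-(Complex.I * ((k + v : ℝ) : ℂ) * ζ)) := fun m => by fun_prop
  let F : ℤ → C(ℝ, ℂ) := fun m => ⟨_, hF m⟩
  have hn : ∀ m (ζ : ℝ), ‖F m ζ‖ ≤ ‖c m‖ := by
    intro m ζ
    simp only [F, ContinuousMap.coe_mk]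
    have : -(Complex.I * ((k + v : ℝ) : ℂ) * ζ) = Complex.I * ((-((k + v) * ζ) : ℝ) : ℂ) := by
      push_cast; ring
    rw [norm_mul, norm_floquetTerm, this, norm_expI, mul_one]
  have hsum := intervalIntegral.hasSum_intervalIntegral_of_summable_norm (a := 0)
    (b := 2 * Real.pi) (f := F) (by
      refine Summable.of_nonneg_of_le (fun m => norm_nonneg _) (fun m => ?_) hc
      exact (ContinuousMap.norm_le _ (norm_nonneg _)).2 fun x => hn m x)
  have hsum2 := hsum.mul_left (((2 * Real.pi)⁻¹ : ℝ) : ℂ)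
  have hval : ∀ m, (((2 * Real.pi)⁻¹ : ℝ) : ℂ) * ∫ ζ in (0 : ℝ)..(2 * Real.pi), F m ζ =
      if m = k then c k else 0 := by
    intro m
    have := freqCoeff_const_mul (c m)
      (fun ζ => Complex.exp (Complex.I * ((m + v : ℝ) : ℂ) * ζ)) (k + v)
    rw [hone] at this
    unfold freqCoeff at this
    simp only [F, ContinuousMap.coe_mk]
    rw [this]
    split_ifs with h
    · rw [h, mul_one]
    · rw [mul_zero]
  simp only [hval] at hsum2
  have h1 := hsum2.unique (hasSum_ite_eq k (c k))
  rw [← h1]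
  unfold freqCoeff floquetSeries
  simp only [F, ContinuousMap.coe_mk, tsum_mul_right]

/-- A sequence solving the three-term recursion, with two summable moments, is the coefficient
sequence of a solution of the boundary value problem. -/
lemma solvesFloquet_floquetSeries (hc : Summable fun m : ℤ => (1 + (m + v) ^ 2) * ‖c m‖)
    (hrec : ∀ m : ℤ, ((D * (m + v) ^ 2 - lam : ℝ) : ℂ) * c m =
      -(q * c (m - 1) + conj q * c (m + 1))) :
    SolvesFloquet D (cosPotential q) v lam (floquetSeries v c) := by
  have hc0 : Summable fun m => ‖c m‖ := by
    refine hc.of_nonneg_of_le (fun m => norm_nonneg _) fun m => ?_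
    nlinarith [norm_nonneg (c m), mul_nonneg (sq_nonneg ((m : ℝ) + v)) (norm_nonneg (c m))]
  have hc1 : Summable fun m : ℤ => ‖Complex.I * ((m + v : ℝ) : ℂ) * c m‖ := by
    refine hc.of_nonneg_of_le (fun m => norm_nonneg _) fun m => ?_
    rw [norm_mul, norm_mul, Complex.norm_I, one_mul, Complex.norm_real, Real.norm_eq_abs]
    gcongr
    nlinarith [sq_nonneg (|(m : ℝ) + v| - 1), sq_abs ((m : ℝ) + v)]
  have hc2 : Summable fun m : ℤ => ‖Complex.I * ((m + v : ℝ) : ℂ) *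
      (Complex.I * ((m + v : ℝ) : ℂ) * c m)‖ := by
    refine hc.of_nonneg_of_le (fun m => norm_nonneg _) fun m => ?_
    simp only [norm_mul, Complex.norm_I, one_mul, Complex.norm_real, Real.norm_eq_abs]
    rw [← mul_assoc, ← sq, sq_abs]
    gcongr
    linarith
  have d0 := hasDerivAt_floquetSeries hc0 hc1
  have d1 := hasDerivAt_floquetSeries hc1 hc2
  have e0 := funext fun ζ => (d0 ζ).deriv
  have e1 := funext fun ζ => (d1 ζ).deriv
  refine ⟨?_, fun ζ => ?_, floquetSeries_add_period⟩
  · rw [show (2 : WithTop ℕ∞) = 1 + 1 from (one_add_one_eq_two).symm, contDiff_succ_iff_deriv]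
    refine ⟨fun ζ => (d0 ζ).differentiableAt, by simp, ?_⟩
    rw [e0, contDiff_one_iff_deriv]
    refine ⟨fun ζ => (d1 ζ).differentiableAt, ?_⟩
    rw [e1]
    exact continuous_floquetSeries hc2
  · rw [e0, e1]
    unfold cosPotential
    rw [add_mul, mul_assoc, mul_assoc, exp_mul_floquetSeries, expNeg_mul_floquetSeries]
    have hm : Summable fun m : ℤ => ‖c (m - 1)‖ :=
      hc0.comp_injective (sub_left_injective (b := (1 : ℤ)))
    have hp : Summable fun m : ℤ => ‖c (m + 1)‖ := hc0.comp_injective (add_left_injective (1 : ℤ))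
    have s2 := (summable_floquetTerm (v := v)
      (c := fun m : ℤ => Complex.I * ((m + v : ℝ) : ℂ) * (Complex.I * ((m + v : ℝ) : ℂ) * c m))
      hc2 ζ).mul_left (-(D : ℂ))
    have sm := (summable_floquetTerm (v := v) (c := fun m => c (m - 1)) hm ζ).mul_left q
    have sp := (summable_floquetTerm (v := v) (c := fun m => c (m + 1)) hp ζ).mul_left (conj q)
    unfold floquetSeries
    rw [← tsum_mul_left, ← tsum_mul_left, ← tsum_mul_left, ← tsum_mul_left, ← sm.tsum_add sp,
      ← s2.tsum_add (sm.add sp)]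
    congr 1
    ext m
    have h := hrec m
    push_cast at h ⊢
    linear_combination Complex.exp (Complex.I * (m + v) * ζ) * h -
      (D : ℂ) * (m + v) ^ 2 * c m * Complex.exp (Complex.I * (m + v) * ζ) * Complex.I_sq

end

/-! ### Truncated Hermitian matrices -/

/-- Extension by zero of a vector indexed by `{-N, …, N}`. -/
noncomputable def extendZero {N : ℤ} (u : Finset.Icc (-N) N → ℂ) (m : ℤ) : ℂ :=
  if h : m ∈ Finset.Icc (-N) N then u ⟨m, h⟩ else 0

/-- The compression to the frequencies `-N + v, …, N + v` of the operator `-D y'' + Q y` with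
`Q(ζ) = q e^{iζ} + conj q e^{-iζ}`. -/
noncomputable def truncation (D v : ℝ) (q : ℂ) (N : ℤ) :
    Matrix (Finset.Icc (-N) N) (Finset.Icc (-N) N) ℂ :=
  Matrix.of fun i j => (if j = i then ((D * ((i : ℤ) + v) ^ 2 : ℝ) : ℂ) else 0) +
    ((if (j : ℤ) = i - 1 then q else 0) + if (j : ℤ) = i + 1 then conj q else 0)

section

variable {D v : ℝ} {q : ℂ} {N : ℤ}

@[simp] lemma extendZero_coe (u : Finset.Icc (-N) N → ℂ) (i : Finset.Icc (-N) N) :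
    extendZero u i = u i := by
  simp [extendZero, i.2]

lemma extendZero_of_notMem (u : Finset.Icc (-N) N → ℂ) {m : ℤ} (h : m ∉ Finset.Icc (-N) N) :
    extendZero u m = 0 := by
  simp [extendZero, h]

lemma truncation_isHermitian (D v : ℝ) (q : ℂ) (N : ℤ) : (truncation D v q N).IsHermitian := by
  ext i j
  have h1 : ((i : ℤ) = j - 1) ↔ (j : ℤ) = i + 1 := by omega
  have h2 : ((i : ℤ) = j + 1) ↔ (j : ℤ) = i - 1 := by omega
  have h3 : (i = j) ↔ (j = i) := eq_comm
  simp only [truncation, Matrix.conjTranspose_apply, Matrix.of_apply, h1, h2, star_add, h3]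
  rw [add_comm (star (if (j : ℤ) = i + 1 then q else 0))]
  congr 1
  · by_cases h : j = i
    · subst h; simp
    · simp [h]
  · congr 1 <;> split_ifs <;> simp

lemma sum_ite_coe_eq (u : Finset.Icc (-N) N → ℂ) (k : ℤ) (a : ℂ) :
    ∑ j : Finset.Icc (-N) N, (if (j : ℤ) = k then a else 0) * u j = a * extendZero u k := by
  unfold extendZero
  split_ifs with h
  · rw [Finset.sum_eq_single ⟨k, h⟩]
    · simp
    · intro j _ hj
      rw [if_neg (fun e => hj (Subtype.ext e)), zero_mul]
    · simp
  · rw [mul_zero]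
    refine Finset.sum_eq_zero fun j _ => ?_
    rw [if_neg (fun e : (j : ℤ) = k => h (by rw [← e]; exact j.2)), zero_mul]

lemma truncation_mulVec (u : Finset.Icc (-N) N → ℂ) (i : Finset.Icc (-N) N) :
    (truncation D v q N).mulVec u i = ((D * ((i : ℤ) + v) ^ 2 : ℝ) : ℂ) * u i +
      (q * extendZero u (i - 1) + conj q * extendZero u (i + 1)) := by
  simp only [Matrix.mulVec, dotProduct, truncation, Matrix.of_apply, add_mul,
    Finset.sum_add_distrib, sum_ite_coe_eq]
  simp

/-- Translating a nonnegative function supported in `T` can only push mass out of `T`. -/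
lemma sum_translate_le (T : Finset ℤ) {f : ℤ → ℝ} (hf : ∀ m, 0 ≤ f m) (h0 : ∀ m ∉ T, f m = 0)
    (a : ℤ) : ∑ m ∈ T, f (m + a) ≤ ∑ m ∈ T, f m := by
  classical
  have h1 : ∑ m ∈ T, f (m + a) = ∑ m ∈ T.image (· + a), f m := by
    rw [Finset.sum_image fun x _ y _ h => add_right_cancel h]
  rw [h1, ← Finset.sum_filter_add_sum_filter_not _ (· ∈ T), Finset.sum_eq_zero (s := Finset.filter
    (fun m => m ∉ T) _) (fun m hm => h0 m (Finset.mem_filter.1 hm).2), add_zero]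
  exact Finset.sum_le_sum_of_subset_of_nonneg (fun m hm => (Finset.mem_filter.1 hm).2)
    fun m _ _ => hf m

lemma sum_sq_extendZero_le (u : Finset.Icc (-N) N → ℂ) (a : ℤ) :
    ∑ i : Finset.Icc (-N) N, ‖extendZero u (i + a)‖ ^ 2 ≤ ∑ i, ‖u i‖ ^ 2 := by
  have h := sum_translate_le (Finset.Icc (-N) N) (f := fun m => ‖extendZero u m‖ ^ 2)
    (fun m => by positivity) (fun m hm => by simp [extendZero_of_notMem u hm]) a
  rw [← Finset.sum_coe_sort, ← Finset.sum_coe_sort (f := fun m => ‖extendZero u m‖ ^ 2)] at h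
  simpa using h

/-- The potential contributes at most `2|q|` times the squared norm to the quadratic form. -/
lemma abs_quadraticForm_sub_le (u : Finset.Icc (-N) N → ℂ) :
    |(∑ i, conj (u i) * (truncation D v q N).mulVec u i).re -
      ∑ i : Finset.Icc (-N) N, D * ((i : ℤ) + v) ^ 2 * ‖u i‖ ^ 2| ≤ 2 * ‖q‖ * ∑ i, ‖u i‖ ^ 2 := by
  have h1 : (∑ i, conj (u i) * (truncation D v q N).mulVec u i).re -
      ∑ i : Finset.Icc (-N) N, D * ((i : ℤ) + v) ^ 2 * ‖u i‖ ^ 2 =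
      (∑ i : Finset.Icc (-N) N, conj (u i) *
        (q * extendZero u (i - 1) + conj q * extendZero u (i + 1))).re := by
    rw [Complex.re_sum, Complex.re_sum, ← Finset.sum_sub_distrib]
    refine Finset.sum_congr rfl fun i _ => ?_
    rw [truncation_mulVec, mul_add, Complex.add_re, mul_left_comm, Complex.conj_mul',
      ← Complex.ofReal_pow, ← Complex.ofReal_mul, Complex.ofReal_re]
    ring
  rw [h1]
  refine (Complex.abs_re_le_norm _).trans ((norm_sum_le _ _).trans ?_)
  have h2 : ∀ i : Finset.Icc (-N) N, ‖conj (u i) *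
      (q * extendZero u (i - 1) + conj q * extendZero u (i + 1))‖ ≤
      ‖q‖ * (‖u i‖ ^ 2 + (‖extendZero u (i + (-1))‖ ^ 2 + ‖extendZero u (i + 1)‖ ^ 2) / 2) := by
    intro i
    rw [norm_mul, RCLike.norm_conj, ← sub_eq_add_neg]
    have h3 := norm_add_le (q * extendZero u (i - 1)) (conj q * extendZero u (i + 1))
    rw [norm_mul, norm_mul, RCLike.norm_conj] at h3
    calc _ ≤ ‖u i‖ * (‖q‖ * ‖extendZero u (i - 1)‖ + ‖q‖ * ‖extendZero u (i + 1)‖) := by gcongr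
      _ = ‖q‖ * (‖u i‖ * ‖extendZero u (i - 1)‖ + ‖u i‖ * ‖extendZero u (i + 1)‖) := by ring
      _ ≤ _ := by
        refine mul_le_mul_of_nonneg_left ?_ (norm_nonneg q)
        nlinarith [sq_nonneg (‖u i‖ - ‖extendZero u (i - 1)‖),
          sq_nonneg (‖u i‖ - ‖extendZero u (i + 1)‖)]
  refine (Finset.sum_le_sum fun i _ => h2 i).trans ?_
  rw [← Finset.mul_sum, Finset.sum_add_distrib, ← Finset.sum_div, Finset.sum_add_distrib]
  have := sum_sq_extendZero_le u (-1)
  have := sum_sq_extendZero_le u 1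
  have hq := norm_nonneg q
  nlinarith

/-- The easy half of the min-max principle: there are at least as many eigenvalues of the truncation
below `L` as there are unperturbed modes on which the quadratic form is at most `L`. -/
lemma card_le_card_eigenvalues {S : Finset ℤ} (hS : S ⊆ Finset.Icc (-N) N) {L : ℝ}
    (hL : ∀ m ∈ S, D * ((m : ℝ) + v) ^ 2 + 2 * ‖q‖ ≤ L) :
    S.card ≤ (Finset.univ.filter fun j =>
      (truncation_isHermitian D v q N).eigenvalues j ≤ L).card := by
  classical
  set A := truncation D v q N with hA_def
  have hA := truncation_isHermitian D v q N
  set P := Finset.univ.filter fun j => hA.eigenvalues j ≤ L with hP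
  by_contra! hlt
  let b := hA.eigenvectorBasis
  let J : (S → ℂ) →ₗ[ℂ] EuclideanSpace ℂ (Finset.Icc (-N) N) :=
    { toFun := fun a => WithLp.toLp 2 fun i => if h : (i : ℤ) ∈ S then a ⟨i, h⟩ else 0
      map_add' := fun a a' => by ext i; by_cases h : (i : ℤ) ∈ S <;> simp [h]
      map_smul' := fun r a => by ext i; by_cases h : (i : ℤ) ∈ S <;> simp [h] }
  let T : (S → ℂ) →ₗ[ℂ] (P → ℂ) :=
    LinearMap.pi fun j => (innerSL ℂ (b j)).toLinearMap ∘ₗ J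
  have hker : LinearMap.ker T ≠ ⊥ := LinearMap.ker_ne_bot_of_finrank_lt (by
    rw [Module.finrank_fintype_fun_eq_card, Module.finrank_fintype_fun_eq_card,
      Fintype.card_coe, Fintype.card_coe]; exact hlt)
  obtain ⟨a, haT, ha⟩ := (Submodule.ne_bot_iff _).1 hker
  set e := J a with he
  have he0 : ∀ j ∈ P, inner ℂ (b j) e = 0 := fun j hj => congrFun (LinearMap.mem_ker.1 haT) ⟨j, hj⟩
  have hne : e ≠ 0 := by
    intro h0
    apply ha
    funext s
    have := congrArg (fun x : EuclideanSpace ℂ _ => x ⟨s, hS s.2⟩) h0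
    simpa [he, J] using this
  have hsupp : ∀ i : Finset.Icc (-N) N, (i : ℤ) ∉ S → e i = 0 := by
    intro i hi
    simp [he, J, hi]
  -- the upper bound, from the support of `e`
  have hup : (∑ i, conj (e i) * A.mulVec e i).re ≤ L * ∑ i, ‖e i‖ ^ 2 := by
    have h1 := (abs_le.1 (abs_quadraticForm_sub_le (D := D) (v := v) (q := q) (N := N) e)).2
    have h2 : ∑ i : Finset.Icc (-N) N, (D * ((i : ℤ) + v) ^ 2 + 2 * ‖q‖) * ‖e i‖ ^ 2 ≤
        ∑ i, L * ‖e i‖ ^ 2 := by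
      refine Finset.sum_le_sum fun i _ => ?_
      by_cases hi : (i : ℤ) ∈ S
      · gcongr; exact hL i hi
      · simp [hsupp i hi]
    rw [← Finset.mul_sum] at h2
    simp only [add_mul, Finset.sum_add_distrib, ← Finset.mul_sum] at h2
    linarith
  -- the lower bound, from the expansion of `e` in eigenvectors above `L`
  have hexp : (∑ i, conj (e i) * A.mulVec e i) =
      ∑ j, (hA.eigenvalues j : ℂ) * (‖inner ℂ (b j) e‖ ^ 2 : ℝ) := by
    have h1 : (∑ i, conj (e i) * A.mulVec e i) = inner ℂ e (WithLp.toLp 2 (A.mulVec e)) := by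
      simp [PiLp.inner_apply, mul_comm]
    rw [h1, ← b.sum_inner_mul_inner]
    refine Finset.sum_congr rfl fun j => fun _ => ?_
    have h2 : inner ℂ (b j) (WithLp.toLp 2 (A.mulVec e)) =
        (hA.eigenvalues j : ℂ) * inner ℂ (b j) e := by
      have h3 := (Matrix.isSymmetric_toEuclideanLin_iff.2 hA) (b j) e
      have h4 : Matrix.toEuclideanLin A (b j) = (hA.eigenvalues j : ℂ) • b j := by
        have := hA.mulVec_eigenvectorBasis j
        ext i
        have := congrFun this i
        simpa [Matrix.toLpLin_apply] using this
      rw [h4, inner_smul_left, Complex.conj_ofReal] at h3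
      rw [h3]
      rfl
    rw [h2, ← inner_conj_symm e (b j), mul_left_comm, Complex.conj_mul']
    push_cast; ring
  have hnorm : ∑ i, ‖e i‖ ^ 2 = ∑ j, ‖inner ℂ (b j) e‖ ^ 2 := by
    rw [← EuclideanSpace.norm_sq_eq, b.sum_sq_norm_inner_right]
  have hlow : L * ∑ i, ‖e i‖ ^ 2 < (∑ i, conj (e i) * A.mulVec e i).re := by
    rw [hexp, hnorm, Finset.mul_sum, Complex.re_sum]
    have hle : ∀ j, L * ‖inner ℂ (b j) e‖ ^ 2 ≤
        ((hA.eigenvalues j : ℂ) * (‖inner ℂ (b j) e‖ ^ 2 : ℝ)).re := by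
      intro j
      rw [← Complex.ofReal_mul, Complex.ofReal_re]
      by_cases hj : j ∈ P
      · simp [he0 j hj]
      · have : L < hA.eigenvalues j := by simpa [hP] using hj
        gcongr
    obtain ⟨j, hj⟩ : ∃ j, inner ℂ (b j) e ≠ 0 := by
      by_contra! hall
      apply hne
      rw [← b.sum_repr' e]
      simp [hall]
    refine Finset.sum_lt_sum (fun j _ => hle j) ⟨j, Finset.mem_univ j, ?_⟩
    have hjP : j ∉ P := fun h => hj (he0 j h)
    have : L < hA.eigenvalues j := by simpa [hP] using hjP
    rw [← Complex.ofReal_mul, Complex.ofReal_re]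
    have : 0 < ‖inner ℂ (b j) e‖ := norm_pos_iff.2 hj
    gcongr
  linarith

/-- Orthonormal eigenvectors of the truncations, as finitely supported sequences. -/
lemma exists_truncated_eigenvectors {S : Finset ℤ} (hS : S ⊆ Finset.Icc (-N) N) (hD : 0 ≤ D) {L : ℝ}
    (hL : ∀ m ∈ S, D * ((m : ℝ) + v) ^ 2 + 2 * ‖q‖ ≤ L) :
    ∃ (lam : S → ℝ) (c : S → ℤ → ℂ), (∀ s, lam s ∈ Set.Icc (-(2 * ‖q‖)) L) ∧
      (∀ s t, ∑' m, c s m * conj (c t m) = if s = t then 1 else 0) ∧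
      (∀ s m, ‖c s m‖ ≤ 1) ∧ (∀ s, ∀ m ∉ Finset.Icc (-N) N, c s m = 0) ∧
      ∀ s, ∀ m ∈ Finset.Icc (-N) N, ((D * (m + v) ^ 2 - lam s : ℝ) : ℂ) * c s m =
        -(q * c s (m - 1) + conj q * c s (m + 1)) := by
  classical
  have hA := truncation_isHermitian D v q N
  have hcard := card_le_card_eigenvalues hS hL
  obtain ⟨g⟩ : Nonempty (S ↪ (Finset.univ.filter fun j => hA.eigenvalues j ≤ L :
      Finset (Finset.Icc (-N) N))) :=
    Function.Embedding.nonempty_of_card_le (by rwa [Fintype.card_coe, Fintype.card_coe])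
  let b := hA.eigenvectorBasis
  have hb : ∀ j i, ‖b j i‖ ≤ 1 := fun j i =>
    (PiLp.norm_apply_le (b j) i).trans (b.orthonormal.1 j).le
  have heig : ∀ j i, (truncation D v q N).mulVec (b j) i = hA.eigenvalues j * b j i := by
    intro j i
    have := congrFun (hA.mulVec_eigenvectorBasis j) i
    simpa using this
  refine ⟨fun s => hA.eigenvalues (g s).1, fun s => extendZero (b (g s).1), fun s => ⟨?_, ?_⟩,
    fun s t => ?_, fun s m => ?_, fun s m hm => extendZero_of_notMem _ hm, fun s m hm => ?_⟩
  · have h1 := (abs_le.1 (abs_quadraticForm_sub_le (D := D) (v := v) (q := q) (N := N)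
      (b (g s).1))).1
    have h2 : ∑ i, ‖b (g s).1 i‖ ^ 2 = 1 := by
      rw [← EuclideanSpace.norm_sq_eq, b.orthonormal.1, one_pow]
    have h3 : (∑ i, conj (b (g s).1 i) * (truncation D v q N).mulVec (b (g s).1) i).re =
        hA.eigenvalues (g s).1 := by
      rw [← mul_one (hA.eigenvalues (g s).1), ← h2, Finset.mul_sum, Complex.re_sum]
      refine Finset.sum_congr rfl fun i _ => ?_
      rw [heig, mul_left_comm, Complex.conj_mul', ← Complex.ofReal_pow, ← Complex.ofReal_mul,
        Complex.ofReal_re]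
    have h4 : 0 ≤ ∑ i : Finset.Icc (-N) N, D * ((i : ℤ) + v) ^ 2 * ‖b (g s).1 i‖ ^ 2 :=
      Finset.sum_nonneg fun i _ => by positivity
    rw [h2, h3] at h1
    linarith
  · exact (Finset.mem_filter.1 (g s).2).2
  · rw [tsum_eq_sum (s := Finset.Icc (-N) N)
      (fun m hm => by beta_reduce; rw [extendZero_of_notMem _ hm, zero_mul]), ← Finset.sum_coe_sort]
    simp only [extendZero_coe]
    have h1 := orthonormal_iff_ite.1 b.orthonormal (g t).1 (g s).1
    rw [PiLp.inner_apply] at h1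
    simp only [RCLike.inner_apply] at h1
    rw [h1]
    have : ((g t).1 = (g s).1) ↔ s = t := by
      rw [Subtype.val_inj, g.injective.eq_iff, eq_comm]
    simp only [this]
  · by_cases hm : m ∈ Finset.Icc (-N) N
    · simpa [extendZero, hm] using hb (g s).1 ⟨m, hm⟩
    · simp [extendZero_of_notMem _ hm]
  · have h1 := heig (g s).1 ⟨m, hm⟩
    rw [truncation_mulVec] at h1
    have h2 := extendZero_coe (b (g s).1).ofLp ⟨m, hm⟩
    simp only at h1 h2
    beta_reduce
    rw [h2]
    push_cast at h1 ⊢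
    linear_combination h1

end

/-! ### Existence of eigenvalues -/

section

open Filter Topology

variable {D v : ℝ} {q : ℂ}

lemma summable_inv_one_add_sq (v : ℝ) :
    Summable fun m : ℤ => (1 + ((m : ℝ) + v) ^ 2)⁻¹ := by
  have hs : Summable fun m : ℤ => (2 + 2 * v ^ 2) * (1 / (m : ℝ) ^ 2) :=
    (Real.summable_one_div_int_pow.2 one_lt_two).mul_left _
  refine Summable.of_norm_bounded_eventually hs ?_
  filter_upwards [(Set.finite_singleton (0 : ℤ)).compl_mem_cofinite] with m hm
  have hm0 : (m : ℝ) ≠ 0 := by exact_mod_cast hm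
  have hm2 : 0 < (m : ℝ) ^ 2 := by positivity
  rw [Real.norm_of_nonneg (by positivity), mul_one_div, inv_le_iff_one_le_mul₀ (by positivity),
    div_mul_eq_mul_div, le_div_iff₀ hm2]
  nlinarith [sq_nonneg ((m : ℝ) + 2 * v), mul_nonneg (sq_nonneg v) (sq_nonneg ((m : ℝ) + v))]

/-- The recursion forces an eigenvector of a truncation to decay, uniformly in the truncation. -/
lemma norm_truncated_le (hD : 0 < D) {lam Λ : ℝ} (hlam : |lam| ≤ Λ) {N : ℤ} {c : ℤ → ℂ}
    (h1 : ∀ m, ‖c m‖ ≤ 1) (h0 : ∀ m ∉ Finset.Icc (-N) N, c m = 0)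
    (hrec : ∀ m ∈ Finset.Icc (-N) N, ((D * (m + v) ^ 2 - lam : ℝ) : ℂ) * c m =
      -(q * c (m - 1) + conj q * c (m + 1))) (m : ℤ) :
    ‖c m‖ ≤ (1 + (Λ + 2 * ‖q‖) / D) * (1 + ((m : ℝ) + v) ^ 2)⁻¹ := by
  have hΛ : 0 ≤ Λ := (abs_nonneg _).trans hlam
  by_cases hm : m ∈ Finset.Icc (-N) N
  · rw [← div_eq_mul_inv, le_div_iff₀ (by positivity)]
    have h := hrec m hm
    have h2 : ((D * (m + v) ^ 2 : ℝ) : ℂ) * c m =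
        (lam : ℂ) * c m - (q * c (m - 1) + conj q * c (m + 1)) := by
      push_cast at h ⊢
      linear_combination h
    have h3 := congrArg norm h2
    rw [norm_mul, Complex.norm_real, Real.norm_of_nonneg (by positivity)] at h3
    have h4 : ‖(lam : ℂ) * c m - (q * c (m - 1) + conj q * c (m + 1))‖ ≤ Λ + 2 * ‖q‖ := by
      refine (norm_sub_le _ _).trans ?_
      have h5 := norm_add_le (q * c (m - 1)) (conj q * c (m + 1))
      rw [norm_mul, norm_mul, RCLike.norm_conj] at h5
      rw [norm_mul, Complex.norm_real, Real.norm_eq_abs]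
      have := mul_le_mul hlam (h1 m) (norm_nonneg _) hΛ
      have := mul_le_mul_of_nonneg_left (h1 (m - 1)) (norm_nonneg q)
      have := mul_le_mul_of_nonneg_left (h1 (m + 1)) (norm_nonneg q)
      linarith
    have h6 : ((m : ℝ) + v) ^ 2 * ‖c m‖ ≤ (Λ + 2 * ‖q‖) / D := by
      rw [le_div_iff₀ hD]; linarith
    linarith [h1 m]
  · rw [h0 m hm, norm_zero]; positivity

/-- The other half of the min-max principle: there are at least as many eigenvalues of the boundary
value problem below `L` as there are unperturbed modes on which the quadratic form is at most `L`.
The eigenvectors of the truncations decay uniformly, so a subsequence converges in `ℓ²` to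
orthonormal eigenvectors of the full problem; as eigenvalues are simple, these belong to different
eigenvalues. -/
theorem exists_eigenvalues_le (hD : 0 < D)
    (hv : v ∈ Set.Ioo (0 : ℝ) (1 / 2) ∪ Set.Ioo (1 / 2 : ℝ) 1) (S : Finset ℤ) {L : ℝ}
    (hL : ∀ m ∈ S, D * ((m : ℝ) + v) ^ 2 + 2 * ‖q‖ ≤ L) :
    ∃ E : Finset ℝ, E.card = S.card ∧ ∀ lam ∈ E, lam ≤ L ∧
      ∃ y ≠ 0, SolvesFloquet D (cosPotential q) v lam y := by
  classical
  obtain ⟨N₀, hN₀⟩ : ∃ N₀ : ℕ, ∀ m ∈ S, |m| ≤ N₀ := by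
    refine ⟨S.sup fun m => m.natAbs, fun m hm => ?_⟩
    have := Finset.le_sup (f := fun m : ℤ => m.natAbs) hm
    rw [Int.abs_eq_natAbs]
    exact_mod_cast this
  have hSN : ∀ N : ℕ, S ⊆ Finset.Icc (-((N₀ + N : ℕ) : ℤ)) ((N₀ + N : ℕ) : ℤ) := by
    intro N m hm
    have := abs_le.1 (hN₀ m hm)
    rw [Finset.mem_Icc]
    push_cast
    omega
  choose lam c hlam horth hone hzero hrec using fun N : ℕ =>
    exists_truncated_eigenvectors (hSN N) hD.le hL
  set Λ : ℝ := max (2 * ‖q‖) |L| with hΛ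
  have habs : ∀ N s, |lam N s| ≤ Λ := fun N s => abs_le.2
    ⟨by linarith [(hlam N s).1, le_max_left (2 * ‖q‖) |L|],
      (hlam N s).2.trans ((le_abs_self L).trans (le_max_right _ _))⟩
  set b : ℤ → ℝ := fun m => (1 + (Λ + 2 * ‖q‖) / D) * (1 + ((m : ℝ) + v) ^ 2)⁻¹ with hb
  have hbs : Summable b := (summable_inv_one_add_sq v).mul_left _
  have hcb : ∀ N s m, ‖c N s m‖ ≤ b m := fun N s m =>
    norm_truncated_le hD (habs N s) (hone N s) (hzero N s) (hrec N s) m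
  -- compactness
  let X := S → ℝ × (ℤ → ℂ)
  let K : Set X := Set.univ.pi fun _ =>
    Set.Icc (-(2 * ‖q‖)) L ×ˢ Set.univ.pi fun m => Metric.closedBall 0 (b m)
  have hK : IsCompact K := isCompact_univ_pi fun _ =>
    isCompact_Icc.prod (isCompact_univ_pi fun m => isCompact_closedBall _ _)
  obtain ⟨x, hxK, ψ, hψ, hlim⟩ := hK.tendsto_subseq
    (x := fun N s => ((lam N s, c N s) : ℝ × (ℤ → ℂ)))
    (fun N s _ => ⟨hlam N s, fun m _ => by simpa using hcb N s m⟩)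
  have hlimlam : ∀ s, Tendsto (fun N => lam (ψ N) s) atTop (𝓝 (x s).1) := fun s =>
    (continuous_fst.tendsto _).comp ((tendsto_pi_nhds.1 hlim) s)
  have hlimc : ∀ s m, Tendsto (fun N => c (ψ N) s m) atTop (𝓝 ((x s).2 m)) := fun s m =>
    (tendsto_pi_nhds.1 ((continuous_snd.tendsto _).comp ((tendsto_pi_nhds.1 hlim) s))) m
  have hxb : ∀ s m, ‖(x s).2 m‖ ≤ b m := fun s m => by
    simpa using (hxK s trivial).2 m trivial
  have hxrec : ∀ s (m : ℤ), ((D * (m + v) ^ 2 - (x s).1 : ℝ) : ℂ) * (x s).2 m =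
      -(q * (x s).2 (m - 1) + conj q * (x s).2 (m + 1)) := by
    intro s m
    have h1 : Tendsto (fun N => ((D * (m + v) ^ 2 - lam (ψ N) s : ℝ) : ℂ) * c (ψ N) s m) atTop
        (𝓝 (((D * (m + v) ^ 2 - (x s).1 : ℝ) : ℂ) * (x s).2 m)) :=
      ((Complex.continuous_ofReal.tendsto _).comp ((hlimlam s).const_sub _)).mul (hlimc s m)
    have h2 : Tendsto (fun N => -(q * c (ψ N) s (m - 1) + conj q * c (ψ N) s (m + 1))) atTop
        (𝓝 (-(q * (x s).2 (m - 1) + conj q * (x s).2 (m + 1)))) :=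
      (((hlimc s (m - 1)).const_mul q).add ((hlimc s (m + 1)).const_mul (conj q))).neg
    refine tendsto_nhds_unique_of_eventuallyEq h1 h2 ?_
    filter_upwards [eventually_ge_atTop m.natAbs] with N hN
    refine hrec (ψ N) s m ?_
    have := hψ.id_le N
    simp only [id_eq] at this
    rw [Finset.mem_Icc]
    push_cast
    omega
  have hxorth : ∀ s t, ∑' m, (x s).2 m * conj ((x t).2 m) = if s = t then 1 else 0 := by
    intro s t
    have hbb : Summable fun m => b m * b m := by
      refine (hbs.mul_left (1 + (Λ + 2 * ‖q‖) / D)).of_nonneg_of_le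
        (fun m => mul_self_nonneg _) fun m => ?_
      have hb0 : 0 ≤ b m := (norm_nonneg _).trans (hxb s m)
      refine mul_le_mul_of_nonneg_right ?_ hb0
      have hΛ0 : 0 ≤ Λ := le_max_of_le_right (abs_nonneg L)
      refine mul_le_of_le_one_right (by positivity) ?_
      exact inv_le_one_of_one_le₀ (by nlinarith [sq_nonneg ((m : ℝ) + v)])
    have h1 : Tendsto (fun N => ∑' m, c (ψ N) s m * conj (c (ψ N) t m)) atTop
        (𝓝 (∑' m, (x s).2 m * conj ((x t).2 m))) := by
      refine tendsto_tsum_of_dominated_convergence hbb (fun m => ?_) (Eventually.of_forall ?_)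
      · exact (hlimc s m).mul ((Complex.continuous_conj.tendsto _).comp (hlimc t m))
      · intro N m
        rw [norm_mul, RCLike.norm_conj]
        exact mul_le_mul (hcb _ s m) (hcb _ t m) (norm_nonneg _) ((norm_nonneg _).trans (hxb s m))
    simp only [horth] at h1
    exact tendsto_nhds_unique h1 tendsto_const_nhds
  -- regularity
  have hs0 : ∀ s, Summable fun m => ‖(x s).2 m‖ := fun s =>
    hbs.of_nonneg_of_le (fun m => norm_nonneg _) (hxb s)
  have hs2 : ∀ s, Summable fun m : ℤ => (1 + ((m : ℝ) + v) ^ 2) * ‖(x s).2 m‖ := by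
    intro s
    have hm : Summable fun m : ℤ => ‖(x s).2 (m - 1)‖ :=
      (hs0 s).comp_injective (sub_left_injective (b := (1 : ℤ)))
    have hp : Summable fun m : ℤ => ‖(x s).2 (m + 1)‖ :=
      (hs0 s).comp_injective (add_left_injective (1 : ℤ))
    refine ((((hs0 s).mul_left (D + |(x s).1|)).add ((hm.add hp).mul_left ‖q‖)).mul_left
      D⁻¹).of_nonneg_of_le (fun m => by positivity) fun m => ?_
    rw [inv_mul_eq_div, le_div_iff₀ hD]
    have h2 : ((D * (m + v) ^ 2 : ℝ) : ℂ) * (x s).2 m =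
        ((x s).1 : ℂ) * (x s).2 m - (q * (x s).2 (m - 1) + conj q * (x s).2 (m + 1)) := by
      have h := hxrec s m
      push_cast at h ⊢
      linear_combination h
    have h3 := congrArg norm h2
    rw [norm_mul, Complex.norm_real, Real.norm_of_nonneg (by positivity)] at h3
    have h4 := norm_sub_le (((x s).1 : ℂ) * (x s).2 m)
      (q * (x s).2 (m - 1) + conj q * (x s).2 (m + 1))
    have h5 := norm_add_le (q * (x s).2 (m - 1)) (conj q * (x s).2 (m + 1))
    rw [norm_mul, norm_mul, RCLike.norm_conj] at h5
    rw [norm_mul, Complex.norm_real, Real.norm_eq_abs] at h4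
    linarith
  have hsol : ∀ s, SolvesFloquet D (cosPotential q) v (x s).1 (floquetSeries v (x s).2) :=
    fun s => solvesFloquet_floquetSeries (hs2 s) (hxrec s)
  have hcoef : ∀ s (m : ℤ), freqCoeff (m + v) (floquetSeries v (x s).2) = (x s).2 m :=
    fun s m => freqCoeff_floquetSeries (hs0 s) m
  have hne : ∀ s, floquetSeries v (x s).2 ≠ 0 := by
    intro s h0
    have h1 := hxorth s s
    have h2 : ∀ m, (x s).2 m = 0 := by
      intro m
      rw [← hcoef, h0]
      simp [freqCoeff]
    simp [h2] at h1
  have hinj : Function.Injective fun s => (x s).1 := by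
    intro s t hst
    by_contra hne_st
    have hst' : (x s).1 = (x t).1 := hst
    have hsolt := hsol t
    rw [← hst'] at hsolt
    obtain ⟨a, ha⟩ := (hsol s).exists_eq_const_mul hD.ne' hv hsolt (hne s)
    have h1 : ∀ m, (x t).2 m = a * (x s).2 m := by
      intro m
      rw [← hcoef t, ← hcoef s, ← freqCoeff_const_mul]
      congr 1
      funext ζ
      exact ha ζ
    have h2 := hxorth t s
    have h3 := hxorth s s
    simp only [h1, mul_assoc, tsum_mul_left, h3, if_true, mul_one, if_neg (Ne.symm hne_st)] at h2
    have h4 := hxorth t t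
    simp [h1, h2] at h4
  refine ⟨Finset.univ.image fun s => (x s).1, ?_, ?_⟩
  · rw [Finset.card_image_of_injective _ hinj, Finset.card_univ, Fintype.card_coe]
  · intro l hl
    obtain ⟨s, -, rfl⟩ := Finset.mem_image.1 hl
    exact ⟨(hxK s trivial).1.2, _, hne s, hsol s⟩

end

/-! ### Numbering of the eigenvalues -/

section

variable {D v : ℝ} {q : ℂ}

/-- Pythagoras for a finite orthonormal family of continuous functions. -/
lemma mean_sq_sum {ι : Type*} [DecidableEq ι] (S : Finset ι) (a : ι → ℂ) {f : ι → ℝ → ℂ}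
    (hf : ∀ i, Continuous (f i))
    (horth : ∀ i j, ((2 * Real.pi)⁻¹ : ℝ) * ∫ ζ in (0 : ℝ)..(2 * Real.pi), f i ζ * conj (f j ζ) =
      if i = j then (1 : ℂ) else 0) :
    (2 * Real.pi)⁻¹ * ∫ ζ in (0 : ℝ)..(2 * Real.pi), ‖∑ i ∈ S, a i * f i ζ‖ ^ 2 =
      ∑ i ∈ S, ‖a i‖ ^ 2 := by
  apply Complex.ofReal_injective
  rw [Complex.ofReal_mul, ← intervalIntegral.integral_ofReal, Complex.ofReal_sum]
  have h1 : ∀ ζ, ((‖∑ i ∈ S, a i * f i ζ‖ ^ 2 : ℝ) : ℂ) =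
      ∑ i ∈ S, ∑ j ∈ S, a i * conj (a j) * (f i ζ * conj (f j ζ)) := by
    intro ζ
    rw [Complex.ofReal_pow, ← Complex.mul_conj', map_sum, Finset.sum_mul_sum]
    refine Finset.sum_congr rfl fun i _ => Finset.sum_congr rfl fun j _ => ?_
    rw [map_mul]; ring
  have hc : ∀ i j, Continuous fun ζ => f i ζ * conj (f j ζ) := fun i j =>
    (hf i).mul (Complex.continuous_conj.comp (hf j))
  have hc' : ∀ i j, Continuous fun ζ => a i * conj (a j) * (f i ζ * conj (f j ζ)) := fun i j =>
    continuous_const.mul (hc i j)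
  simp only [h1]
  rw [intervalIntegral.integral_finsetSum fun i _ => Continuous.intervalIntegrable
    (continuous_finsetSum _ fun j _ => hc' i j) _ _, Finset.mul_sum]
  refine Finset.sum_congr rfl fun i hi => ?_
  rw [intervalIntegral.integral_finsetSum fun j _ => Continuous.intervalIntegrable
    (hc' i j) _ _, Finset.mul_sum]
  simp only [intervalIntegral.integral_const_mul]
  rw [Finset.sum_eq_single i]
  · rw [mul_left_comm, horth, if_pos rfl, mul_one, Complex.mul_conj', Complex.ofReal_pow]
  · intro j _ hj
    rw [mul_left_comm, horth, if_neg hj.symm, mul_zero]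
  · exact fun h => absurd hi h

/-- As `2v` is not an integer, it stays away from the integers. -/
lemma exists_dist_pos (hv : v ∈ Set.Ioo (0 : ℝ) (1 / 2) ∪ Set.Ioo (1 / 2 : ℝ) 1) :
    ∃ θ : ℝ, 0 < θ ∧ θ ≤ 1 ∧ ∀ k : ℤ, θ ≤ |(k : ℝ) + 2 * v| := by
  have hv0 : 0 < v ∧ v < 1 ∧ 2 * v - 1 ≠ 0 := by
    rcases hv with h | h
    · exact ⟨h.1, by linarith [h.2], by linarith [h.2]⟩
    · refine ⟨by linarith [h.1], h.2, ?_⟩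
      have := h.1
      intro h0
      linarith
  obtain ⟨h0, h1, h2⟩ := hv0
  refine ⟨min 1 (min (2 * v) (min |2 * v - 1| (2 - 2 * v))), ?_, min_le_left _ _, fun k => ?_⟩
  · have := abs_pos.2 h2
    simp only [lt_min_iff]
    exact ⟨one_pos, by linarith, this, by linarith⟩
  · have e1 : min 1 (min (2 * v) (min |2 * v - 1| (2 - 2 * v))) ≤ 2 * v :=
      (min_le_right _ _).trans (min_le_left _ _)
    have e2 : min 1 (min (2 * v) (min |2 * v - 1| (2 - 2 * v))) ≤ |2 * v - 1| :=
      (min_le_right _ _).trans ((min_le_right _ _).trans (min_le_left _ _))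
    have e3 : min 1 (min (2 * v) (min |2 * v - 1| (2 - 2 * v))) ≤ 2 - 2 * v :=
      (min_le_right _ _).trans ((min_le_right _ _).trans (min_le_right _ _))
    rcases lt_trichotomy k (-1) with hk | hk | hk
    · have : (k : ℝ) ≤ -2 := by exact_mod_cast (by omega : k ≤ -2)
      exact e3.trans ((by linarith : 2 - 2 * v ≤ -(k + 2 * v)).trans (neg_le_abs _))
    · subst hk
      convert e2 using 2
      push_cast; ring
    · have : (0 : ℝ) ≤ k := by exact_mod_cast (by omega : 0 ≤ k)
      exact e1.trans ((by linarith : 2 * v ≤ k + 2 * v).trans (le_abs_self _))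

lemma eq_of_abs_add_eq (hv : v ∈ Set.Ioo (0 : ℝ) (1 / 2) ∪ Set.Ioo (1 / 2 : ℝ) 1) {m n : ℤ}
    (h : |(m : ℝ) + v| = |(n : ℝ) + v|) : m = n := by
  rcases abs_eq_abs.1 h with h | h
  · exact_mod_cast add_right_cancel h
  · obtain ⟨θ, h0, -, hθ⟩ := exists_dist_pos hv
    have h1 := hθ (m + n)
    push_cast at h1
    rw [show (m : ℝ) + n + 2 * v = 0 by linarith, abs_zero] at h1
    linarith

/-- The indices `m` with `|m + v| ≤ |n + v|`. -/
noncomputable def lowModes (v : ℝ) (n : ℤ) : Finset ℤ :=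
  (Finset.Icc (-(|n| + 2)) (|n| + 2)).filter fun m => |(m : ℝ) + v| ≤ |(n : ℝ) + v|

lemma mem_lowModes (hv : |v| < 1) {m n : ℤ} :
    m ∈ lowModes v n ↔ |(m : ℝ) + v| ≤ |(n : ℝ) + v| := by
  unfold lowModes
  rw [Finset.mem_filter, and_iff_right_iff_imp]
  intro h
  have h1 : |(m : ℝ)| ≤ |(m : ℝ) + v| + |v| := by
    simpa using abs_sub (m + v : ℝ) v
  have h2 := abs_add_le (n : ℝ) v
  have h3 : |(m : ℝ)| ≤ |(n : ℝ)| + 2 := by linarith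
  have h4 : |m| ≤ |n| + 2 := by exact_mod_cast h3
  rw [Finset.mem_Icc]
  exact abs_le.1 h4

lemma abs_lt_one_of_mem (hv : v ∈ Set.Ioo (0 : ℝ) (1 / 2) ∪ Set.Ioo (1 / 2 : ℝ) 1) : |v| < 1 := by
  rw [abs_lt]
  rcases hv with h | h <;> constructor <;> linarith [h.1, h.2]

namespace IsEigenSystem

variable {μ : ℤ → ℝ} {φ : ℤ → ℝ → ℂ}

lemma injective (hv : v ∈ Set.Ioo (0 : ℝ) (1 / 2) ∪ Set.Ioo (1 / 2 : ℝ) 1)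
    {Q : ℝ → ℂ} (hφ : IsEigenSystem D Q v μ φ) : Function.Injective μ := by
  intro i j hij
  rcases lt_trichotomy |(i : ℝ) + v| |(j : ℝ) + v| with h | h | h
  · exact absurd hij (hφ.ordered i j h).ne
  · exact eq_of_abs_add_eq hv h
  · exact absurd hij (hφ.ordered j i h).ne'

lemma orthonormal (hD : D ≠ 0) (hv : v ∈ Set.Ioo (0 : ℝ) (1 / 2) ∪ Set.Ioo (1 / 2 : ℝ) 1)
    (hφ : IsEigenSystem D (cosPotential q) v μ φ) (i j : ℤ) :
    ((2 * Real.pi)⁻¹ : ℝ) * ∫ ζ in (0 : ℝ)..(2 * Real.pi), φ i ζ * conj (φ j ζ) =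
      if i = j then (1 : ℂ) else 0 := by
  split_ifs with h
  · subst h
    have h1 := congrArg ((↑) : ℝ → ℂ) (hφ.normalized i)
    rw [Complex.ofReal_mul, ← intervalIntegral.integral_ofReal] at h1
    simp only [Complex.ofReal_pow, ← Complex.mul_conj', Complex.ofReal_one] at h1
    exact h1
  · rw [(hφ.solves i).integral_mul_conj_eq_zero hD (hφ.solves j)
      (fun e => h (hφ.injective hv e)), mul_zero]

/-- Upper bound: otherwise too few of the `μ j` would be available for the eigenvalues that the
min-max principle provides. -/
lemma le_unperturbed_add (hD : 0 < D) (hv : v ∈ Set.Ioo (0 : ℝ) (1 / 2) ∪ Set.Ioo (1 / 2 : ℝ) 1)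
    (hφ : IsEigenSystem D (cosPotential q) v μ φ) (n : ℤ) :
    μ n ≤ D * (n + v) ^ 2 + 2 * ‖q‖ := by
  by_contra! hlt
  have hmem := fun m : ℤ => mem_lowModes (m := m) (n := n) (abs_lt_one_of_mem hv)
  obtain ⟨E, hE, hEL⟩ := exists_eigenvalues_le (q := q) hD hv (lowModes v n)
    (L := D * (n + v) ^ 2 + 2 * ‖q‖) (fun m hm => by
      have := sq_le_sq.2 ((hmem m).1 hm)
      gcongr)
  have hsub : E ⊆ ((lowModes v n).erase n).image μ := by
    intro lam hlam
    obtain ⟨hle, y, hy0, hy⟩ := hEL lam hlam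
    obtain ⟨j, rfl⟩ := hφ.complete lam y hy hy0
    refine Finset.mem_image_of_mem _ (Finset.mem_erase.2 ⟨?_, (hmem j).2 ?_⟩)
    · rintro rfl
      linarith
    · by_contra! h
      have := hφ.ordered n j h
      linarith
  have h1 := (Finset.card_le_card hsub).trans Finset.card_image_le
  rw [hE, Finset.card_erase_of_mem ((hmem n).2 le_rfl)] at h1
  have h2 : 0 < (lowModes v n).card := Finset.card_pos.2 ⟨n, (hmem n).2 le_rfl⟩
  omega

/-- Lower bound: some combination of the eigenfunctions up to `n` has no Fourier coefficients below
`n`; compare the two ways of estimating the operator on it. -/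
lemma unperturbed_le_add (hD : 0 < D) (hv : v ∈ Set.Ioo (0 : ℝ) (1 / 2) ∪ Set.Ioo (1 / 2 : ℝ) 1)
    (hφ : IsEigenSystem D (cosPotential q) v μ φ) (n : ℤ) :
    D * (n + v) ^ 2 ≤ μ n + (2 * ‖q‖ + 1) := by
  have hmem := fun m : ℤ => mem_lowModes (m := m) (n := n) (abs_lt_one_of_mem hv)
  set S := lowModes v n with hS
  have hnS : n ∈ S := (hmem n).2 le_rfl
  have hcont : ∀ j, Continuous (φ j) := fun j => (hφ.solves j).continuous
  -- a combination with vanishing low coefficients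
  let T : (↥S → ℂ) →ₗ[ℂ] (↥(S.erase n) → ℂ) :=
    { toFun := fun a m => ∑ j, a j * freqCoeff (((m : ℤ) : ℝ) + v) (φ j)
      map_add' := fun a a' => by
        ext m; simp only [Pi.add_apply, add_mul, Finset.sum_add_distrib]
      map_smul' := fun r a => by
        ext m; simp only [Pi.smul_apply, smul_eq_mul, mul_assoc, RingHom.id_apply, Finset.mul_sum] }
  have hker : LinearMap.ker T ≠ ⊥ := LinearMap.ker_ne_bot_of_finrank_lt (by
    rw [Module.finrank_fintype_fun_eq_card, Module.finrank_fintype_fun_eq_card,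
      Fintype.card_coe, Fintype.card_coe, Finset.card_erase_of_mem hnS]
    have : 0 < S.card := Finset.card_pos.2 ⟨n, hnS⟩
    omega)
  obtain ⟨a₀, ha₀T, ha₀⟩ := (Submodule.ne_bot_iff _).1 hker
  let a : ℤ → ℂ := fun j => if h : j ∈ S then a₀ ⟨j, h⟩ else 0
  have haS : ∀ j : S, a j = a₀ j := fun j => by simp [a, j.2]
  have hα : 0 < ∑ j ∈ S, ‖a j‖ ^ 2 := by
    obtain ⟨j, hj⟩ := Function.ne_iff.1 ha₀
    refine Finset.sum_pos' (fun _ _ => by positivity) ⟨j, j.2, ?_⟩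
    rw [haS]
    have := norm_pos_iff.2 hj
    positivity
  -- `σ` is a number below all the eigenvalues involved
  obtain ⟨σ, hσ0, hσ⟩ : ∃ σ : ℝ, σ < 0 ∧ ∀ j ∈ S, σ < μ j := by
    refine ⟨-∑ j ∈ S, |μ j| - 1, ?_, fun j hj => ?_⟩
    · have : 0 ≤ ∑ j ∈ S, |μ j| := Finset.sum_nonneg fun _ _ => abs_nonneg _
      linarith
    · have := Finset.single_le_sum (f := fun j => |μ j|) (fun _ _ => abs_nonneg _) hj
      have := neg_abs_le (μ j)
      linarith
  set y : ℝ → ℂ := fun ζ => ∑ j ∈ S, a j * φ j ζ with hy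
  set z : ℝ → ℂ := fun ζ => ∑ j ∈ S, (a j * (μ j - σ : ℝ)) * φ j ζ with hz
  set g : ℝ → ℂ := fun ζ => z ζ + (-1) * (cosPotential q ζ * y ζ) with hg
  have cQ := continuous_cosPotential q
  have cy : Continuous y := continuous_finsetSum _ fun j _ => continuous_const.mul (hcont j)
  have cz : Continuous z := continuous_finsetSum _ fun j _ => continuous_const.mul (hcont j)
  have cg : Continuous g := by fun_prop
  have hylow : ∀ m ∈ S.erase n, freqCoeff (m + v) y = 0 := by
    intro m hm
    have h1 := congrFun (LinearMap.mem_ker.1 ha₀T) ⟨m, hm⟩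
    rw [hy, freqCoeff_finset_sum S a (fun j _ => hcont j), ← Finset.sum_coe_sort]
    simp only [haS]
    exact h1
  have hgcoef : ∀ m : ℤ, freqCoeff (m + v) g =
      ((D * (m + v) ^ 2 - σ : ℝ) : ℂ) * freqCoeff (m + v) y := by
    intro m
    have e1 : (m + v - 1 : ℝ) = m - 1 + v := by ring
    have e2 : (m + v + 1 : ℝ) = m + 1 + v := by ring
    rw [hg, freqCoeff_add (by fun_prop) (by fun_prop), freqCoeff_const_mul,
      freqCoeff_cosPotential_mul q cy, e1, e2, hy, hz,
      freqCoeff_finset_sum S _ (fun j _ => hcont j), freqCoeff_finset_sum S _ (fun j _ => hcont j),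
      freqCoeff_finset_sum S _ (fun j _ => hcont j), freqCoeff_finset_sum S _ (fun j _ => hcont j),
      Finset.mul_sum, Finset.mul_sum, Finset.mul_sum, ← Finset.sum_add_distrib, Finset.mul_sum,
      ← Finset.sum_add_distrib]
    refine Finset.sum_congr rfl fun j _ => ?_
    have h := (hφ.solves j).coeff_recursion hD.ne' m
    push_cast at h ⊢
    linear_combination -a j * h
  -- two estimates for the mean square of `g`
  have horth := hφ.orthonormal hD.ne' hv
  have hym := mean_sq_sum S a hcont horth
  have hzm := mean_sq_sum S (fun j => a j * (μ j - σ : ℝ)) hcont horth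
  set A : ℝ := μ n - σ with hA
  have hA0 : 0 < A := sub_pos.2 (hσ n hnS)
  set M : ℝ := 2 * ‖q‖ + 1 with hM
  have hM0 : 0 < M := by positivity
  set Bd : ℝ := D * (n + v) ^ 2 - σ with hBd
  have hB0 : 0 < Bd := by
    have : 0 ≤ D * ((n : ℝ) + v) ^ 2 := by positivity
    linarith
  set α := ∑ j ∈ S, ‖a j‖ ^ 2 with hαd
  have hzA : ∑ j ∈ S, ‖a j * (μ j - σ : ℝ)‖ ^ 2 ≤ A ^ 2 * α := by
    rw [hαd, Finset.mul_sum]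
    refine Finset.sum_le_sum fun j hj => ?_
    have h1 : 0 < μ j - σ := sub_pos.2 (hσ j hj)
    have h2 : μ j ≤ μ n := by
      rcases ((hmem j).1 hj).lt_or_eq with h | h
      · exact (hφ.ordered j n h).le
      · rw [eq_of_abs_add_eq hv h]
    rw [norm_mul, Complex.norm_real, Real.norm_of_nonneg h1.le, mul_pow, mul_comm]
    have : (μ j - σ) ^ 2 ≤ A ^ 2 := pow_le_pow_left₀ h1.le (by linarith) 2
    gcongr
  have hlow : Bd ^ 2 * α ≤ (2 * Real.pi)⁻¹ * ∫ ζ in (0 : ℝ)..(2 * Real.pi), ‖g ζ‖ ^ 2 := by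
    rw [← hym]
    refine hasSum_le (fun m => ?_) ((hasSum_sq_freqCoeff cy v).mul_left (Bd ^ 2))
      (hasSum_sq_freqCoeff cg v)
    rw [hgcoef, norm_mul, mul_pow, Complex.norm_real, Real.norm_eq_abs, sq_abs]
    by_cases hm : m ∈ S.erase n
    · rw [hylow m hm]; simp
    · have h1 : |(n : ℝ) + v| ≤ |(m : ℝ) + v| := by
        by_cases hmn : m = n
        · rw [hmn]
        · by_contra! h
          exact hm (Finset.mem_erase.2 ⟨hmn, (hmem m).2 h.le⟩)
      have h2 := sq_le_sq.2 h1
      have h3 : Bd ≤ D * (m + v) ^ 2 - σ := by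
        rw [hBd]; gcongr
      have := pow_le_pow_left₀ hB0.le h3 2
      gcongr
  have hup : (2 * Real.pi)⁻¹ * ∫ ζ in (0 : ℝ)..(2 * Real.pi), ‖g ζ‖ ^ 2 ≤
      (1 + M / A) * (A ^ 2 * α) + (1 + A / M) * (M ^ 2 * α) := by
    have hpt : ∀ ζ, ‖g ζ‖ ^ 2 ≤ (1 + M / A) * ‖z ζ‖ ^ 2 + (1 + A / M) * (M ^ 2 * ‖y ζ‖ ^ 2) := by
      intro ζ
      have h1 : ‖g ζ‖ ≤ ‖z ζ‖ + M * ‖y ζ‖ := by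
        refine (norm_add_le _ _).trans ?_
        rw [norm_mul, norm_mul, norm_neg, norm_one, one_mul]
        have := norm_cosPotential_le q ζ
        gcongr
        linarith
      have h2 := pow_le_pow_left₀ (norm_nonneg _) h1 2
      have h3 : (1 + M / A) * ‖z ζ‖ ^ 2 + (1 + A / M) * (M ^ 2 * ‖y ζ‖ ^ 2) -
          (‖z ζ‖ + M * ‖y ζ‖) ^ 2 = M * (‖z ζ‖ - A * ‖y ζ‖) ^ 2 / A := by
        field_simp
        ring
      have h4 : 0 ≤ M * (‖z ζ‖ - A * ‖y ζ‖) ^ 2 / A := by positivity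
      linarith
    have hi : (∫ ζ in (0 : ℝ)..(2 * Real.pi), ‖g ζ‖ ^ 2) ≤
        ∫ ζ in (0 : ℝ)..(2 * Real.pi), ((1 + M / A) * ‖z ζ‖ ^ 2 +
          (1 + A / M) * (M ^ 2 * ‖y ζ‖ ^ 2)) :=
      intervalIntegral.integral_mono Real.two_pi_pos.le
        (Continuous.intervalIntegrable (by fun_prop) _ _)
        (Continuous.intervalIntegrable (by fun_prop) _ _) hpt
    rw [intervalIntegral.integral_add (Continuous.intervalIntegrable (by fun_prop) _ _)
      (Continuous.intervalIntegrable (by fun_prop) _ _), intervalIntegral.integral_const_mul,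
      intervalIntegral.integral_const_mul, intervalIntegral.integral_const_mul] at hi
    refine (mul_le_mul_of_nonneg_left hi (by positivity)).trans (le_of_eq_of_le
      (b := (1 + M / A) * ((2 * Real.pi)⁻¹ * ∫ ζ in (0 : ℝ)..(2 * Real.pi), ‖z ζ‖ ^ 2) +
        (1 + A / M) * (M ^ 2 * ((2 * Real.pi)⁻¹ * ∫ ζ in (0 : ℝ)..(2 * Real.pi), ‖y ζ‖ ^ 2)))
      (by ring) ?_)
    rw [hym, hzm]
    gcongr
  have hsq : Bd ^ 2 ≤ (A + M) ^ 2 := by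
    have h1 := hlow.trans hup
    have h2 : (1 + M / A) * (A ^ 2 * α) + (1 + A / M) * (M ^ 2 * α) = (A + M) ^ 2 * α := by
      field_simp
      ring
    rw [h2] at h1
    exact le_of_mul_le_mul_right h1 hα
  have := abs_le_of_sq_le_sq' hsq (by positivity)
  linarith [this.2]

/-- The eigenvalues are numbered like those of the unperturbed problem. -/
lemma abs_sub_le (hD : 0 < D) (hv : v ∈ Set.Ioo (0 : ℝ) (1 / 2) ∪ Set.Ioo (1 / 2 : ℝ) 1)
    (hφ : IsEigenSystem D (cosPotential q) v μ φ) (n : ℤ) :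
    |μ n - D * (n + v) ^ 2| ≤ 2 * ‖q‖ + 1 :=
  abs_le.2 ⟨by linarith [hφ.unperturbed_le_add hD hv n],
    by linarith [hφ.le_unperturbed_add hD hv n]⟩

end IsEigenSystem

end

/-! ### Asymptotics of the density recursion -/

/-- The `ℓ¹`-mass of a sequence outside `(-j, j)`. -/
noncomputable def tailMass (a : ℤ → ℂ) (j : ℕ) : ℝ :=
  ∑' k : ℤ, if (j : ℤ) ≤ |k| then ‖a k‖ else 0

section

variable {D L κ r : ℝ} {q : ℂ} {a : ℤ → ℂ}

lemma summable_tail (ha : Summable fun k => ‖a k‖) (j : ℕ) :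
    Summable fun k : ℤ => if (j : ℤ) ≤ |k| then ‖a k‖ else 0 :=
  ha.of_nonneg_of_le (fun k => by split_ifs <;> simp) fun k => by split_ifs <;> simp

lemma norm_le_tailMass (ha : Summable fun k => ‖a k‖) {j : ℕ} {k : ℤ} (hk : (j : ℤ) ≤ |k|) :
    ‖a k‖ ≤ tailMass a j := by
  have h := (summable_tail ha j).le_tsum k fun i _ => by split_ifs <;> simp
  rwa [if_pos hk] at h

lemma hasSum_int_add {f : ℤ → ℝ} {s : ℝ} (h : HasSum f s) (c : ℤ) :
    HasSum (fun k => f (k + c)) s :=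
  (Equiv.addRight c).hasSum_iff.2 h

/-- When every term away from `0` is at most `ε` times the sum of its neighbours, one step outwards
costs a factor `2ε` in the tail. -/
lemma tailMass_succ_le (ha : Summable fun k => ‖a k‖) {ε : ℝ} (hε : 0 ≤ ε)
    (h : ∀ k : ℤ, k ≠ 0 → ‖a k‖ ≤ ε * (‖a (k - 1)‖ + ‖a (k + 1)‖)) (j : ℕ) :
    tailMass a (j + 1) ≤ 2 * ε * tailMass a j := by
  have s := summable_tail ha j
  set f : ℤ → ℝ := fun k => if (j : ℤ) ≤ |k| then ‖a k‖ else 0 with hf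
  have sm := hasSum_int_add s.hasSum (-1)
  have sp := hasSum_int_add s.hasSum 1
  have hle := hasSum_le (fun k => ?_) (summable_tail ha (j + 1)).hasSum ((sm.add sp).mul_left ε)
  · calc tailMass a (j + 1) ≤ ε * (tailMass a j + tailMass a j) := hle
      _ = _ := by ring
  · have hf0 : ∀ k, 0 ≤ f k := fun k => by simp only [hf]; split_ifs <;> simp
    rw [← sub_eq_add_neg]
    split_ifs with hk
    · have t1 := abs_add_le (k - 1) 1
      have t2 := abs_sub (k + 1) 1
      rw [sub_add_cancel, abs_one] at t1
      rw [add_sub_cancel_right, abs_one] at t2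
      push_cast at hk
      have h1 : (j : ℤ) ≤ |k - 1| := by linarith
      have h2 : (j : ℤ) ≤ |k + 1| := by linarith
      simp only [hf, if_pos h1, if_pos h2]
      refine h k ?_
      rintro rfl
      simp at hk
      omega
    · exact mul_nonneg hε (add_nonneg (hf0 _) (hf0 _))

/-- Iterating from `tailMass a 0 = 1 + tailMass a 1`, which is at most `2` because the second
summand can be absorbed. -/
lemma tailMass_le (ha : Summable fun k => ‖a k‖) (h0 : a 0 = 1) {ε : ℝ} (hε : 0 ≤ ε)
    (hε4 : ε ≤ 1 / 4) (h : ∀ k : ℤ, k ≠ 0 → ‖a k‖ ≤ ε * (‖a (k - 1)‖ + ‖a (k + 1)‖)) (j : ℕ) :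
    tailMass a j ≤ 2 * (2 * ε) ^ j := by
  induction j with
  | zero =>
    have h1 := tailMass_succ_le ha hε h 0
    have h2 : tailMass a 0 = 1 + tailMass a (0 + 1) := by
      have hs := (summable_tail ha 0).tsum_eq_add_tsum_ite 0
      rw [tailMass, hs]
      congr 1
      · simp [h0]
      · unfold tailMass
        congr 1
        ext k
        by_cases hk : k = 0
        · simp [hk]
        · have : 0 < |k| := abs_pos.2 hk
          have h1 : ((0 + 1 : ℕ) : ℤ) ≤ |k| := by push_cast; omega
          simp [hk]
    have h3 : 0 ≤ tailMass a 0 := tsum_nonneg fun k => by split_ifs <;> simp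
    rw [pow_zero, mul_one]
    nlinarith
  | succ j ih =>
    refine (tailMass_succ_le ha hε h j).trans ?_
    rw [pow_succ]
    nlinarith

/-- The three-term recursion in absolute values. -/
lemma norm_mul_le_of_recursion (hD : 0 < D)
    (hrec : ∀ k : ℤ, (k : ℂ) * (4 * L - k ^ 2) * a k =
      2 / D * ((2 * k - 1) * q * a (k - 1) + (2 * k + 1) * conj q * a (k + 1))) {k : ℤ}
    (hk : k ≠ 0) :
    |4 * L - (k : ℝ) ^ 2| * ‖a k‖ ≤ 6 * ‖q‖ / D * (‖a (k - 1)‖ + ‖a (k + 1)‖) := by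
  have hk0 : 0 < |(k : ℝ)| := abs_pos.2 (by exact_mod_cast hk)
  have hk1 : 1 ≤ |(k : ℝ)| := by
    have : 1 ≤ |k| := Int.one_le_abs hk
    exact_mod_cast this
  have h := congrArg norm (hrec k)
  have e1 : ((2 * k - 1 : ℂ)) = ((2 * k - 1 : ℝ) : ℂ) := by push_cast; ring
  have e2 : ((2 * k + 1 : ℂ)) = ((2 * k + 1 : ℝ) : ℂ) := by push_cast; ring
  have e3 : ((4 * L - k ^ 2 : ℂ)) = ((4 * L - (k : ℝ) ^ 2 : ℝ) : ℂ) := by push_cast; ring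
  have e4 : (2 / D : ℂ) = ((2 / D : ℝ) : ℂ) := by push_cast; ring
  have h2 := norm_add_le ((2 * k - 1 : ℂ) * q * a (k - 1)) ((2 * k + 1) * conj q * a (k + 1))
  rw [e1, e2] at h2
  rw [e1, e2, e3, e4] at h
  simp only [norm_mul, Complex.norm_real, Real.norm_eq_abs, RCLike.norm_conj,
    Complex.norm_intCast] at h h2
  rw [abs_of_pos (by positivity : 0 < 2 / D)] at h
  have b1 : |2 * (k : ℝ) - 1| ≤ 3 * |(k : ℝ)| := by
    have := abs_sub (2 * (k : ℝ)) 1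
    rw [abs_mul, abs_one, abs_two] at this
    linarith
  have b2 : |2 * (k : ℝ) + 1| ≤ 3 * |(k : ℝ)| := by
    have := abs_add_le (2 * (k : ℝ)) 1
    rw [abs_mul, abs_one, abs_two] at this
    linarith
  have h3 : |(k : ℝ)| * (|4 * L - (k : ℝ) ^ 2| * ‖a k‖) ≤
      |(k : ℝ)| * (6 * ‖q‖ / D * (‖a (k - 1)‖ + ‖a (k + 1)‖)) := by
    rw [← mul_assoc, h]
    calc _ ≤ 2 / D * (|2 * (k : ℝ) - 1| * ‖q‖ * ‖a (k - 1)‖ +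
            |2 * (k : ℝ) + 1| * ‖q‖ * ‖a (k + 1)‖) := by gcongr
      _ ≤ 2 / D * (3 * |(k : ℝ)| * ‖q‖ * ‖a (k - 1)‖ + 3 * |(k : ℝ)| * ‖q‖ * ‖a (k + 1)‖) := by
          gcongr
      _ = _ := by ring
  exact le_of_mul_le_mul_left h3 hk0

/-- The first coefficients of a normalized solution of the recursion up to `O(r⁻⁵)`, when all
divisors are at least of order `r` and the first ones at least of order `r²`. -/
lemma coeff_asymptotics (hD : 0 < D) (hκ : 0 < κ) (q : ℂ) : ∃ C R : ℝ, 1 ≤ R ∧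
    ∀ (r : ℝ) (L : ℝ) (a : ℤ → ℂ), R ≤ r → (Summable fun k => ‖a k‖) → a 0 = 1 →
    (∀ k : ℤ, (k : ℂ) * (4 * L - k ^ 2) * a k =
      2 / D * ((2 * k - 1) * q * a (k - 1) + (2 * k + 1) * conj q * a (k + 1))) →
    (∀ k : ℤ, κ * r ≤ |4 * L - (k : ℝ) ^ 2|) →
    (∀ k : ℤ, |k| ≤ 4 → r ^ 2 ≤ |4 * L - (k : ℝ) ^ 2|) →
    ‖a 1 - 2 * q / (D * (4 * L - 1))‖ ≤ C / r ^ 5 ∧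
    ‖a 2 - 6 * q ^ 2 / (D ^ 2 * (4 * L - 1) * (4 * L - 4))‖ ≤ C / r ^ 5 ∧
    ‖a 3‖ ≤ C / r ^ 5 ∧ ‖a 4‖ ≤ C / r ^ 5 ∧ tailMass a 5 ≤ C / r ^ 5 := by
  set β : ℝ := 6 * ‖q‖ / D with hβ
  have hβ0 : 0 ≤ β := by positivity
  set E : ℝ := β / κ with hE
  have hE0 : 0 ≤ E := by positivity
  -- bounds for `a 2`, `a 3`, `a 4` and the tail, in this order
  set C₂ : ℝ := 8 * β * E with hC₂
  set C₄ : ℝ := 32 * β * E ^ 3 with hC₄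
  set C₃ : ℝ := β * (C₂ + C₄) with hC₃
  have hC₂0 : 0 ≤ C₂ := by positivity
  have hC₄0 : 0 ≤ C₄ := by positivity
  have hC₃0 : 0 ≤ C₃ := by positivity
  refine ⟨β * C₂ + (β * (β * C₂) + β * C₃) + C₃ + C₄ + 64 * E ^ 5, max 1 (4 * E),
    le_max_left _ _, ?_⟩
  intro r L a hr hs h0 hrec hgap hgap2
  have hr1 : 1 ≤ r := (le_max_left _ _).trans hr
  have hr0 : 0 < r := by linarith
  have hrE : 4 * E ≤ r := (le_max_right _ _).trans hr
  have hmul := fun (k : ℤ) (hk : k ≠ 0) => norm_mul_le_of_recursion hD hrec hk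
  have h1 : ∀ k : ℤ, k ≠ 0 → ‖a k‖ ≤ E / r * (‖a (k - 1)‖ + ‖a (k + 1)‖) := by
    intro k hk
    have h := (mul_le_mul_of_nonneg_right (hgap k) (norm_nonneg (a k))).trans (hmul k hk)
    rw [hE, div_div, div_mul_eq_mul_div, le_div_iff₀ (by positivity)]
    linarith
  have h2 : ∀ k : ℤ, k ≠ 0 → |k| ≤ 4 → ‖a k‖ ≤ β / r ^ 2 * (‖a (k - 1)‖ + ‖a (k + 1)‖) := by
    intro k hk hk4
    have h := (mul_le_mul_of_nonneg_right (hgap2 k hk4) (norm_nonneg (a k))).trans (hmul k hk)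
    rw [div_mul_eq_mul_div, le_div_iff₀ (by positivity)]
    linarith
  have hS : ∀ j, tailMass a j ≤ 2 * (2 * (E / r)) ^ j :=
    tailMass_le hs h0 (by positivity) (by rw [div_le_iff₀ hr0]; linarith) h1
  have b2 : ‖a 2‖ ≤ C₂ / r ^ 3 := by
    refine (h2 2 (by norm_num) (by norm_num)).trans ?_
    have e1 := norm_le_tailMass hs (j := 1) (k := 2 - 1) (by norm_num)
    have e2 := norm_le_tailMass hs (j := 1) (k := 2 + 1) (by norm_num)
    have e3 := hS 1
    calc _ ≤ β / r ^ 2 * (2 * (2 * (E / r)) ^ 1 + 2 * (2 * (E / r)) ^ 1) := by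
          gcongr
          exacts [e1.trans e3, e2.trans e3]
      _ = _ := by rw [hC₂]; field_simp; ring
  have b4 : ‖a 4‖ ≤ C₄ / r ^ 5 := by
    refine (h2 4 (by norm_num) (by norm_num)).trans ?_
    have e1 := norm_le_tailMass hs (j := 3) (k := 4 - 1) (by norm_num)
    have e2 := norm_le_tailMass hs (j := 3) (k := 4 + 1) (by norm_num)
    have e3 := hS 3
    calc _ ≤ β / r ^ 2 * (2 * (2 * (E / r)) ^ 3 + 2 * (2 * (E / r)) ^ 3) := by
          gcongr
          exacts [e1.trans e3, e2.trans e3]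
      _ = _ := by rw [hC₄]; field_simp; ring
  have mono : ∀ {c : ℝ} {i j : ℕ}, 0 ≤ c → i ≤ j → c / r ^ j ≤ c / r ^ i := by
    intro c i j hc hij
    gcongr
  have b3 : ‖a 3‖ ≤ C₃ / r ^ 5 := by
    refine (h2 3 (by norm_num) (by norm_num)).trans ?_
    have e4 := b4.trans (mono (i := 3) hC₄0 (by norm_num))
    norm_num
    calc _ ≤ β / r ^ 2 * (C₂ / r ^ 3 + C₄ / r ^ 3) := by gcongr
      _ = _ := by rw [hC₃]; field_simp
  have hD' : (D : ℂ) ≠ 0 := by exact_mod_cast hD.ne'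
  have g1 : r ^ 2 ≤ ‖(4 * L - 1 : ℂ)‖ := by
    have := hgap2 1 (by norm_num)
    rw [← Real.norm_eq_abs, ← Complex.norm_real] at this
    push_cast at this
    simpa using this
  have g2 : r ^ 2 ≤ ‖(4 * L - 4 : ℂ)‖ := by
    have := hgap2 2 (by norm_num)
    rw [← Real.norm_eq_abs, ← Complex.norm_real] at this
    push_cast at this
    norm_num at this
    simpa using this
  have n1 : (4 * L - 1 : ℂ) ≠ 0 := norm_pos_iff.1 (lt_of_lt_of_le (by positivity) g1)
  have n2 : (4 * L - 4 : ℂ) ≠ 0 := norm_pos_iff.1 (lt_of_lt_of_le (by positivity) g2)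
  have b1 : ‖a 1 - 2 * q / (D * (4 * L - 1))‖ ≤ β * C₂ / r ^ 5 := by
    have h := hrec 1
    norm_num [h0] at h
    have e : a 1 - 2 * q / (D * (4 * L - 1)) = 6 * conj q * a 2 / (D * (4 * L - 1)) := by
      field_simp at h ⊢
      linear_combination h
    rw [e, norm_div, norm_mul, norm_mul, norm_mul, RCLike.norm_conj, Complex.norm_real,
      Real.norm_of_nonneg hD.le]
    norm_num
    calc 6 * ‖q‖ * ‖a 2‖ / (D * ‖(4 * L - 1 : ℂ)‖) ≤ 6 * ‖q‖ * (C₂ / r ^ 3) / (D * r ^ 2) := by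
          gcongr
      _ = _ := by rw [hβ]; field_simp
  have b2' : ‖a 2 - 6 * q ^ 2 / (D ^ 2 * (4 * L - 1) * (4 * L - 4))‖ ≤
      (β * (β * C₂) + β * C₃) / r ^ 5 := by
    have h : 2 * (4 * L - 4) * a 2 = 2 / D * (3 * q * a 1 + 5 * conj q * a 3) := by
      have := hrec 2
      norm_num at this
      linear_combination this
    have e : a 2 - 6 * q ^ 2 / (D ^ 2 * (4 * L - 1) * (4 * L - 4)) =
        (3 * q * (a 1 - 2 * q / (D * (4 * L - 1))) + 5 * conj q * a 3) / (D * (4 * L - 4)) := by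
      generalize (4 * L - 1 : ℂ) = x at n1
      generalize (4 * L - 4 : ℂ) = x' at n2 h
      field_simp at h ⊢
      linear_combination x * D * h
    rw [e, norm_div]
    have e1 := norm_add_le (3 * q * (a 1 - 2 * q / (D * (4 * L - 1)))) (5 * conj q * a 3)
    rw [norm_mul, norm_mul, norm_mul, norm_mul, RCLike.norm_conj] at e1
    norm_num at e1
    rw [norm_mul (D : ℂ), Complex.norm_real, Real.norm_of_nonneg hD.le]
    have hq := norm_nonneg q
    have hr2 : (1 : ℝ) ≤ r ^ 2 := one_le_pow₀ hr1
    calc _ ≤ (6 * ‖q‖ * (β * C₂ / r ^ 5) + 6 * ‖q‖ * (C₃ / r ^ 5)) / (D * 1) := by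
          gcongr
          · refine e1.trans ?_
            have := mul_le_mul_of_nonneg_left b1 hq
            have := mul_le_mul_of_nonneg_left b3 hq
            have := mul_nonneg hq (norm_nonneg (a 3))
            have := mul_nonneg hq (norm_nonneg (a 1 - 2 * q / (D * (4 * L - 1))))
            nlinarith
          · exact hr2.trans g2
      _ = _ := by rw [hβ]; field_simp
  have b5 : tailMass a 5 ≤ 64 * E ^ 5 / r ^ 5 := by
    refine (hS 5).trans (le_of_eq ?_)
    field_simp
    ring
  have k1 : 0 ≤ β * C₂ := by positivity
  have k2 : 0 ≤ β * (β * C₂) + β * C₃ := by positivity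
  have k5 : 0 ≤ 64 * E ^ 5 := by positivity
  refine ⟨b1.trans ?_, b2'.trans ?_, b3.trans ?_, b4.trans ?_, b5.trans ?_⟩ <;>
    exact div_le_div_of_nonneg_right (by linarith) (by positivity)

end

/-! ### Eigenvalues up to `O(1/n)` -/

section

variable {D v : ℝ} {q : ℂ}

/-- If neither factor is smaller than `θ` and one of them has size at least `R`, the product has
size at least `θ R`. -/
lemma mul_le_abs_mul {θ R s t : ℝ} (hθ : 0 < θ) (hs : θ ≤ |s|) (ht : θ ≤ |t|)
    (h : 2 * R ≤ |s| + |t|) : θ * R ≤ |s * t| := by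
  rw [abs_mul]
  rcases le_total R |s| with hR | hR
  · calc θ * R ≤ θ * |s| := by gcongr
      _ ≤ |t| * |s| := by gcongr
      _ = _ := mul_comm _ _
  · have : R ≤ |t| := by linarith
    calc θ * R ≤ θ * |t| := by gcongr
      _ ≤ |s| * |t| := by gcongr

lemma abs_sub_one_le (hv : |v| < 1) (n : ℤ) : |(n : ℝ)| - 1 ≤ |(n : ℝ) + v| := by
  have := abs_sub (n + v : ℝ) v
  rw [add_sub_cancel_right] at this
  linarith

/-- The distance from `μ n` to the unperturbed eigenvalue is `O(1/n)`: almost all of the mass of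
`φ n` sits at the frequency `n + v`, and the first-order correction vanishes because `Q` has mean
zero. -/
lemma IsEigenSystem.exists_abs_sub_le_div {μ : ℤ → ℝ} {φ : ℤ → ℝ → ℂ} (hD : 0 < D)
    (hv : v ∈ Set.Ioo (0 : ℝ) (1 / 2) ∪ Set.Ioo (1 / 2 : ℝ) 1)
    (hφ : IsEigenSystem D (cosPotential q) v μ φ) :
    ∃ C R : ℝ, 0 ≤ C ∧ ∀ n : ℤ, R ≤ |(n : ℝ)| → |μ n - D * (n + v) ^ 2| ≤ C / |(n : ℝ)| := by
  obtain ⟨θ, hθ0, hθ1, hθ⟩ := exists_dist_pos hv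
  have hv1 := abs_lt_one_of_mem hv
  set M : ℝ := 2 * ‖q‖ + 1 with hM
  have hM0 : 0 < M := by positivity
  set κ : ℝ := D * θ / 4 with hκ
  have hκ0 : 0 < κ := by positivity
  refine ⟨2 * M ^ 2 / κ, max 2 (2 * M / κ), by positivity, fun n hn => ?_⟩
  set r := |(n : ℝ)| with hr
  have hr2 : 2 ≤ r := (le_max_left _ _).trans hn
  have hr0 : 0 < r := by linarith
  have hrM : 2 * M ≤ κ * r := by
    have := (le_max_right _ _).trans hn
    rw [div_le_iff₀ hκ0] at this
    linarith
  set g := κ * r with hg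
  have hg0 : 0 < g := by positivity
  have hclose := hφ.abs_sub_le hD hv n
  -- the other unperturbed eigenvalues are at distance at least `g`
  have hgap : ∀ m : ℤ, m ≠ n → g ≤ |D * (m + v) ^ 2 - μ n| := by
    intro m hm
    have h1 : θ ≤ |(m : ℝ) - n| := by
      have : 1 ≤ |m - n| := Int.one_le_abs (sub_ne_zero.2 hm)
      have h : (1 : ℝ) ≤ |(m : ℝ) - n| := by exact_mod_cast this
      linarith
    have h2 : θ ≤ |(m : ℝ) + n + 2 * v| := by
      have := hθ (m + n); push_cast at this; exact this
    have h3 : 2 * |(n : ℝ) + v| ≤ |(m : ℝ) - n| + |(m : ℝ) + n + 2 * v| := by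
      have h := abs_sub ((m : ℝ) + n + 2 * v) (m - n)
      rw [show (m : ℝ) + n + 2 * v - (m - n) = 2 * (n + v) by ring, abs_mul, abs_two] at h
      linarith
    have h4 := mul_le_abs_mul hθ0 h1 h2 h3
    have h5 := abs_sub_one_le hv1 n
    have h6 : D * (θ * (r / 2)) ≤ D * |((m : ℝ) - n) * (m + n + 2 * v)| := by
      have : r / 2 ≤ |(n : ℝ) + v| := by linarith
      have : θ * (r / 2) ≤ θ * |(n : ℝ) + v| := by gcongr
      gcongr
      linarith
    have h7 : D * |((m : ℝ) - n) * (m + n + 2 * v)| = |D * (m + v) ^ 2 - D * (n + v) ^ 2| := by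
      rw [← abs_of_pos hD, ← abs_mul, abs_of_pos hD]
      congr 1
      ring
    have h8 := _root_.abs_sub_le (D * ((m : ℝ) + v) ^ 2) (μ n) (D * (n + v) ^ 2)
    have h9 : D * (θ * (r / 2)) = 2 * g := by rw [hg, hκ]; ring
    linarith
  have hy := hφ.solves n
  have cy := hy.continuous
  have cQ := continuous_cosPotential q
  set c : ℤ → ℂ := fun m => freqCoeff (m + v) (φ n) with hc
  set d : ℤ → ℂ := fun m => freqCoeff (m + v) (fun ζ => cosPotential q ζ * φ n ζ) with hd
  have hcd : ∀ m : ℤ, ((D * (m + v) ^ 2 - μ n : ℝ) : ℂ) * c m = -d m := by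
    intro m
    have e1 : (m + v - 1 : ℝ) = m - 1 + v := by ring
    have e2 : (m + v + 1 : ℝ) = m + 1 + v := by ring
    simp only [hc, hd]
    rw [freqCoeff_cosPotential_mul q cy, e1, e2]
    exact hy.coeff_recursion hD.ne' m
  have hcs : HasSum (fun m => ‖c m‖ ^ 2) 1 := by
    have := hasSum_sq_freqCoeff cy v
    rwa [hφ.normalized n] at this
  have hds := hasSum_sq_freqCoeff (f := fun ζ => cosPotential q ζ * φ n ζ) (by fun_prop) v
  have hdM : (2 * Real.pi)⁻¹ * ∫ ζ in (0 : ℝ)..(2 * Real.pi), ‖cosPotential q ζ * φ n ζ‖ ^ 2 ≤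
      M ^ 2 := by
    have hi : (∫ ζ in (0 : ℝ)..(2 * Real.pi), ‖cosPotential q ζ * φ n ζ‖ ^ 2) ≤
        ∫ ζ in (0 : ℝ)..(2 * Real.pi), M ^ 2 * ‖φ n ζ‖ ^ 2 := by
      refine intervalIntegral.integral_mono Real.two_pi_pos.le
        (Continuous.intervalIntegrable (by fun_prop) _ _)
        (Continuous.intervalIntegrable (by fun_prop) _ _) fun ζ => ?_
      beta_reduce
      rw [norm_mul, mul_pow]
      have := norm_cosPotential_le q ζ
      gcongr
      linarith
    rw [intervalIntegral.integral_const_mul] at hi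
    refine (mul_le_mul_of_nonneg_left hi (by positivity)).trans ?_
    rw [mul_left_comm, hφ.normalized n, mul_one]
  have hdle : ∀ m, ‖d m‖ ^ 2 ≤ M ^ 2 := fun m =>
    (le_hasSum hds m fun _ _ => by positivity).trans hdM
  -- most of the mass of `φ n` is at the frequency `n + v`
  have hcn : 1 ≤ M ^ 2 / g ^ 2 + ‖c n‖ ^ 2 := by
    refine (hasSum_le (fun m => ?_) hcs
      ((hds.div_const (g ^ 2)).add (hasSum_ite_eq n (‖c n‖ ^ 2)))).trans (by gcongr)
    split_ifs with hm
    · subst hm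
      have : 0 ≤ ‖d m‖ ^ 2 / g ^ 2 := by positivity
      linarith
    · rw [add_zero, le_div_iff₀ (by positivity)]
      have h := congrArg norm (hcd m)
      rw [norm_mul, norm_neg, Complex.norm_real, Real.norm_eq_abs] at h
      change ‖c m‖ ^ 2 * g ^ 2 ≤ ‖d m‖ ^ 2
      rw [← h, mul_comm (‖c m‖ ^ 2), mul_pow _ ‖c m‖]
      exact mul_le_mul_of_nonneg_right (pow_le_pow_left₀ hg0.le (hgap m hm) 2) (by positivity)
  have hcn2 : 1 / 2 ≤ ‖c n‖ := by
    have h1 : M ^ 2 / g ^ 2 ≤ 1 / 4 := by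
      rw [div_le_iff₀ (by positivity)]
      nlinarith
    nlinarith [norm_nonneg (c n)]
  -- the neighbouring coefficients are small
  have hsmall : ∀ m, m ≠ n → ‖c m‖ ≤ M / g := by
    intro m hm
    have h := congrArg norm (hcd m)
    rw [norm_mul, norm_neg, Complex.norm_real, Real.norm_eq_abs] at h
    rw [le_div_iff₀ hg0]
    have h1 : ‖d m‖ ≤ M := by
      have := abs_le_of_sq_le_sq' (hdle m) hM0.le
      exact this.2
    have h2 := mul_le_mul_of_nonneg_right (hgap m hm) (norm_nonneg (c m))
    linarith
  have h := congrArg norm (hy.coeff_recursion hD.ne' n)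
  rw [norm_mul, norm_neg, Complex.norm_real, Real.norm_eq_abs] at h
  have h1 := norm_add_le (q * freqCoeff (n - 1 + v) (φ n)) (conj q * freqCoeff (n + 1 + v) (φ n))
  rw [norm_mul, norm_mul, RCLike.norm_conj] at h1
  have h2 := hsmall (n - 1) (by omega)
  have h3 := hsmall (n + 1) (by omega)
  simp only [hc] at h2 h3 hcn2
  push_cast at h2 h3
  have hq := norm_nonneg q
  have h4 : |D * (n + v) ^ 2 - μ n| * (1 / 2) ≤ 2 * ‖q‖ * (M / g) := by
    calc _ ≤ |D * (n + v) ^ 2 - μ n| * ‖freqCoeff (n + v) (φ n)‖ := by gcongr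
      _ ≤ ‖q‖ * (M / g) + ‖q‖ * (M / g) := by rw [h]; refine h1.trans ?_; gcongr
      _ = _ := by ring
  rw [abs_sub_comm]
  have h5 : 2 * M ^ 2 / κ / r = 2 * (M * (M / g)) := by rw [hg]; field_simp
  have h6 : 2 * ‖q‖ * (M / g) ≤ M * (M / g) := by
    gcongr
    linarith
  rw [h5]
  linarith

/-- The coefficient of the potential (up to the factor `1/D`) in the expansion of `|φ n|²`: the
polynomial in `1/n` of degree `4` that approximates `2 / (4(n+v)² - 1)`. -/
noncomputable def firstHarmonic (v n : ℝ) : ℝ :=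
  1 / (2 * n ^ 2) - v / n ^ 3 + (12 * v ^ 2 + 1) / (8 * n ^ 4)

/-- An error `O(1/n)` in `L` is harmless here, as `1 / (4L - 1)` has derivative `O(1/n⁴)`. -/
lemma abs_two_div_sub_firstHarmonic_le (hv : |v| < 1) {C₁ n L : ℝ} (hC₁ : 0 ≤ C₁) (hn : 1 ≤ |n|)
    (hL : |L - (n + v) ^ 2| ≤ C₁ / |n|) (hX : |n| ^ 2 ≤ |4 * L - 1|) :
    |2 / (4 * L - 1) - firstHarmonic v n| ≤ (15 + 16 * C₁) / |n| ^ 5 := by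
  set r := |n| with hr
  have hr0 : 0 < r := by linarith
  have hn0 : n ≠ 0 := abs_pos.1 hr0
  have hX0 : 4 * L - 1 ≠ 0 := abs_pos.1 (lt_of_lt_of_le (by positivity) hX)
  have hv2 : v ^ 2 ≤ 1 := by nlinarith [abs_lt.1 hv]
  have hv0 := abs_nonneg v
  set e := L - (n + v) ^ 2 with he
  have hLe : L = (n + v) ^ 2 + e := by rw [he]; ring
  have hP : |firstHarmonic v n| ≤ 4 / r ^ 2 := by
    unfold firstHarmonic
    have h1 := abs_add_le (1 / (2 * n ^ 2) - v / n ^ 3) ((12 * v ^ 2 + 1) / (8 * n ^ 4))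
    have h2 := abs_sub (1 / (2 * n ^ 2)) (v / n ^ 3)
    rw [abs_div, abs_div, abs_mul, abs_pow, abs_pow, abs_one, abs_two, ← hr] at h2
    rw [abs_div ((12 * v ^ 2 + 1)), abs_mul, abs_pow n, ← hr,
      abs_of_nonneg (by positivity : 0 ≤ 12 * v ^ 2 + 1),
      abs_of_pos (by norm_num : (0 : ℝ) < 8)] at h1
    have a1 : 1 / (2 * r ^ 2) = (1 / 2) / r ^ 2 := by field_simp
    have a2 : |v| / r ^ 3 ≤ 1 / r ^ 2 := by
      gcongr
      norm_num
    have a3 : (12 * v ^ 2 + 1) / (8 * r ^ 4) ≤ (13 / 8) / r ^ 2 := by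
      rw [div_le_div_iff₀ (by positivity) (by positivity)]
      have : 1 ≤ r ^ 2 := one_le_pow₀ hn
      have hr4 : r ^ 4 = r ^ 2 * r ^ 2 := by ring
      rw [hr4]
      nlinarith [mul_nonneg (sub_nonneg.2 this) (sq_nonneg r),
        mul_nonneg (sub_nonneg.2 hv2) (sq_nonneg r)]
    have a4 : (4 : ℝ) / r ^ 2 =
        (1 / 2) / r ^ 2 + 1 / r ^ 2 + (13 / 8) / r ^ 2 + (7 / 8) / r ^ 2 := by
      rw [← add_div, ← add_div, ← add_div]; norm_num
    have a5 : 0 ≤ (7 / 8) / r ^ 2 := by positivity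
    linarith
  have hid : 2 / (4 * L - 1) - firstHarmonic v n =
      -((8 * v ^ 3 + 2 * v) / n ^ 3 + (4 * v ^ 2 - 1) * (12 * v ^ 2 + 1) / 8 / n ^ 4 +
        4 * e * firstHarmonic v n) / (4 * L - 1) := by
    rw [eq_div_iff hX0, sub_mul, div_mul_cancel₀ _ hX0]
    rw [hLe]
    unfold firstHarmonic
    field_simp
    ring
  have b1 : |(8 * v ^ 3 + 2 * v) / n ^ 3| ≤ 10 / r ^ 3 := by
    rw [abs_div, abs_pow, ← hr]
    gcongr
    have : 8 * v ^ 3 + 2 * v = v * (8 * v ^ 2 + 2) := by ring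
    rw [this, abs_mul, abs_of_nonneg (by positivity : 0 ≤ 8 * v ^ 2 + 2)]
    nlinarith
  have b2 : |(4 * v ^ 2 - 1) * (12 * v ^ 2 + 1) / 8 / n ^ 4| ≤ 5 / r ^ 3 := by
    rw [abs_div, abs_pow, ← hr]
    have h1 : |(4 * v ^ 2 - 1) * (12 * v ^ 2 + 1) / 8| ≤ 5 := by
      rw [abs_le]
      constructor <;> nlinarith [sq_nonneg v]
    calc _ ≤ 5 / r ^ 4 := by gcongr
      _ ≤ 5 / r ^ 3 := by gcongr; norm_num
  have b3 : |4 * e * firstHarmonic v n| ≤ 16 * C₁ / r ^ 3 := by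
    rw [abs_mul, abs_mul, abs_of_pos (by norm_num : (0 : ℝ) < 4)]
    calc _ ≤ 4 * (C₁ / r) * (4 / r ^ 2) := by gcongr
      _ = _ := by field_simp; ring
  rw [hid, abs_div, abs_neg]
  have b4 := abs_add_le ((8 * v ^ 3 + 2 * v) / n ^ 3 +
    (4 * v ^ 2 - 1) * (12 * v ^ 2 + 1) / 8 / n ^ 4) (4 * e * firstHarmonic v n)
  have b5 := abs_add_le ((8 * v ^ 3 + 2 * v) / n ^ 3)
    ((4 * v ^ 2 - 1) * (12 * v ^ 2 + 1) / 8 / n ^ 4)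
  have b6 : (15 + 16 * C₁) / r ^ 3 = 10 / r ^ 3 + 5 / r ^ 3 + 16 * C₁ / r ^ 3 := by ring
  calc _ ≤ ((15 + 16 * C₁) / r ^ 3) / r ^ 2 := by
        gcongr
        linarith
    _ = _ := by field_simp

lemma abs_six_div_sub_le (hv : |v| < 1) {C₁ n L : ℝ} (hC₁ : 0 ≤ C₁) (hn : 1 ≤ |n|)
    (hL : |L - (n + v) ^ 2| ≤ C₁ / |n|) (hX : |n| ^ 2 ≤ |4 * L - 1|)
    (hY : |n| ^ 2 ≤ |4 * L - 4|) :
    |6 / ((4 * L - 1) * (4 * L - 4)) - 3 / (8 * n ^ 4)| ≤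
      (8 * (16 + 4 * C₁) + (16 + 4 * C₁) ^ 2) / |n| ^ 5 := by
  set r := |n| with hr
  have hr0 : 0 < r := by linarith
  have hn0 : n ≠ 0 := abs_pos.1 hr0
  have hX0 : 4 * L - 1 ≠ 0 := abs_pos.1 (lt_of_lt_of_le (by positivity) hX)
  have hY0 : 4 * L - 4 ≠ 0 := abs_pos.1 (lt_of_lt_of_le (by positivity) hY)
  have hv2 : v ^ 2 ≤ 1 := by nlinarith [abs_lt.1 hv]
  set e := L - (n + v) ^ 2 with he
  have hLe : L = (n + v) ^ 2 + e := by rw [he]; ring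
  set K := 16 + 4 * C₁ with hK
  have hK0 : 0 ≤ K := by positivity
  have hdiff : ∀ c : ℝ, 0 ≤ c → c ≤ 4 → |4 * L - c - 4 * n ^ 2| ≤ K * r := by
    intro c hc0 hc4
    have h1 : 4 * L - c - 4 * n ^ 2 = 8 * (n * v) + (4 * v ^ 2 - c) + 4 * e := by rw [hLe]; ring
    have h2 := abs_add_le (8 * (n * v) + (4 * v ^ 2 - c)) (4 * e)
    have h3 := abs_add_le (8 * (n * v)) (4 * v ^ 2 - c)
    rw [abs_mul, abs_mul, ← hr, abs_of_pos (by norm_num : (0 : ℝ) < 8)] at h3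
    rw [abs_mul 4 e, abs_of_pos (by norm_num : (0 : ℝ) < 4)] at h2
    have h4 : |4 * v ^ 2 - c| ≤ 4 := by
      rw [abs_le]; constructor <;> nlinarith [sq_nonneg v]
    have h5 : C₁ / r ≤ C₁ := div_le_self hC₁ hn
    have h6 : r * |v| ≤ r := mul_le_of_le_one_right hr0.le hv.le
    rw [h1, hK]
    nlinarith
  have d1 := hdiff 1 (by norm_num) (by norm_num)
  have d4 := hdiff 4 (by norm_num) (by norm_num)
  have hid : 6 / ((4 * L - 1) * (4 * L - 4)) - 3 / (8 * n ^ 4) =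
      -(3 / (8 * n ^ 4) * (4 * n ^ 2 * ((4 * L - 1 - 4 * n ^ 2) + (4 * L - 4 - 4 * n ^ 2)) +
        (4 * L - 1 - 4 * n ^ 2) * (4 * L - 4 - 4 * n ^ 2))) / ((4 * L - 1) * (4 * L - 4)) := by
    generalize 4 * L - 1 = x at *
    generalize 4 * L - 4 = x' at *
    field_simp
    ring
  rw [hid, abs_div, abs_neg, abs_mul, abs_mul (4 * L - 1), abs_div, abs_mul (8 : ℝ), abs_pow, ← hr,
    abs_of_pos (by norm_num : (0 : ℝ) < 8), abs_of_pos (by norm_num : (0 : ℝ) < 3)]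
  have b1 := abs_add_le (4 * n ^ 2 * ((4 * L - 1 - 4 * n ^ 2) + (4 * L - 4 - 4 * n ^ 2)))
    ((4 * L - 1 - 4 * n ^ 2) * (4 * L - 4 - 4 * n ^ 2))
  have b2 := abs_add_le (4 * L - 1 - 4 * n ^ 2) (4 * L - 4 - 4 * n ^ 2)
  rw [abs_mul, abs_mul (4 : ℝ), abs_pow, ← hr, abs_of_pos (by norm_num : (0 : ℝ) < 4),
    abs_mul (4 * L - 1 - 4 * n ^ 2)] at b1
  have b3 : |4 * n ^ 2 * ((4 * L - 1 - 4 * n ^ 2) + (4 * L - 4 - 4 * n ^ 2)) +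
      (4 * L - 1 - 4 * n ^ 2) * (4 * L - 4 - 4 * n ^ 2)| ≤ (8 * K + K ^ 2) * r ^ 3 := by
    refine b1.trans ?_
    calc _ ≤ 4 * r ^ 2 * (K * r + K * r) + K * r * (K * r) := by
          gcongr
          linarith
      _ = 8 * K * r ^ 3 + K ^ 2 * r ^ 2 := by ring
      _ ≤ 8 * K * r ^ 3 + K ^ 2 * r ^ 3 := by gcongr; norm_num
      _ = _ := by ring
  calc _ ≤ 3 / (8 * r ^ 4) * ((8 * K + K ^ 2) * r ^ 3) / (r ^ 2 * r ^ 2) := by gcongr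
    _ = 3 / 8 * ((8 * K + K ^ 2) / r ^ 5) := by field_simp
    _ ≤ 1 * ((8 * K + K ^ 2) / r ^ 5) := by gcongr; norm_num
    _ = _ := one_mul _

end

/-! ### Expansion of the density -/

section

variable {D v : ℝ} {q : ℂ}

/-- A Fourier series differs from its partial sum over `|k| ≤ 4` by at most its tail. -/
lemma norm_sub_partialSum_le {a : ℤ → ℂ} (ha : Summable fun k => ‖a k‖) {ζ : ℝ} {w : ℂ}
    (hw : HasSum (fun k : ℤ => a k * Complex.exp (Complex.I * (k * ζ))) w) :
    ‖w - ∑ k ∈ Finset.Icc (-4 : ℤ) 4, a k * Complex.exp (Complex.I * (k * ζ))‖ ≤ tailMass a 5 := by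
  have h1 : HasSum (fun k : ℤ => if k ∈ Finset.Icc (-4 : ℤ) 4 then
      a k * Complex.exp (Complex.I * (k * ζ)) else 0)
      (∑ k ∈ Finset.Icc (-4 : ℤ) 4, a k * Complex.exp (Complex.I * (k * ζ))) := by
    have := hasSum_sum_of_ne_finset_zero (L := SummationFilter.unconditional ℤ)
      (s := Finset.Icc (-4 : ℤ) 4)
      (f := fun k : ℤ => if k ∈ Finset.Icc (-4 : ℤ) 4 then
        a k * Complex.exp (Complex.I * (k * ζ)) else 0) (fun k hk => if_neg hk)
    rwa [Finset.sum_congr rfl (fun k hk => if_pos hk)] at this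
  have h2 := hw.sub h1
  rw [← h2.tsum_eq]
  refine tsum_of_norm_bounded (summable_tail ha 5).hasSum fun k => ?_
  have hexp : ‖Complex.exp (Complex.I * (k * ζ))‖ = 1 := by
    have := norm_expI (k * ζ)
    push_cast at this
    exact this
  by_cases hk : k ∈ Finset.Icc (-4 : ℤ) 4
  · rw [if_pos hk, sub_self, norm_zero]
    split_ifs <;> simp
  · have h5 : ((5 : ℕ) : ℤ) ≤ |k| := by
      rw [Finset.mem_Icc, ← abs_le, not_le] at hk
      push_cast
      omega
    rw [if_neg hk, sub_zero, if_pos h5, norm_mul, hexp, mul_one]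

/-- The expansion of `|φ n|²` in powers of `1/n`, uniform in `ζ`. -/
theorem IsEigenSystem.exists_density_expansion {μ : ℤ → ℝ} {φ : ℤ → ℝ → ℂ} (hD : 0 < D)
    (hv : v ∈ Set.Ioo (0 : ℝ) (1 / 2) ∪ Set.Ioo (1 / 2 : ℝ) 1)
    (hφ : IsEigenSystem D (cosPotential q) v μ φ) :
    ∃ C R : ℝ, ∀ n : ℤ, R ≤ |(n : ℝ)| → ∀ ζ : ℝ,
      ‖((‖φ n ζ‖ ^ 2 : ℝ) : ℂ) - (1 + (firstHarmonic v n / D : ℝ) * cosPotential q ζ +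
        (3 / (8 * n ^ 4) / D ^ 2 : ℝ) * (q ^ 2 * Complex.exp (Complex.I * (2 * ζ)) +
          conj q ^ 2 * Complex.exp (-(Complex.I * (2 * ζ)))))‖ ≤ C / |(n : ℝ)| ^ 5 := by
  obtain ⟨θ, hθ0, hθ1, hθ⟩ := exists_dist_pos hv
  have hv1 := abs_lt_one_of_mem hv
  obtain ⟨C₀, R₀, hC₀, hμ⟩ := hφ.exists_abs_sub_le_div hD hv
  obtain ⟨C₂, R₂, hR₂, hco⟩ := coeff_asymptotics hD (half_pos hθ0) q
  obtain ⟨C₃, R₃, -, hco'⟩ := coeff_asymptotics hD (half_pos hθ0) (conj q)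
  set C₁ : ℝ := C₀ / D with hC₁
  have hC₁0 : 0 ≤ C₁ := by positivity
  set K : ℝ := 8 * (16 + 4 * C₁) + (16 + 4 * C₁) ^ 2 with hK
  refine ⟨5 * C₂ + 4 * C₃ + (15 + 16 * C₁) / D * (2 * ‖q‖) + K / D ^ 2 * (2 * ‖q‖ ^ 2),
    max R₀ (max R₂ (max R₃ (max (8 * C₁ / θ) (4 * C₁ + 16)))), fun n hn ζ => ?_⟩
  set r := |(n : ℝ)| with hr
  simp only [max_le_iff] at hn
  obtain ⟨hn0, hn2, hn3, hnθ, hn16⟩ := hn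
  have hr4 : 4 ≤ r := by linarith
  have hr1 : 1 ≤ r := by linarith
  have hr0 : 0 < r := by linarith
  set L : ℝ := μ n / D with hL
  have hLn : |L - (n + v) ^ 2| ≤ C₁ / r := by
    have h1 : L - (n + v) ^ 2 = (μ n - D * (n + v) ^ 2) / D := by rw [hL]; field_simp
    rw [h1, abs_div, abs_of_pos hD, div_le_iff₀ hD]
    refine (hμ n hn0).trans (le_of_eq ?_)
    rw [hC₁, div_right_comm, div_mul_cancel₀ _ hD.ne']
  have hLn' : |L - (n + v) ^ 2| ≤ C₁ := hLn.trans (div_le_self hC₁0 hr1)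
  have hnv := abs_sub_one_le hv1 n
  rw [← hr] at hnv
  -- no resonances: `4L` keeps away from the squares
  have hgap : ∀ k : ℤ, θ / 2 * r ≤ |4 * L - (k : ℝ) ^ 2| := by
    intro k
    have h1 := hθ (2 * n - k)
    have h2 := hθ (2 * n + k)
    push_cast at h1 h2
    have h3 : 2 * (2 * |(n : ℝ) + v|) ≤ |2 * (n : ℝ) - k + 2 * v| + |2 * (n : ℝ) + k + 2 * v| := by
      have h := abs_add_le (2 * (n : ℝ) - k + 2 * v) (2 * n + k + 2 * v)
      rw [show 2 * (n : ℝ) - k + 2 * v + (2 * n + k + 2 * v) = 4 * (n + v) by ring, abs_mul,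
        abs_of_pos (by norm_num : (0 : ℝ) < 4)] at h
      linarith
    have h4 := mul_le_abs_mul hθ0 h1 h2 h3
    rw [show (2 * (n : ℝ) - k + 2 * v) * (2 * n + k + 2 * v) = 4 * (n + v) ^ 2 - k ^ 2 by ring]
      at h4
    have h5 := _root_.abs_sub_le (4 * ((n : ℝ) + v) ^ 2) (4 * L) ((k : ℝ) ^ 2)
    have h6 : |4 * ((n : ℝ) + v) ^ 2 - 4 * L| ≤ 4 * C₁ := by
      rw [← mul_sub, abs_mul, abs_of_pos (by norm_num : (0 : ℝ) < 4), abs_sub_comm]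
      linarith
    rw [div_le_iff₀ hθ0] at hnθ
    have h7 : θ * r ≤ θ * (2 * |(n : ℝ) + v|) := by
      gcongr
      linarith
    linarith
  have hgap2 : ∀ k : ℤ, |k| ≤ 4 → r ^ 2 ≤ |4 * L - (k : ℝ) ^ 2| := by
    intro k hk
    have hk' : |(k : ℝ)| ≤ 4 := by exact_mod_cast hk
    have h1 : (k : ℝ) ^ 2 ≤ 16 := by
      rw [← sq_abs]; nlinarith [abs_nonneg (k : ℝ)]
    have h2 : (r - 1) ^ 2 ≤ ((n : ℝ) + v) ^ 2 := by
      rw [← sq_abs ((n : ℝ) + v)]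
      exact pow_le_pow_left₀ (by linarith) hnv 2
    have h3 := (abs_le.1 hLn').1
    refine le_trans ?_ (le_abs_self _)
    nlinarith
  have hX : r ^ 2 ≤ |4 * L - 1| := by simpa using hgap2 1 (by norm_num)
  have hY : r ^ 2 ≤ |4 * L - 4| := by
    have := hgap2 2 (by norm_num)
    norm_num at this
    exact this
  -- the Fourier coefficients of the density
  set w : ℝ → ℂ := fun ζ => φ n ζ * conj (φ n ζ) with hw
  have hsol := hφ.solves n
  have cw : Continuous w := hsol.continuous.mul (Complex.continuous_conj.comp hsol.continuous)
  have pw : w.Periodic (2 * Real.pi) := by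
    intro ζ
    simp only [hw]
    rw [hsol.2.2, map_mul]
    linear_combination φ n ζ * conj (φ n ζ) * SolvesFloquet.multiplier_mul_conj (v := v)
  obtain ⟨hrec, hsum⟩ := hsol.normSq_coeff_recursion hD.ne'
  set a : ℤ → ℂ := fun k => freqCoeff k w with ha
  have hsum' : Summable fun k => ‖a k‖ := hsum.norm
  have ha0 : a 0 = 1 := by
    have := hφ.orthonormal hD.ne' hv n n
    rw [if_pos rfl] at this
    simp only [ha, freqCoeff, Int.cast_zero, Complex.ofReal_zero, mul_zero, zero_mul, neg_zero,
      Complex.exp_zero, mul_one]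
    exact this
  have hrec' : ∀ k : ℤ, (k : ℂ) * (4 * L - k ^ 2) * a k =
      2 / D * ((2 * k - 1) * q * a (k - 1) + (2 * k + 1) * conj q * a (k + 1)) := by
    intro k
    have h := hrec k
    simp only [ha]
    push_cast
    rw [hL]
    push_cast
    exact h
  have hneg : ∀ k : ℤ, (k : ℂ) * (4 * L - k ^ 2) * a (-k) =
      2 / D * ((2 * k - 1) * conj q * a (-(k - 1)) +
        (2 * k + 1) * conj (conj q) * a (-(k + 1))) := by
    intro k
    have h := hrec' (-k)
    rw [show -k - 1 = -(k + 1) by ring, show -k + 1 = -(k - 1) by ring] at h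
    rw [Complex.conj_conj]
    push_cast at h ⊢
    linear_combination -h
  obtain ⟨a1, a2, a3, a4, a5⟩ := hco r L a hn2 hsum' ha0 hrec' hgap hgap2
  obtain ⟨b1, b2, b3, b4, -⟩ := hco' r L (fun k => a (-k)) hn3 (hsum'.comp_injective neg_injective)
    (by simpa using ha0) hneg hgap hgap2
  have hpart := norm_sub_partialSum_le hsum' (hasSum_freqCoeff cw pw hsum ζ)
  have hF : Finset.Icc (-4 : ℤ) 4 = {-4, -3, -2, -1, 0, 1, 2, 3, 4} := by decide
  have hexp : ∀ k : ℤ, ‖Complex.exp (Complex.I * (k * ζ))‖ = 1 := by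
    intro k
    have := norm_expI (k * ζ)
    push_cast at this
    exact this
  have hmulE : ∀ (k : ℤ) {x : ℂ} {c : ℝ}, ‖x‖ ≤ c →
      ‖x * Complex.exp (Complex.I * (k * ζ))‖ ≤ c := by
    intro k x c hx
    rwa [norm_mul, hexp, mul_one]
  -- replacing `L` by powers of `n`
  have t1 : ‖(((2 / (4 * L - 1) - firstHarmonic v n) / D : ℝ) : ℂ) * cosPotential q ζ‖ ≤
      (15 + 16 * C₁) / D * (2 * ‖q‖) / r ^ 5 := by
    have h1 := abs_two_div_sub_firstHarmonic_le hv1 hC₁0 hr1 hLn hX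
    rw [norm_mul, Complex.norm_real, Real.norm_eq_abs, abs_div, abs_of_pos hD]
    have h2 := norm_cosPotential_le q ζ
    calc _ ≤ (15 + 16 * C₁) / r ^ 5 / D * (2 * ‖q‖) := by gcongr
      _ = _ := by field_simp
  have t2 : ‖(((6 / ((4 * L - 1) * (4 * L - 4)) - 3 / (8 * (n : ℝ) ^ 4)) / D ^ 2 : ℝ) : ℂ) *
      (q ^ 2 * Complex.exp (Complex.I * ((2 : ℤ) * ζ)) +
        conj q ^ 2 * Complex.exp (Complex.I * ((-2 : ℤ) * ζ)))‖ ≤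
      K / D ^ 2 * (2 * ‖q‖ ^ 2) / r ^ 5 := by
    have h1 := abs_six_div_sub_le hv1 hC₁0 hr1 hLn hX hY
    rw [norm_mul, Complex.norm_real, Real.norm_eq_abs, abs_div,
      abs_of_pos (by positivity : 0 < D ^ 2)]
    have h2 : ‖q ^ 2 * Complex.exp (Complex.I * ((2 : ℤ) * ζ)) +
        conj q ^ 2 * Complex.exp (Complex.I * ((-2 : ℤ) * ζ))‖ ≤ 2 * ‖q‖ ^ 2 := by
      refine (norm_add_le _ _).trans (le_of_eq ?_)
      rw [norm_mul, norm_mul, hexp, hexp, norm_pow, norm_pow, RCLike.norm_conj]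
      ring
    calc _ ≤ K / r ^ 5 / D ^ 2 * (2 * ‖q‖ ^ 2) := by gcongr
      _ = _ := by field_simp
  have total := norm_add_le_of_le (norm_add_le_of_le (norm_add_le_of_le (norm_add_le_of_le
    (norm_add_le_of_le (norm_add_le_of_le (norm_add_le_of_le (norm_add_le_of_le (norm_add_le_of_le
    (norm_add_le_of_le (hpart.trans a5) (hmulE 1 a1)) (hmulE 2 a2)) (hmulE 3 a3)) (hmulE 4 a4))
    (hmulE (-1) b1)) (hmulE (-2) b2)) (hmulE (-3) b3)) (hmulE (-4) b4)) t1) t2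
  have hwζ : ((‖φ n ζ‖ ^ 2 : ℝ) : ℂ) = w ζ := by
    simp only [hw]
    rw [Complex.mul_conj', Complex.ofReal_pow]
  have e2p : Complex.exp (Complex.I * (2 * ζ)) = Complex.exp (Complex.I * ((2 : ℤ) * ζ)) := by
    push_cast; rfl
  have e2m : Complex.exp (-(Complex.I * (2 * ζ))) = Complex.exp (Complex.I * ((-2 : ℤ) * ζ)) := by
    congr 1; push_cast; ring
  have e1p : Complex.exp (Complex.I * ζ) = Complex.exp (Complex.I * ((1 : ℤ) * ζ)) := by
    congr 1; push_cast; ring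
  have e1m : Complex.exp (-(Complex.I * ζ)) = Complex.exp (Complex.I * ((-1 : ℤ) * ζ)) := by
    congr 1; push_cast; ring
  have e0 : Complex.exp (Complex.I * ((0 : ℤ) * ζ)) = 1 := by simp
  refine le_trans (le_of_eq ?_) (total.trans (le_of_eq ?_))
  · congr 1
    rw [hF, hwζ]
    simp only [cosPotential]
    rw [e2p, e2m, e1p, e1m]
    rw [Finset.sum_insert (by decide), Finset.sum_insert (by decide), Finset.sum_insert (by decide),
      Finset.sum_insert (by decide), Finset.sum_insert (by decide), Finset.sum_insert (by decide),
      Finset.sum_insert (by decide), Finset.sum_insert (by decide), Finset.sum_singleton, ha0, e0]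
    generalize Complex.exp (Complex.I * ((1 : ℤ) * ζ)) = E1
    generalize Complex.exp (Complex.I * ((-1 : ℤ) * ζ)) = E2
    generalize Complex.exp (Complex.I * ((2 : ℤ) * ζ)) = E3
    generalize Complex.exp (Complex.I * ((-2 : ℤ) * ζ)) = E4
    push_cast
    generalize (4 * (L : ℂ) - 1) = X
    generalize (4 * (L : ℂ) - 4) = Y
    ring
  · ring

end

/-! ### Lattice sums and the potentials `q_{δ,b}` -/

section

variable {d : ℕ} {B : Module.Basis (Fin d) ℝ (EuclideanSpace ℝ (Fin d))}
  {q : EuclideanSpace ℝ (Fin d) → ℝ} {δ b : EuclideanSpace ℝ (Fin d)}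

/-- The coordinates `(γ, B i) / 2π`, which are integers exactly on the dual lattice. -/
noncomputable def dualCoord (B : Module.Basis (Fin d) ℝ (EuclideanSpace ℝ (Fin d))) :
    EuclideanSpace ℝ (Fin d) →ₗ[ℝ] (Fin d → ℝ) :=
  LinearMap.pi fun i => (2 * Real.pi)⁻¹ • (innerₗ (EuclideanSpace ℝ (Fin d)) (B i))

lemma dualCoord_apply (γ : EuclideanSpace ℝ (Fin d)) (i : Fin d) :
    dualCoord B γ i = (2 * Real.pi)⁻¹ * inner ℝ γ (B i) := by
  simp [dualCoord, real_inner_comm]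

lemma dualCoord_injective : Function.Injective (dualCoord B) := by
  rw [← LinearMap.ker_eq_bot, LinearMap.ker_eq_bot']
  intro γ hγ
  refine InnerProductSpace.ext_inner_left_basis (𝕜 := ℝ) B fun i => ?_
  have h := congrFun hγ i
  rw [dualCoord_apply, real_inner_comm] at h
  simpa [Real.pi_ne_zero] using h

/-- The basis of `ℝ^d` dual to `B`, multiplied by `2π`. -/
noncomputable def dualBasis (B : Module.Basis (Fin d) ℝ (EuclideanSpace ℝ (Fin d))) :
    Module.Basis (Fin d) ℝ (EuclideanSpace ℝ (Fin d)) :=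
  Module.Basis.ofEquivFun
    (LinearMap.linearEquivOfInjective (dualCoord B) dualCoord_injective (by simp))

lemma mem_span_dualBasis {γ : EuclideanSpace ℝ (Fin d)} (hγ : γ ∈ dualLattice B) :
    γ ∈ Submodule.span ℤ (Set.range (dualBasis B)) := by
  rw [Module.Basis.mem_span_iff_repr_mem]
  intro i
  obtain ⟨k, hk⟩ := hγ (B i) (Submodule.subset_span ⟨i, rfl⟩)
  refine ⟨k, ?_⟩
  rw [← Module.Basis.equivFun_apply, dualBasis, Module.Basis.equivFun_ofEquivFun,
    LinearMap.linearEquivOfInjective_apply, dualCoord_apply, hk]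
  have := Real.pi_ne_zero
  simp
  field_simp

lemma summable_norm_rpow_dualLattice {r : ℝ} (hr : r < -d) :
    Summable fun γ : dualLattice B => ‖(γ : EuclideanSpace ℝ (Fin d))‖ ^ r := by
  have key : ∀ L : Submodule ℤ (EuclideanSpace ℝ (Fin d)), (∀ γ ∈ dualLattice B, γ ∈ L) →
      (Summable fun z : L => ‖(z : EuclideanSpace ℝ (Fin d))‖ ^ r) →
      Summable fun γ : dualLattice B => ‖(γ : EuclideanSpace ℝ (Fin d))‖ ^ r :=
    fun L hL h => h.comp_injective (i := fun γ : dualLattice B => (⟨γ.1, hL γ.1 γ.2⟩ : L))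
      fun γ γ' h => Subtype.ext (congrArg (fun z : L => z.1) h)
  have hrank : Module.finrank ℤ (Submodule.span ℤ (Set.range (dualBasis B))) = d := by
    rw [ZLattice.rank ℝ]
    simp
  exact key (Submodule.span ℤ (Set.range (dualBasis B))) (fun _ => mem_span_dualBasis)
    (ZLattice.summable_norm_rpow _ r (by rwa [hrank]))

/-- The Fourier series of the gradient of a Sobolev potential converges absolutely. -/
lemma IsPeriodicSobolev.summable_norm_mul {s : ℝ} (hq : IsPeriodicSobolev B s q)
    (hs : d + 2 < 2 * s) :
    Summable fun γ : dualLattice B =>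
      ‖fourierCoeff B q γ‖ * ‖(γ : EuclideanSpace ℝ (Fin d))‖ := by
  have h := hq.2.2.add (summable_norm_rpow_dualLattice (B := B) (r := 2 - 2 * s) (by linarith))
  refine Summable.of_nonneg_of_le (fun γ => by positivity) (fun γ => ?_) h
  rcases eq_or_ne (γ : EuclideanSpace ℝ (Fin d)) 0 with h0 | h0
  · rw [h0]
    simp only [norm_zero, mul_zero]
    positivity
  · have hpos : 0 < ‖(γ : EuclideanSpace ℝ (Fin d))‖ := norm_pos_iff.2 h0
    set c := ‖fourierCoeff B q γ‖
    set g := ‖(γ : EuclideanSpace ℝ (Fin d))‖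
    have h1 : g ^ (2 - 2 * s) * g ^ (2 * s) = g ^ 2 := by
      rw [← Real.rpow_add hpos, sub_add_cancel, Real.rpow_two]
    set t := g ^ (2 * s)
    have ht : 0 < t := Real.rpow_pos_of_pos hpos _
    set u := g ^ (2 - 2 * s)
    have hu : 0 < u := Real.rpow_pos_of_pos hpos _
    have h2 : (c * g) ^ 2 = (c ^ 2 * t) * u := by rw [mul_pow, ← h1]; ring
    have h3 : c * g ≤ c ^ 2 * t + u := by
      refine abs_le_of_sq_le_sq' ?_ (by positivity) |>.2
      have : 0 ≤ c ^ 2 * t := by positivity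
      nlinarith
    nlinarith [sq_nonneg c]

/-- The divisors `(b, γ)` are bounded below. Off the line `ℝδ`, the elements of the dual lattice in
the plane of `δ` and `b` have a component along `b` which lies in `Γ_δ`, hence is at least as long
as the maximal element `b`. -/
lemma sq_norm_le_abs_inner (hb : IsMaximalElement (dualLatticePerp B δ) b)
    {γ : EuclideanSpace ℝ (Fin d)} (hγ : γ ∈ planeIndices B δ b) :
    ‖b‖ ^ 2 ≤ |inner ℝ b γ| := by
  obtain ⟨⟨hbδ, -⟩, hb0, hmax⟩ := hb
  obtain ⟨hγΓ, hγp, hγl⟩ := hγ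
  obtain ⟨α, β, rfl⟩ := Submodule.mem_span_pair.1 hγp
  have hβ : β ≠ 0 := by
    rintro rfl
    exact hγl (Submodule.mem_span_singleton.2 ⟨α, by simp⟩)
  have hnorm := hmax (β • b) ⟨by rw [inner_smul_left, hbδ, mul_zero], fun h hh hhδ => by
    obtain ⟨k, hk⟩ := hγΓ h hh
    refine ⟨k, ?_⟩
    rw [inner_add_left, inner_smul_left, real_inner_comm, hhδ] at hk
    simpa using hk⟩ (smul_ne_zero hβ hb0) ⟨β, rfl⟩
  have hbpos : 0 < ‖b‖ := norm_pos_iff.2 hb0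
  rw [norm_smul, Real.norm_eq_abs] at hnorm
  rw [inner_add_right, inner_smul_right, inner_smul_right, hbδ, mul_zero, zero_add,
    real_inner_self_eq_norm_sq, abs_mul, abs_of_nonneg (sq_nonneg ‖b‖)]
  nlinarith

lemma norm_toLp_ofReal (γ : EuclideanSpace ℝ (Fin d)) :
    ‖(WithLp.toLp 2 (fun i => ((γ i : ℝ) : ℂ)) : EuclideanSpace ℂ (Fin d))‖ = ‖γ‖ := by
  simp [EuclideanSpace.norm_eq]

lemma norm_planeTerm (x γ : EuclideanSpace ℝ (Fin d)) :
    ‖planeTerm B q b x γ‖ = ‖fourierCoeff B q γ‖ * ‖γ‖ / |inner ℝ b γ| := by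
  have h : ‖Complex.exp (Complex.I * ((inner ℝ γ x : ℝ) : ℂ))‖ = 1 := norm_expI _
  rw [planeTerm, norm_smul, norm_div, norm_mul, h, norm_toLp_ofReal, Complex.norm_real,
    Real.norm_eq_abs]
  ring

lemma summable_planeTerm_bound {s : ℝ} (hq : IsPeriodicSobolev B s q) (hs : d + 2 < 2 * s)
    (hb : IsMaximalElement (dualLatticePerp B δ) b) :
    Summable fun γ : planeIndices B δ b =>
      ‖fourierCoeff B q γ‖ * ‖(γ : EuclideanSpace ℝ (Fin d))‖ /
        |inner ℝ b (γ : EuclideanSpace ℝ (Fin d))| := by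
  have hbpos : 0 < ‖b‖ := norm_pos_iff.2 hb.2.1
  have h := ((hq.summable_norm_mul hs).comp_injective
    (i := fun γ : planeIndices B δ b => (⟨γ, γ.2.1⟩ : dualLattice B))
    fun γ γ' h => Subtype.ext (congrArg (fun z : dualLattice B => z.1) h)).div_const (‖b‖ ^ 2)
  refine Summable.of_nonneg_of_le (fun γ => by positivity) (fun γ => ?_) h
  have := sq_norm_le_abs_inner hb γ.2
  simp only [Function.comp_apply]
  gcongr

lemma continuous_planePotential {s : ℝ} (hq : IsPeriodicSobolev B s q) (hs : d + 2 < 2 * s)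
    (hb : IsMaximalElement (dualLatticePerp B δ) b) :
    Continuous (planePotential B q δ b) := by
  refine continuous_tsum (fun γ => ?_) (summable_planeTerm_bound hq hs hb)
    fun _ x => (norm_planeTerm x _).le
  unfold planeTerm
  fun_prop

lemma exists_norm_planePotential_le {s : ℝ} (hq : IsPeriodicSobolev B s q) (hs : d + 2 < 2 * s)
    (hb : IsMaximalElement (dualLatticePerp B δ) b) :
    ∃ M : ℝ, ∀ x, ‖planePotential B q δ b x‖ ≤ M :=
  ⟨_, fun x => tsum_of_norm_bounded (summable_planeTerm_bound hq hs hb).hasSum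
    fun _ => (norm_planeTerm x _).le⟩

lemma integrableOn_weighted (hP : Continuous (planePotential B q δ b)) {A : ℝ → ℂ}
    (hA : Continuous A) :
    IntegrableOn (fun x => ((‖planePotential B q δ b x‖ ^ 2 : ℝ) : ℂ) * A (inner ℝ δ x))
      (cell B) := by
  have hc : IsCompact (closure (cell B)) :=
    (ZSpan.fundamentalDomain_isBounded B).isCompact_closure
  refine IntegrableOn.mono_set (ContinuousOn.integrableOn_compact hc ?_) subset_closure
  fun_prop

lemma weightedIntegral_add (hP : Continuous (planePotential B q δ b)) {A A' : ℝ → ℂ}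
    (hA : Continuous A) (hA' : Continuous A') :
    weightedIntegral B q δ b (fun ζ => A ζ + A' ζ) =
      weightedIntegral B q δ b A + weightedIntegral B q δ b A' := by
  simp only [weightedIntegral, mul_add]
  exact integral_add (integrableOn_weighted hP hA) (integrableOn_weighted hP hA')

lemma weightedIntegral_const_mul (c : ℂ) (A : ℝ → ℂ) :
    weightedIntegral B q δ b (fun ζ => c * A ζ) = c * weightedIntegral B q δ b A := by
  simp only [weightedIntegral, mul_left_comm _ c]
  exact integral_const_mul _ _

lemma weightedIntegral_sub_sum (hP : Continuous (planePotential B q δ b)) {A : ℝ → ℂ}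
    (hA : Continuous A) {A' : ℕ → ℝ → ℂ} (hA' : ∀ i, Continuous (A' i)) (c : ℕ → ℂ) (N : ℕ) :
    weightedIntegral B q δ b A -
        ∑ i ∈ Finset.range N, weightedIntegral B q δ b (A' i) / c i =
      weightedIntegral B q δ b (fun ζ => A ζ - ∑ i ∈ Finset.range N, A' i ζ / c i) := by
  induction N with
  | zero => simp
  | succ N ih =>
    have h := weightedIntegral_add hP
      (A := fun ζ => A ζ - ∑ i ∈ Finset.range N, A' i ζ / c i)
      (A' := fun ζ => (-(c N)⁻¹) * A' N ζ)
      (hA.sub (continuous_finsetSum _ fun i _ => (hA' i).div_const _))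
      (continuous_const.mul (hA' N))
    rw [weightedIntegral_const_mul, ← ih] at h
    rw [Finset.sum_range_succ, ← sub_sub]
    rw [div_eq_inv_mul, sub_eq_add_neg, ← neg_mul, ← h]
    congr 1
    funext ζ
    rw [Finset.sum_range_succ]
    ring

lemma norm_weightedIntegral_le (hvol : volume (cell B) = 1) {M c : ℝ}
    (hM : ∀ x, ‖planePotential B q δ b x‖ ≤ M) {A : ℝ → ℂ} (hA : ∀ ζ, ‖A ζ‖ ≤ c) :
    ‖weightedIntegral B q δ b A‖ ≤ M ^ 2 * c := by
  have h := norm_setIntegral_le_of_norm_le_const (μ := volume) (s := cell B) (C := M ^ 2 * c)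
    (f := fun x => ((‖planePotential B q δ b x‖ ^ 2 : ℝ) : ℂ) * A (inner ℝ δ x))
    (by rw [hvol]; exact ENNReal.one_lt_top) (fun x _ => by
      rw [norm_mul, Complex.norm_real, norm_pow, norm_norm]
      have := hM x
      have := hA (inner ℝ δ x)
      gcongr)
  simpa [Measure.real, hvol, weightedIntegral] using h

lemma invariantJ_eq_weightedIntegral (f : ℝ → ℂ) :
    (invariantJ B q δ b f : ℂ) = weightedIntegral B q δ b fun ζ => ((‖f ζ‖ ^ 2 : ℝ) : ℂ) := by
  rw [invariantJ, weightedIntegral, ← integral_complex_ofReal]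
  refine integral_congr_ae (Filter.Eventually.of_forall fun x => ?_)
  simp only [norm_smul]
  push_cast
  ring

end

/-- The last coefficient of an asymptotic expansion in powers of `1/n` is a limit. -/
lemma tendsto_lastCoeff_of_expansion {J : ℤ → ℂ} {c : ℕ → ℂ} (k : ℕ) {C : ℝ} {N : ℕ}
    (h : ∀ n : ℤ, N < n.natAbs →
      ‖J n - ∑ i ∈ Finset.range (k + 1), c i / (n : ℂ) ^ i‖ ≤ C / |(n : ℝ)| ^ (k + 1)) :
    Filter.Tendsto (fun n : ℤ => (n : ℂ) ^ k * (J n - ∑ i ∈ Finset.range k, c i / (n : ℂ) ^ i))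
      Filter.cofinite (nhds (c k)) := by
  rw [tendsto_iff_norm_sub_tendsto_zero]
  have hlim : Filter.Tendsto (fun n : ℤ => C / |(n : ℝ)|) Filter.cofinite (nhds 0) :=
    ((tendsto_norm_cocompact_atTop (E := ℝ)).comp Int.tendsto_coe_cofinite).const_div_atTop C
  refine tendsto_of_tendsto_of_tendsto_of_le_of_le' tendsto_const_nhds hlim
    (Filter.Eventually.of_forall fun n => norm_nonneg _) ?_
  have hfin : {n : ℤ | ¬ N < n.natAbs}.Finite := by
    refine (Set.finite_Icc (-(N : ℤ)) N).subset fun n hn => ?_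
    simp only [Set.mem_ofPred_eq, not_lt] at hn
    constructor <;> omega
  filter_upwards [Filter.eventually_cofinite.2 hfin] with n hn
  have hn0 : (n : ℂ) ≠ 0 := by
    have : n ≠ 0 := by omega
    exact_mod_cast this
  have hpos : 0 < |(n : ℝ)| := by
    have : n ≠ 0 := by omega
    positivity
  have h1 : (n : ℂ) ^ k * (J n - ∑ i ∈ Finset.range k, c i / (n : ℂ) ^ i) - c k =
      (n : ℂ) ^ k * (J n - ∑ i ∈ Finset.range (k + 1), c i / (n : ℂ) ^ i) := by
    rw [Finset.sum_range_succ]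
    field_simp
    ring
  rw [h1, norm_mul, norm_pow, Complex.norm_intCast]
  calc |(n : ℝ)| ^ k * _ ≤ |(n : ℝ)| ^ k * (C / |(n : ℝ)| ^ (k + 1)) := by
        gcongr
        exact h n hn
    _ = C / |(n : ℝ)| := by
        field_simp
        ring

/-- The coefficients of an asymptotic expansion in powers of `1/n` are determined successively. -/
lemma tendsto_coeff_of_expansion {J : ℤ → ℂ} {c : ℕ → ℂ} (K : ℕ) {C : ℝ} {N : ℕ}
    (h : ∀ n : ℤ, N < n.natAbs →
      ‖J n - ∑ i ∈ Finset.range (K + 1), c i / (n : ℂ) ^ i‖ ≤ C / |(n : ℝ)| ^ (K + 1))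
    {k : ℕ} (hk : k ≤ K) :
    Filter.Tendsto (fun n : ℤ => (n : ℂ) ^ k * (J n - ∑ i ∈ Finset.range k, c i / (n : ℂ) ^ i))
      Filter.cofinite (nhds (c k)) := by
  induction K generalizing C with
  | zero =>
    obtain rfl := Nat.le_zero.1 hk
    exact tendsto_lastCoeff_of_expansion 0 h
  | succ K ih =>
    rcases hk.eq_or_lt with rfl | hk
    · exact tendsto_lastCoeff_of_expansion _ h
    · refine ih (C := C + ‖c (K + 1)‖) (fun n hn => ?_) (Nat.lt_succ_iff.1 hk)
      have h1 := h n hn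
      have hn1 : (1 : ℝ) ≤ |(n : ℝ)| := by
        have : (1 : ℤ) ≤ |n| := Int.one_le_abs (by omega)
        exact_mod_cast this
      rw [Finset.sum_range_succ, ← sub_sub] at h1
      have h2 := norm_le_norm_add_norm_sub'
        (J n - ∑ i ∈ Finset.range (K + 1), c i / (n : ℂ) ^ i) (c (K + 1) / (n : ℂ) ^ (K + 1))
      rw [norm_div, norm_pow, Complex.norm_intCast] at h2
      have hC : 0 ≤ C := by
        by_contra hC
        exact absurd ((norm_nonneg _).trans h1) (not_le.2 (div_neg_of_neg_of_pos (not_le.1 hC)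
          (by positivity)))
      have h3 : C / |(n : ℝ)| ^ (K + 1 + 1) ≤ C / |(n : ℝ)| ^ (K + 1) := by
        gcongr
        exact Nat.le_succ _
      rw [add_div]
      linarith

/-! ### The expansion coefficients and the invariant -/

section

variable {d : ℕ} {B : Module.Basis (Fin d) ℝ (EuclideanSpace ℝ (Fin d))}
  {q : EuclideanSpace ℝ (Fin d) → ℝ} {δ b : EuclideanSpace ℝ (Fin d)}

lemma fourierCoeff_neg (γ : EuclideanSpace ℝ (Fin d)) :
    fourierCoeff B q (-γ) = conj (fourierCoeff B q γ) := by
  rw [fourierCoeff, fourierCoeff, ← integral_conj]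
  congr 1
  funext x
  rw [map_mul, Complex.conj_ofReal, ← Complex.exp_conj]
  simp

lemma directionalProfile_eq_cosPotential (hδ : δ ≠ 0)
    (hdir : ∀ x, directionalPotential B q δ x =
      fourierCoeff B q δ * Complex.exp (Complex.I * ((inner ℝ δ x : ℝ) : ℂ)) +
      fourierCoeff B q (-δ) * Complex.exp (-(Complex.I * ((inner ℝ δ x : ℝ) : ℂ)))) :
    directionalProfile B q δ = cosPotential (fourierCoeff B q δ) := by
  funext ζ
  have hnorm : ‖δ‖ ≠ 0 := norm_ne_zero_iff.2 hδ
  have hζ : inner ℝ δ ((ζ / ‖δ‖ ^ 2) • δ) = ζ := by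
    rw [inner_smul_right, real_inner_self_eq_norm_sq]
    field_simp
  have h := hdir ((ζ / ‖δ‖ ^ 2) • δ)
  rwa [directionalPotential, hζ, fourierCoeff_neg] at h

/-- The coefficients `A k` of the expansion of `|φ n|²` in powers of `1/n`, for
`D = |δ|²` and the potential `cosPotential q`. -/
noncomputable def densityCoeff (D v : ℝ) (q : ℂ) (k : ℕ) (ζ : ℝ) : ℂ :=
  match k with
  | 0 => 1
  | 2 => cosPotential q ζ / (2 * D)
  | 3 => (-v / D : ℝ) * cosPotential q ζ
  | 4 => ((12 * v ^ 2 + 1) / (8 * D) : ℝ) * cosPotential q ζ +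
      (3 / (8 * D ^ 2) : ℝ) * (q ^ 2 * Complex.exp (Complex.I * (2 * ζ)) +
        conj q ^ 2 * Complex.exp (-(Complex.I * (2 * ζ))))
  | _ => 0

lemma continuous_densityCoeff (D v : ℝ) (q : ℂ) (k : ℕ) : Continuous (densityCoeff D v q k) := by
  have := continuous_cosPotential q
  unfold densityCoeff
  split <;> fun_prop

lemma sum_densityCoeff (D v : ℝ) (q : ℂ) (n : ℤ) (ζ : ℝ) :
    ∑ k ∈ Finset.range 5, densityCoeff D v q k ζ / (n : ℂ) ^ k =
      1 + (firstHarmonic v n / D : ℝ) * cosPotential q ζ +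
        (3 / (8 * n ^ 4) / D ^ 2 : ℝ) * (q ^ 2 * Complex.exp (Complex.I * (2 * ζ)) +
          conj q ^ 2 * Complex.exp (-(Complex.I * (2 * ζ)))) := by
  simp only [Finset.sum_range_succ, Finset.sum_range_zero, densityCoeff, firstHarmonic]
  push_cast
  ring

/-- Since `A 2` and the first part of `A 4` are both multiples of the potential, a combination of
`J 2` and `J 4` isolates the second harmonic. -/
lemma weightedIntegral_secondHarmonic (hP : Continuous (planePotential B q δ b)) {D : ℝ}
    (hD : D ≠ 0) (v : ℝ) (c : ℂ) :
    weightedIntegral B q δ b (fun ζ => c ^ 2 * Complex.exp (Complex.I * (2 * ζ)) +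
        conj c ^ 2 * Complex.exp (-(Complex.I * (2 * ζ)))) =
      8 * (D : ℂ) ^ 2 / 3 * (weightedIntegral B q δ b (densityCoeff D v c 4) -
        (12 * (v : ℂ) ^ 2 + 1) / 4 * weightedIntegral B q δ b (densityCoeff D v c 2)) := by
  have hDc : (D : ℂ) ≠ 0 := by exact_mod_cast hD
  have h := weightedIntegral_add hP
    (A := fun ζ => 8 * (D : ℂ) ^ 2 / 3 * densityCoeff D v c 4 ζ)
    (A' := fun ζ => -(8 * (D : ℂ) ^ 2 / 3 * ((12 * (v : ℂ) ^ 2 + 1) / 4)) * densityCoeff D v c 2 ζ)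
    (continuous_const.mul (continuous_densityCoeff D v c 4))
    (continuous_const.mul (continuous_densityCoeff D v c 2))
  rw [weightedIntegral_const_mul, weightedIntegral_const_mul] at h
  rw [mul_sub, sub_eq_add_neg, ← mul_assoc, ← neg_mul, ← h]
  congr 1
  funext ζ
  simp only [densityCoeff]
  push_cast
  field_simp
  ring

end

end PeriodicSchrodinger

open PeriodicSchrodinger in
theorem mainTheorem6 (d : ℕ) (hd : 2 ≤ d)
    (B : Module.Basis (Fin d) ℝ (EuclideanSpace ℝ (Fin d)))
    (hvol : MeasureTheory.volume (cell B) = 1)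
    (s : ℝ) (hs : 6 * (3 ^ d * ((d : ℝ) + 1) ^ 2) + d ≤ s)
    (q : EuclideanSpace ℝ (Fin d) → ℝ)
    (hq : IsPeriodicSobolev B s q) (hq0 : fourierCoeff B q 0 = 0)
    (δ : EuclideanSpace ℝ (Fin d)) (hδ : IsMaximalElement (dualLattice B) δ)
    (hdir : ∀ x, directionalPotential B q δ x =
      fourierCoeff B q δ * Complex.exp (Complex.I * ((inner ℝ δ x : ℝ) : ℂ)) +
      fourierCoeff B q (-δ) * Complex.exp (-(Complex.I * ((inner ℝ δ x : ℝ) : ℂ))))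
    (v : ℝ) (hv : v ∈ Set.Ioo (0 : ℝ) (1 / 2) ∪ Set.Ioo (1 / 2 : ℝ) 1)
    (μ : ℤ → ℝ) (φ : ℤ → ℝ → ℂ)
    (hφ : IsEigenSystem (‖δ‖ ^ 2) (directionalProfile B q δ) v μ φ) :
    ∃ (A : ℕ → ℝ → ℂ) (a₁ a₂ a₃ a₄ a₅ a₆ : ℝ),
      -- the explicit constants
      (a₁ = 0 ∧ a₂ = -v / ‖δ‖ ^ 2 ∧ a₃ = 0 ∧ a₄ = (12 * v ^ 2 + 1) / (8 * ‖δ‖ ^ 2) ∧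
        a₅ = 3 / (8 * ‖δ‖ ^ 4) ∧ a₆ = 0) ∧
      -- the explicit coefficients
      (∀ ζ, A 0 ζ = 1) ∧
      (∀ ζ, A 1 ζ = 0) ∧
      (∀ ζ, A 2 ζ = directionalProfile B q δ ζ / (2 * (‖δ‖ : ℂ) ^ 2) +
        a₁ * (‖fourierCoeff B q δ‖ : ℂ) ^ 2) ∧
      (∀ ζ, A 3 ζ = a₂ * directionalProfile B q δ ζ + a₃ * (‖fourierCoeff B q δ‖ : ℂ) ^ 2) ∧
      (∀ ζ, A 4 ζ = a₄ * directionalProfile B q δ ζ +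
        a₅ * (fourierCoeff B q δ ^ 2 * Complex.exp (Complex.I * (2 * ζ)) +
          fourierCoeff B q (-δ) ^ 2 * Complex.exp (-(Complex.I * (2 * ζ)))) + a₆) ∧
      -- the expansion of the squared modulus, uniformly in the variable
      (∃ (C : ℝ) (N : ℕ), ∀ n : ℤ, N < n.natAbs → ∀ ζ : ℝ,
        ‖((‖φ n ζ‖ ^ 2 : ℝ) : ℂ) - ∑ k ∈ Finset.range 5, A k ζ / (n : ℂ) ^ k‖
          ≤ C / |(n : ℝ)| ^ 5) ∧
      -- the resulting determination of the invariant
      (∀ b, IsMaximalElement (dualLatticePerp B δ) b →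
        (∀ x, Summable (fun γ : planeIndices B δ b => ‖planeTerm B q b x γ‖)) ∧
        (∀ k ≤ 4, Filter.Tendsto
          (fun n : ℤ => (n : ℂ) ^ k * ((invariantJ B q δ b (φ n) : ℂ) -
            ∑ i ∈ Finset.range k, weightedIntegral B q δ b (A i) / (n : ℂ) ^ i))
          Filter.cofinite (nhds (weightedIntegral B q δ b (A k)))) ∧
        weightedIntegral B q δ b (fun ζ =>
            fourierCoeff B q δ ^ 2 * Complex.exp (Complex.I * (2 * ζ)) +
            fourierCoeff B q (-δ) ^ 2 * Complex.exp (-(Complex.I * (2 * ζ)))) =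
          8 * (‖δ‖ : ℂ) ^ 4 / 3 * (weightedIntegral B q δ b (A 4) -
            (12 * (v : ℂ) ^ 2 + 1) / 4 * weightedIntegral B q δ b (A 2))) := by
  have hδ0 : δ ≠ 0 := hδ.2.1
  have hD : 0 < ‖δ‖ ^ 2 := by positivity
  have hs' : (d : ℝ) + 2 < 2 * s := by
    have h3 : (1 : ℝ) ≤ 3 ^ d := one_le_pow₀ (by norm_num)
    have hd0 : (0 : ℝ) ≤ d := Nat.cast_nonneg d
    nlinarith [mul_le_mul h3 (one_le_pow₀ (by linarith : (1 : ℝ) ≤ d + 1) : (1 : ℝ) ≤ (d + 1) ^ 2)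
      zero_le_one (by positivity)]
  have hprof := directionalProfile_eq_cosPotential hδ0 hdir
  rw [hprof] at hφ ⊢
  rw [fourierCoeff_neg]
  obtain ⟨C, R, hexp⟩ := hφ.exists_density_expansion hD hv
  have hexp' : ∀ n : ℤ, ⌈R⌉₊ < n.natAbs → ∀ ζ : ℝ,
      ‖((‖φ n ζ‖ ^ 2 : ℝ) : ℂ) - ∑ k ∈ Finset.range 5,
        densityCoeff (‖δ‖ ^ 2) v (fourierCoeff B q δ) k ζ / (n : ℂ) ^ k‖ ≤ C / |(n : ℝ)| ^ 5 := by
    intro n hn ζ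
    rw [sum_densityCoeff]
    refine hexp n ((Nat.le_ceil R).trans ?_) ζ
    rw [← Int.cast_abs, Int.abs_eq_natAbs]
    exact_mod_cast hn.le
  refine ⟨densityCoeff (‖δ‖ ^ 2) v (fourierCoeff B q δ), 0, -v / ‖δ‖ ^ 2, 0,
    (12 * v ^ 2 + 1) / (8 * ‖δ‖ ^ 2), 3 / (8 * ‖δ‖ ^ 4), 0, ⟨rfl, rfl, rfl, rfl, rfl, rfl⟩,
    fun ζ => rfl, fun ζ => rfl, fun ζ => ?_, fun ζ => ?_, fun ζ => ?_, ⟨C, ⌈R⌉₊, hexp'⟩,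
    fun b hb => ?_⟩
  · simp [densityCoeff]
  · simp [densityCoeff]
  · simp only [densityCoeff]
    push_cast
    ring
  have hP := continuous_planePotential hq hs' hb
  obtain ⟨M, hM⟩ := exists_norm_planePotential_le hq hs' hb
  refine ⟨fun x => ?_, fun k hk => ?_, ?_⟩
  · simpa only [norm_planeTerm] using summable_planeTerm_bound hq hs' hb
  · refine tendsto_coeff_of_expansion (C := M ^ 2 * C) (N := ⌈R⌉₊) 4 (fun n hn => ?_) hk
    have hcont : Continuous fun ζ => ((‖φ n ζ‖ ^ 2 : ℝ) : ℂ) := by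
      have := (hφ.solves n).continuous
      fun_prop
    rw [invariantJ_eq_weightedIntegral, weightedIntegral_sub_sum hP hcont
      (continuous_densityCoeff _ v _) (fun i => (n : ℂ) ^ i), mul_div_assoc]
    exact norm_weightedIntegral_le hvol hM (hexp' n hn)
  · rw [weightedIntegral_secondHarmonic hP hD.ne' v]
    push_cast
    ring_nf
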